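/- All graphs are finite and simple. For a graph $H$ let $|H|$ be its order, $\alpha_H$ its independence number and $\gamma_H=|H|-\alpha_H-1$. Let $\mathbb H$ be a nonempty (finite or infinite) family of graphs, each of minimum degree at least $1$ and none of them isomorphic to a star $K_{1,t}$, and put $\gamma_{\mathbb H}=\min_{H\in\mathbb H}\gamma_H$. A graph is $\mathbb H$-minor-free if no member of $\mathbb H$ is a minor of it, and $\mathbb H$-minor-saturated if it is $\mathbb H$-minor-free but adding any edge between two distinct non-adjacent vertices produces a graph that has some member of $\mathbb H$ as a minor. Let $SAT(n,\mathbb H_{minor})$ be the set of $n$-vertex $\mathbb H$-minor-saturated graphs, and let $SPEX(n,\mathbb H_{minor})$ be the set of $n$-vertex $\mathbb H$-minor-free graphs whose adjacency spectral radius is maximum among all $n$-vertex $\mathbb H$-minor-free graphs. For $s\ge 0$ let $\Gamma_s(H)$ be the set of $s$-vertex induced subgraphs of $H$, and let $\Gamma_s^*(H)$ be the set of those $K\in\Gamma_s(H)$ that are irreducible, i.e. such that no member of $\Gamma_s(H)$ is isomorphic to a proper subgraph of $K$. Put $$\Gamma(\mathbb H)=\bigcup_{H\in\mathbb H}\Gamma^*_{|H|-\gamma_{\mathbb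 H}}(H).$$ **Theorem.** There is an $N$, depending only on $\mathbb H$, such that the following holds for all $n\ge N$ and all $G^*\in SPEX(n,\mathbb H_{minor})$. Let $L$ be the set of dominating vertices of $G^*$, i.e. of the vertices adjacent to all other vertices. Then $|L|=\gamma_{\mathbb H}$ and $$G^*-L\in SAT\big(n-\gamma_{\mathbb H},\Gamma(\mathbb H)_{minor}\big).$$ In particular, if $\mathbb H=\{H\}$, then $G^*-L\in SAT\big(n-\gamma_H,\Gamma^*_{\alpha_H+1}(H)_{minor}\big)$. -/

import Mathlib

/-- A finite simple graph. -/
structure FinGraph where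
  V : Type
  [finite : Finite V]
  graph : SimpleGraph V

namespace FinGraph

attribute [instance] FinGraph.finite

/-- The order `|G|`. -/
noncomputable def order (G : FinGraph) : ℕ := Nat.card G.V

/-- The subgraph `G[S]` induced by a set `S` of vertices. -/
def induce (G : FinGraph) (S : Set G.V) : FinGraph where
  V := S
  graph := G.graph.induce S

/-- The graph `G - S` obtained by deleting a set `S` of vertices. -/
def delete (G : FinGraph) (S : Set G.V) : FinGraph := G.induce Sᶜ

/-- The graph `G + uv`. -/
def addEdge (G : FinGraph) (u v : G.V) : FinGraph where
  V := G.V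
  graph := G.graph ⊔ SimpleGraph.edge u v

/-- `H` is a minor of `G`: there is a model of `H` in `G`, that is, a family of pairwise disjoint
(nonempty) connected branch sets in `G`, one for each vertex of `H`, such that `G` has an edge
between the branch sets of any two adjacent vertices of `H`. -/
def IsMinor (H G : FinGraph) : Prop :=
  ∃ B : H.V → Set G.V,
    (∀ v, (G.graph.induce (B v)).Connected) ∧
    (∀ v w, v ≠ w → Disjoint (B v) (B w)) ∧
    (∀ v w, H.graph.Adj v w → ∃ x ∈ B v, ∃ y ∈ B w, G.graph.Adj x y)

/-- `G` contains no member of the family `F` as a minor. -/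
def MinorFree (F : Set FinGraph) (G : FinGraph) : Prop := ∀ H ∈ F, ¬ H.IsMinor G

/-- `G` is `F`-minor-saturated: it is `F`-minor-free, but the addition of any edge creates a
member of `F` as a minor. -/
def MinorSaturated (F : Set FinGraph) (G : FinGraph) : Prop :=
  G.MinorFree F ∧
    ∀ u v : G.V, u ≠ v → ¬ G.graph.Adj u v → ∃ H ∈ F, H.IsMinor (G.addEdge u v)

/-- `SAT(n, F_minor)`: the `n`-vertex `F`-minor-saturated graphs. -/
def SAT (n : ℕ) (F : Set FinGraph) : Set FinGraph :=
  {G | G.order = n ∧ G.MinorSaturated F}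

open Classical in
/-- The spectral radius of (the adjacency matrix of) `G`. The matrix is real symmetric, so all its
eigenvalues are real. -/
noncomputable def rho (G : FinGraph) : ENNReal :=
  letI := Fintype.ofFinite G.V
  spectralRadius ℝ (G.graph.adjMatrix ℝ)

/-- `SPEX(n, F_minor)`: the `n`-vertex `F`-minor-free graphs whose spectral radius is maximal among
all `n`-vertex `F`-minor-free graphs. -/
def SPEX (n : ℕ) (F : Set FinGraph) : Set FinGraph :=
  {G | G.order = n ∧ G.MinorFree F ∧
    ∀ G' : FinGraph, G'.order = n → G'.MinorFree F → G'.rho ≤ G.rho}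

/-- The set of dominating vertices: those adjacent to every other vertex. -/
def dominatingVertices (G : FinGraph) : Set G.V :=
  G.graph.universalVerts

/-- The independence number `α_H`. -/
noncomputable def alpha (H : FinGraph) : ℕ := H.graph.indepNum

/-- `γ_H = |H| - α_H - 1`. The natural subtraction is not truncated as soon as `H` has an edge. -/
noncomputable def gamma (H : FinGraph) : ℕ := H.order - H.alpha - 1

/-- `γ_F = min {γ_H : H ∈ F}` for a nonempty family `F`. -/
noncomputable def familyGamma (F : Set FinGraph) : ℕ := sInf (gamma '' F)

/-- `H` is isomorphic to a star `K_{1,t}`. -/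
def IsStar (H : FinGraph) : Prop :=
  ∃ t : ℕ, Nonempty (H.graph ≃g completeBipartiteGraph (Fin 1) (Fin t))

/-- `H` has at least one vertex and no isolated vertices, i.e. minimum degree at least one. -/
def MinDegreePos (H : FinGraph) : Prop :=
  Nonempty H.V ∧ ∀ v, ∃ w, H.graph.Adj v w

/-- `Γ_s(H)`: the `s`-vertex induced subgraphs of `H`. -/
def inducedSubgraphs (s : ℕ) (H : FinGraph) : Set FinGraph :=
  {K | ∃ S : Set H.V, S.ncard = s ∧ K = H.induce S}

/-- `K` is isomorphic to a proper subgraph of `G`. -/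
def IsoProperSubgraph (K G : FinGraph) : Prop :=
  ∃ G' : G.graph.Subgraph, G' ≠ ⊤ ∧ Nonempty (K.graph ≃g G'.coe)

/-- `Γ*_s(H)`: the irreducible members `K` of `Γ_s(H)`, i.e. those for which no member of `Γ_s(H)`
is isomorphic to a proper subgraph of `K`. -/
def irreducibleInduced (s : ℕ) (H : FinGraph) : Set FinGraph :=
  {K | K ∈ inducedSubgraphs s H ∧ ∀ K' ∈ inducedSubgraphs s H, ¬ K'.IsoProperSubgraph K}

/-- `Γ(F) = ⋃_{H ∈ F} Γ*_{|H| - γ_F}(H)`. -/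
def Gam (F : Set FinGraph) : Set FinGraph :=
  ⋃ H ∈ F, irreducibleInduced (H.order - familyGamma F) H

end FinGraph

/-! ### Connected vertex sets, minor models and joins with a clique. -/

section

open Set

namespace SimpleGraph

variable {U V W : Type*}

/-! Write `k` for the minimum of `γ_H` over the family and let `H₀` attain it. A `k`-clique joined
to an independent set is minor-free for the whole family, since any `α_H + 1` vertices of `H` span
an edge. Hence an extremal graph `G` has spectral radius `r` with `r² ≥ k(n - k)`. On the other
hand, excluding `H₀` makes `G` sparse (Mader, `exists_top_model_of_le_degSum`) and bounds the number
of common neighbours of any `k + 1` vertices (`card_common_neighbors_lt`). Counting walks of length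
two against the Perron vector, scaled to maximum one, then shows that exactly `k` vertices `L` have
entries near one and almost full degree, while all other entries are small (`exists_dominant_set`).

To see that `L` is dominating, let `B` be the common neighbours of `L` and `A` the few remaining
vertices outside `L`. Delete all edges at `A` and at a bounded reserve `W ⊆ B`, apart from those to
`L`, and make `L` dominating. If `A` is nonempty or `L` is not a clique, this raises the quadratic
form above `r` times the squared norm of some vector (`IsExchange.exists_lt_quadForm`). The new
graph must therefore be shown to be minor-free. For members of bounded order this holds because a
model in the new graph can be rerouted through `W` to a model in `G`
(`MinorOf.of_joinGraph_restrict`). An infinite family is reduced to bounded order in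
`exists_order_bound`: the part outside the clique has no `K_{1,α}` minor with `α = α_{H₀}`, and
graphs without such a minor are well-quasi-ordered by minors. Their components consist of boundedly
many vertices and paths, so Dickson's lemma handles components and Higman's lemma handles their
multisets.

Once `L` is dominating, `H` is a minor of `G` exactly when some induced subgraph of `H` on `|H| - k`
vertices is a minor of `G - L` (`minorOf_joinGraph_iff`), and such a subgraph can be chosen
irreducible by minimizing its edges. The same equivalence applies to `G + uv`. A dominating vertex
makes the Perron vector positive, so adding an edge strictly increases the spectral radius, and
extremality becomes saturation. -/

/-- A vertex set induces a connected subgraph iff it is nonempty and every vertex set meeting it and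
closed under adjacency inside it contains it. -/
theorem connected_induce_iff_closed {G : SimpleGraph V} {S : Set V} :
    (G.induce S).Connected ↔ S.Nonempty ∧ ∀ T : Set V, (∃ x ∈ S, x ∈ T) →
      (∀ x ∈ S, x ∈ T → ∀ y ∈ S, G.Adj x y → y ∈ T) → S ⊆ T := by
  constructor
  · intro h
    refine ⟨nonempty_coe_sort.mp h.nonempty, ?_⟩
    rintro T ⟨x, hxS, hxT⟩ hcl y hy
    obtain ⟨p⟩ := h.preconnected ⟨x, hxS⟩ ⟨y, hy⟩
    have key : ∀ (a b : S) (_ : (G.induce S).Walk a b), a.1 ∈ T → b.1 ∈ T := by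
      intro a b p
      induction p with
      | nil => exact id
      | cons hadj _ ih => exact fun ha => ih (hcl _ (Subtype.property _) ha _ (Subtype.property _) hadj)
    exact key _ _ p hxT
  · rintro ⟨⟨x, hx⟩, h⟩
    rw [connected_iff_exists_forall_reachable]
    refine ⟨⟨x, hx⟩, ?_⟩
    have := h {y | ∃ hy : y ∈ S, (G.induce S).Reachable ⟨x, hx⟩ ⟨y, hy⟩} ⟨x, hx, hx, Reachable.refl _⟩ ?_
    · rintro ⟨y, hy⟩
      exact (this hy).2
    · rintro a ha ⟨_, hr⟩ b hb hab
      exact ⟨hb, hr.trans (Adj.reachable (G := G.induce S) (u := ⟨a, ha⟩) (v := ⟨b, hb⟩) hab)⟩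

theorem connected_induce_singleton (G : SimpleGraph V) (v : V) : (G.induce {v}).Connected := by
  rw [connected_induce_iff_closed]
  refine ⟨singleton_nonempty v, ?_⟩
  rintro T ⟨x, rfl, hx⟩ -
  simpa using hx

theorem connected_induce_mono {G G' : SimpleGraph V} (h : G ≤ G') {S : Set V}
    (hS : (G.induce S).Connected) : (G'.induce S).Connected :=
  hS.mono (fun _ _ hab => h hab)

/-- The image of a connected vertex set under a family of connected, compatibly linked sets is
connected. -/
theorem connected_induce_biUnion {G : SimpleGraph V} {K : SimpleGraph U} {S : Set U}
    {B : U → Set V} (hS : (K.induce S).Connected) (hB : ∀ x ∈ S, (G.induce (B x)).Connected)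
    (hadj : ∀ x ∈ S, ∀ y ∈ S, K.Adj x y → ∃ a ∈ B x, ∃ b ∈ B y, G.Adj a b) :
    (G.induce (⋃ x ∈ S, B x)).Connected := by
  rw [connected_induce_iff_closed] at hS ⊢
  have hB' := fun x hx => connected_induce_iff_closed.mp (hB x hx)
  obtain ⟨⟨x, hx⟩, hcl⟩ := hS
  refine ⟨?_, ?_⟩
  · obtain ⟨a, ha⟩ := (hB' x hx).1
    exact ⟨a, mem_biUnion hx ha⟩
  · rintro T ⟨a, ha, haT⟩ hT
    have full : ∀ y ∈ S, ∀ b ∈ B y, b ∈ T → B y ⊆ T := fun y hy b hb hbT =>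
      (hB' y hy).2 T ⟨b, hb, hbT⟩ fun c hc hcT d hd hcd =>
        hT c (mem_biUnion hy hc) hcT d (mem_biUnion hy hd) hcd
    obtain ⟨y, hy, hay⟩ := mem_iUnion₂.mp ha
    have := hcl {y | B y ⊆ T} ⟨y, hy, full y hy a hay haT⟩ (by
      intro u hu huT v hv huv
      obtain ⟨c, hc, d, hd, hcd⟩ := hadj u hu v hv huv
      exact full v hv d hd (hT c (mem_biUnion hu hc) (huT hc) d (mem_biUnion hv hd) hcd))
    exact iUnion₂_subset this

/-- `B` is a model of `H` in `G`. -/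
structure IsModel (H : SimpleGraph U) (G : SimpleGraph V) (B : U → Set V) : Prop where
  connected : ∀ v, (G.induce (B v)).Connected
  disjoint : ∀ v w, v ≠ w → Disjoint (B v) (B w)
  adj : ∀ v w, H.Adj v w → ∃ x ∈ B v, ∃ y ∈ B w, G.Adj x y

/-- `H` is a minor of `G`. -/
def MinorOf (H : SimpleGraph U) (G : SimpleGraph V) : Prop := ∃ B : U → Set V, IsModel H G B

theorem MinorOf.of_injective {H : SimpleGraph U} {G : SimpleGraph V} (f : U → V)
    (hf : Function.Injective f) (h : ∀ v w, H.Adj v w → G.Adj (f v) (f w)) : MinorOf H G :=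
  ⟨fun v => {f v}, fun v => connected_induce_singleton G _,
    fun v w hvw => by simpa using fun h => hvw (hf h),
    fun v w hvw => ⟨f v, rfl, f w, rfl, h v w hvw⟩⟩

theorem MinorOf.refl (G : SimpleGraph V) : MinorOf G G :=
  MinorOf.of_injective id Function.injective_id fun _ _ h => h

theorem MinorOf.trans {K : SimpleGraph U} {H : SimpleGraph V} {G : SimpleGraph W}
    (h₁ : MinorOf K H) (h₂ : MinorOf H G) : MinorOf K G := by
  obtain ⟨B, hB⟩ := h₁
  obtain ⟨C, hC⟩ := h₂
  refine ⟨fun v => ⋃ x ∈ B v, C x, ?_, ?_, ?_⟩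
  · exact fun v => connected_induce_biUnion (hB.connected v) (fun x _ => hC.connected x)
      fun x _ y _ hxy => hC.adj x y hxy
  · intro v w hvw
    simp only [disjoint_iUnion_left, disjoint_iUnion_right]
    intro x hx y hy
    exact hC.disjoint _ _ fun h => Set.disjoint_left.mp (hB.disjoint v w hvw) (h ▸ hy) hx
  · intro v w hvw
    obtain ⟨x, hx, y, hy, hxy⟩ := hB.adj v w hvw
    obtain ⟨a, ha, b, hb, hab⟩ := hC.adj x y hxy
    exact ⟨a, mem_biUnion hx ha, b, mem_biUnion hy hb, hab⟩

/-- The image of a set that is connected in an induced subgraph is connected. -/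
theorem connected_induce_image_val {G : SimpleGraph V} {S : Set V} {T : Set S}
    (h : ((G.induce S).induce T).Connected) : (G.induce (Subtype.val '' T)).Connected := by
  have := connected_induce_biUnion (G := G) (B := fun x : S => {x.1}) h
    (fun x _ => connected_induce_singleton G _) (fun x _ y _ hxy => ⟨x, rfl, y, rfl, hxy⟩)
  convert this using 2 <;> simp [Set.image_eq_iUnion]

theorem connected_induce_preimage_val {G : SimpleGraph V} {S T : Set V} (hTS : T ⊆ S)
    (h : (G.induce T).Connected) :
    ((G.induce S).induce (Subtype.val ⁻¹' T)).Connected := by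
  rw [connected_induce_iff_closed] at h ⊢
  obtain ⟨⟨x, hx⟩, hcl⟩ := h
  refine ⟨⟨⟨x, hTS hx⟩, hx⟩, ?_⟩
  rintro Q ⟨a, ha, haQ⟩ hQ
  have := hcl (Subtype.val '' Q) ⟨a, ha, a, haQ, rfl⟩ (by
    rintro _ hb ⟨b, hbQ, rfl⟩ c hc hbc
    exact ⟨⟨c, hTS hc⟩, hQ b hb hbQ ⟨c, hTS hc⟩ hc hbc, rfl⟩)
  intro y hy
  obtain ⟨z, hz, hzy⟩ := this hy
  rwa [← Subtype.ext hzy]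

/-- A minor of an induced subgraph, seen through branch sets inside the vertex set. -/
theorem minorOf_induce_iff {H : SimpleGraph U} {G : SimpleGraph V} {S : Set V} :
    MinorOf H (G.induce S) ↔ ∃ B : U → Set V, IsModel H G B ∧ ∀ v, B v ⊆ S := by
  constructor
  · rintro ⟨B, hB⟩
    refine ⟨fun v => Subtype.val '' B v, ⟨fun v => connected_induce_image_val (hB.connected v),
      fun v w hvw => (disjoint_image_iff Subtype.val_injective).mpr (hB.disjoint v w hvw), ?_⟩, ?_⟩
    · intro v w hvw
      obtain ⟨x, hx, y, hy, hxy⟩ := hB.adj v w hvw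
      exact ⟨x, ⟨x, hx, rfl⟩, y, ⟨y, hy, rfl⟩, hxy⟩
    · rintro v _ ⟨x, -, rfl⟩
      exact x.2
  · rintro ⟨B, hB, hS⟩
    refine ⟨fun v => Subtype.val ⁻¹' B v, fun v => connected_induce_preimage_val (hS v)
      (hB.connected v), fun v w hvw => (hB.disjoint v w hvw).preimage _, ?_⟩
    intro v w hvw
    obtain ⟨x, hx, y, hy, hxy⟩ := hB.adj v w hvw
    exact ⟨⟨x, hS v hx⟩, hx, ⟨y, hS w hy⟩, hy, hxy⟩

theorem IsModel.nonempty {H : SimpleGraph U} {G : SimpleGraph V} {B : U → Set V}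
    (hB : IsModel H G B) (v : U) : (B v).Nonempty :=
  (connected_induce_iff_closed.mp (hB.connected v)).1

/-- Two models, of `H[S]` and of `H[Sᶜ]`, with disjoint supports and all edges between them, give a
model of `H`. -/
theorem MinorOf.glue {H : SimpleGraph U} {G : SimpleGraph V} {S : Set U} {B C : U → Set V}
    (hB : ∀ v ∈ S, (G.induce (B v)).Connected)
    (hBd : ∀ v ∈ S, ∀ w ∈ S, v ≠ w → Disjoint (B v) (B w))
    (hBa : ∀ v ∈ S, ∀ w ∈ S, H.Adj v w → ∃ x ∈ B v, ∃ y ∈ B w, G.Adj x y)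
    (hC : ∀ v ∉ S, (G.induce (C v)).Connected)
    (hCd : ∀ v ∉ S, ∀ w ∉ S, v ≠ w → Disjoint (C v) (C w))
    (hCa : ∀ v ∉ S, ∀ w ∉ S, H.Adj v w → ∃ x ∈ C v, ∃ y ∈ C w, G.Adj x y)
    (hd : ∀ v ∈ S, ∀ w ∉ S, Disjoint (B v) (C w))
    (ha : ∀ v ∈ S, ∀ w ∉ S, H.Adj v w → ∃ x ∈ B v, ∃ y ∈ C w, G.Adj x y) : MinorOf H G := by
  classical
  refine ⟨fun v => if v ∈ S then B v else C v, ?_, ?_, ?_⟩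
  · intro v
    by_cases hv : v ∈ S
    · rw [if_pos hv]; exact hB v hv
    · rw [if_neg hv]; exact hC v hv
  · intro v w hvw
    by_cases hv : v ∈ S <;> by_cases hw : w ∈ S <;> simp only [hv, hw, if_true, if_false]
    exacts [hBd v hv w hw hvw, hd v hv w hw, (hd w hw v hv).symm, hCd v hv w hw hvw]
  · intro v w hvw
    by_cases hv : v ∈ S <;> by_cases hw : w ∈ S <;> simp only [hv, hw, if_true, if_false]
    · exact hBa v hv w hw hvw
    · exact ha v hv w hw hvw
    · obtain ⟨x, hx, y, hy, hxy⟩ := ha w hw v hv hvw.symm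
      exact ⟨y, hy, x, hx, hxy.symm⟩
    · exact hCa v hv w hw hvw

/-- The graph obtained from `R` by making every vertex of `L` adjacent to all other vertices. -/
def joinGraph (L : Set V) (R : SimpleGraph V) : SimpleGraph V where
  Adj u v := u ≠ v ∧ (u ∈ L ∨ v ∈ L ∨ R.Adj u v)
  symm := ⟨fun u v h => ⟨h.1.symm, by
    rcases h.2 with h | h | h
    exacts [Or.inr (Or.inl h), Or.inl h, Or.inr (Or.inr h.symm)]⟩⟩
  loopless := ⟨fun v h => h.1 rfl⟩

/-- `H` is a minor of the join of a `k`-clique with `R` iff some induced subgraph of `H` on all but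
`k` vertices is a minor of `R`. -/
theorem minorOf_joinGraph_iff [Finite U] [Finite V] {H : SimpleGraph U} {L : Set V}
    {R : SimpleGraph V} (hcard : L.ncard ≤ Nat.card U) :
    MinorOf H (joinGraph L R) ↔
      ∃ S : Set U, S.ncard + L.ncard = Nat.card U ∧ MinorOf (H.induce S) (R.induce Lᶜ) := by
  classical
  constructor
  · rintro ⟨B, hB⟩
    -- Disjoint branch sets can meet `L` at most `|L|` times. Discarding these vertices of `H`, and
    -- arbitrary further ones until exactly `|L|` are gone, leaves a model that avoids `L`.
    set T : Set U := {v | ∃ l ∈ L, l ∈ B v} with hT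
    have hTL : T.ncard ≤ L.ncard := by
      have : ∀ v, ∃ l, v ∈ T → l ∈ L ∧ l ∈ B v := fun v => by
        by_cases hv : v ∈ T
        · obtain ⟨l, hl⟩ := hv
          exact ⟨l, fun _ => hl⟩
        · obtain ⟨x, -⟩ := hB.nonempty v
          exact ⟨x, fun h => absurd h hv⟩
      choose f hf using this
      refine ncard_le_ncard_of_injOn f (fun v hv => (hf v hv).1) ?_ (toFinite _)
      intro v hv w hw hvw
      by_contra hne
      exact Set.disjoint_left.mp (hB.disjoint v w hne) (hf v hv).2 (hvw ▸ (hf w hw).2)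
    have hTc := ncard_add_ncard_compl T
    obtain ⟨S, hST, hS⟩ := exists_subset_card_eq (s := Tᶜ) (n := Nat.card U - L.ncard) (by omega)
    refine ⟨S, by omega, minorOf_induce_iff.mpr ⟨fun v => B v.1, ⟨?_, ?_, ?_⟩, ?_⟩⟩
    · intro v
      have hv : ∀ l ∈ L, l ∉ B v.1 := fun l hl hlB => hST v.2 ⟨l, hl, hlB⟩
      have := hB.connected v.1
      rw [connected_induce_iff_closed] at this ⊢
      refine ⟨this.1, fun Q h1 h2 => this.2 Q h1 fun x hx hxQ y hy hxy => h2 x hx hxQ y hy ?_⟩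
      rcases hxy.2 with h | h | h
      exacts [absurd hx (hv x h), absurd hy (hv y h), h]
    · exact fun v w hvw => hB.disjoint _ _ fun h => hvw (Subtype.ext h)
    · intro v w hvw
      obtain ⟨x, hx, y, hy, hxy⟩ := hB.adj v.1 w.1 hvw
      refine ⟨x, hx, y, hy, ?_⟩
      rcases hxy.2 with h | h | h
      exacts [absurd ⟨x, h, hx⟩ (hST v.2), absurd ⟨y, h, hy⟩ (hST w.2), h]
    · exact fun v x hx hxL => hST v.2 ⟨x, hxL, hx⟩
  · rintro ⟨S, hS, hM⟩
    obtain ⟨B, hB, hBL⟩ := minorOf_induce_iff.mp hM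
    have hSc := ncard_add_ncard_compl S
    obtain ⟨e⟩ : Nonempty ((Sᶜ : Set U) ≃ L) := Finite.card_eq.mp (by
      rw [Nat.card_coe_set_eq, Nat.card_coe_set_eq]; omega)
    have hle : R ≤ joinGraph L R := fun u v h => ⟨h.ne, Or.inr (Or.inr h)⟩
    refine MinorOf.glue (S := S) (B := fun v => if h : v ∈ S then B ⟨v, h⟩ else ∅)
      (C := fun v => if h : v ∈ S then ∅ else {(e ⟨v, h⟩).1}) ?_ ?_ ?_ ?_ ?_ ?_ ?_ ?_
    · intro v hv
      rw [dif_pos hv]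
      exact connected_induce_mono hle (hB.connected _)
    · intro v hv w hw hvw
      simp only [hv, hw, dif_pos]
      exact hB.disjoint _ _ fun h => hvw (congrArg Subtype.val h)
    · intro v hv w hw hvw
      simp only [hv, hw, dif_pos]
      obtain ⟨x, hx, y, hy, hxy⟩ := hB.adj ⟨v, hv⟩ ⟨w, hw⟩ hvw
      exact ⟨x, hx, y, hy, hle hxy⟩
    · intro v hv
      rw [dif_neg hv]
      exact connected_induce_singleton _ _
    · intro v hv w hw hvw
      simp only [hv, hw, dif_neg, not_false_eq_true, disjoint_singleton]
      exact fun h => hvw (congrArg Subtype.val (e.injective (Subtype.ext h)))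
    · intro v hv w hw hvw
      simp only [hv, hw, dif_neg, not_false_eq_true]
      exact ⟨_, rfl, _, rfl,
        fun h => hvw.ne (congrArg Subtype.val (e.injective (Subtype.ext h))), Or.inl (e _).2⟩
    · intro v hv w hw
      simp only [hv, hw, dif_pos, dif_neg, not_false_eq_true, disjoint_singleton_right]
      exact fun h => hBL _ h (e _).2
    · intro v hv w hw _
      simp only [hv, hw, dif_pos, dif_neg, not_false_eq_true]
      obtain ⟨x, hx⟩ := hB.nonempty ⟨v, hv⟩
      exact ⟨x, hx, _, rfl, fun h => hBL _ hx (h ▸ (e _).2), Or.inr (Or.inl (e _).2)⟩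

end SimpleGraph

end

/-! ### Star minors and vertices of degree at least three. -/

section

open Set

namespace SimpleGraph

variable {U V W : Type*}

/-- `G` has the star `K_{1,t}` as a minor: some connected set has at least `t` outer neighbours. -/
def HasStar (G : SimpleGraph V) (t : ℕ) : Prop :=
  ∃ (S : Set V) (Λ : Finset V), (G.induce S).Connected ∧ Λ.card = t ∧
    ∀ u ∈ Λ, u ∉ S ∧ ∃ s ∈ S, G.Adj s u

theorem HasStar.of_le {G : SimpleGraph V} {S : Set V} {Λ : Finset V} {t : ℕ}
    (hS : (G.induce S).Connected) (ht : t ≤ Λ.card)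
    (h : ∀ u ∈ Λ, u ∉ S ∧ ∃ s ∈ S, G.Adj s u) : HasStar G t := by
  obtain ⟨Λ', hsub, hcard⟩ := Finset.exists_subset_card_eq ht
  exact ⟨S, Λ', hS, hcard, fun u hu => h u (hsub hu)⟩

theorem HasStar.of_induce {G : SimpleGraph V} {X : Set V} {t : ℕ} (h : HasStar (G.induce X) t) :
    HasStar G t := by
  obtain ⟨S, Λ, hS, hcard, hΛ⟩ := h
  refine ⟨Subtype.val '' S, Λ.map (Function.Embedding.subtype _), connected_induce_image_val hS,
    by simpa using hcard, ?_⟩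
  intro u hu
  obtain ⟨u, hu', rfl⟩ := Finset.mem_map.mp hu
  obtain ⟨h1, s, hs, hsu⟩ := hΛ u hu'
  refine ⟨?_, s, ⟨s, hs, rfl⟩, hsu⟩
  rintro ⟨v, hv, hvu⟩
  exact h1 (by rwa [← Subtype.ext hvu])

theorem degree_lt_of_not_hasStar [Fintype V] {G : SimpleGraph V} [DecidableRel G.Adj] {t : ℕ}
    (h : ¬ HasStar G t) (v : V) : G.degree v < t := by
  by_contra! hd
  refine h (HasStar.of_le (connected_induce_singleton G v) (Λ := G.neighborFinset v) hd ?_)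
  intro u hu
  rw [mem_neighborFinset] at hu
  exact ⟨fun h => hu.ne (Eq.symm h), v, rfl, hu⟩

theorem Preconnected.mem_of_closed {G : SimpleGraph V} (hG : G.Preconnected) {T : Set V} {x y : V}
    (hx : x ∈ T) (hT : ∀ a ∈ T, ∀ b, G.Adj a b → b ∈ T) : y ∈ T := by
  obtain ⟨p⟩ := hG x y
  induction p with
  | nil => exact hx
  | cons hadj _ ih => exact ih (hT _ hx _ hadj)

/-- Every vertex of a cycle has two distinct neighbours on it, so no edge of a cycle can have an end
with a single neighbour. -/
theorem isAcyclic_of_forall_adj_subsingleton {G : SimpleGraph V}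
    (h : ∀ a b, G.Adj a b → (G.neighborSet a).Subsingleton ∨ (G.neighborSet b).Subsingleton) :
    G.IsAcyclic := by
  classical
  have key : ∀ (v : V) (p : G.Walk v v), p.IsCycle → ¬ (G.neighborSet v).Subsingleton := by
    intro v p hp hs
    exact hp.snd_ne_penultimate (hs (p.adj_snd hp.not_nil) (p.adj_penultimate hp.not_nil).symm)
  intro v p hp
  rcases h _ _ (p.adj_snd hp.not_nil) with hs | hs
  · exact key v p hp hs
  · exact key _ _ (hp.rotate (p.getVert_mem_support 1)) hs

/-- The closed neighbourhood of a vertex. -/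
noncomputable def closedNbhd [Fintype V] (G : SimpleGraph V) [DecidableRel G.Adj] [DecidableEq V]
    (v : V) : Finset V := insert v (G.neighborFinset v)

/-- Vertices of degree at least three with pairwise disjoint closed neighbourhoods in a connected
graph produce a star minor: extend their stars to a spanning tree and count its leaves. -/
theorem hasStar_of_pairwise_disjoint_closedNbhd [Fintype V] [DecidableEq V] {G : SimpleGraph V}
    [DecidableRel G.Adj] (hG : G.Connected) {X : Finset V} (hX : ∀ w ∈ X, 3 ≤ G.degree w)
    (hd : ∀ v ∈ X, ∀ w ∈ X, v ≠ w → Disjoint (closedNbhd G v) (closedNbhd G w)) :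
    HasStar G X.card := by
  classical
  rcases X.eq_empty_or_nonempty with rfl | ⟨w₀, hw₀⟩
  · obtain ⟨v⟩ := hG.nonempty
    exact ⟨{v}, ∅, connected_induce_singleton G v, rfl, by simp⟩
  -- The union of the full stars centred in `X`. Disjointness of the closed neighbourhoods makes
  -- each outer vertex a leaf, so `K` is a forest and extends to a spanning tree in which the
  -- vertices of `X` still have degree at least three.
  let K : SimpleGraph V :=
    { Adj := fun a b => G.Adj a b ∧ (a ∈ X ∨ b ∈ X)
      symm := ⟨fun a b h => ⟨h.1.symm, h.2.symm⟩⟩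
      loopless := ⟨fun a h => h.1.ne rfl⟩ }
  have hKG : K ≤ G := fun a b h => h.1
  have hmem : ∀ {a b}, G.Adj a b → b ∈ closedNbhd G a := fun {a b} h =>
    Finset.mem_insert_of_mem ((mem_neighborFinset _ _ _).mpr h)
  have hself : ∀ a, a ∈ closedNbhd G a := fun a => Finset.mem_insert_self _ _
  have hleaf : ∀ a b, a ∈ X → G.Adj a b → (K.neighborSet b).Subsingleton := by
    intro a b ha hab
    have hb : b ∉ X := fun hb =>
      Finset.disjoint_left.mp (hd a ha b hb hab.ne) (hmem hab) (hself b)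
    have : ∀ c, K.Adj b c → c = a := by
      rintro c ⟨hbc, h | hc⟩
      · exact absurd h hb
      · by_contra hne
        exact Finset.disjoint_left.mp (hd c hc a ha hne) (hmem hbc.symm) (hmem hab)
    intro c hc d hd
    rw [this c hc, this d hd]
  have hK : K.IsAcyclic := isAcyclic_of_forall_adj_subsingleton (by
    rintro a b ⟨hab, ha | hb⟩
    · exact Or.inr (hleaf a b ha hab)
    · exact Or.inl (hleaf b a hb hab.symm))
  obtain ⟨T, hKT, hTG, hT⟩ := hG.exists_isTree_le_of_le_of_isAcyclic hKG hK
  have hdeg3 : ∀ w ∈ X, 3 ≤ T.degree w := by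
    intro w hw
    refine (hX w hw).trans (Finset.card_le_card ?_)
    intro u hu
    rw [mem_neighborFinset] at hu ⊢
    exact hKT ⟨hu, Or.inl hw⟩
  have hpos : ∀ v, 1 ≤ T.degree v := by
    intro v
    have : Nontrivial V := by
      obtain ⟨u, hu⟩ := Finset.card_pos.mp (lt_of_lt_of_le (by norm_num) (hX w₀ hw₀))
      exact ⟨w₀, u, ((mem_neighborFinset _ _ _).mp hu).ne⟩
    exact hT.1.preconnected.degree_pos_of_nontrivial v
  set Λ : Finset V := Finset.univ.filter fun v => T.degree v = 1 with hΛ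
  have hsum : ∑ v, (T.degree v : ℤ) = 2 * Fintype.card V - 2 := by
    have h1 := T.sum_degrees_eq_twice_card_edges
    have h2 := hT.card_edgeFinset
    have h3 : ∑ v, (T.degree v : ℤ) = 2 * (T.edgeFinset.card : ℤ) := by exact_mod_cast h1
    rw [h3]; omega
  -- In a tree the numbers `deg - 2` sum to `-2`. Each vertex of `X` contributes at least `1` and
  -- only leaves contribute `-1`, so there are at least `|X| + 2` leaves.
  have hbound : ∀ v, (if v ∈ X then (1 : ℤ) else 0) - (if v ∈ Λ then 1 else 0) ≤
      (T.degree v : ℤ) - 2 := by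
    intro v
    have h1 := hpos v
    by_cases hv : v ∈ X
    · have h3 := hdeg3 v hv
      have : v ∉ Λ := by simp [hΛ]; omega
      simp only [hv, this, if_true, if_false]; omega
    · by_cases hl : v ∈ Λ
      · simp only [hv, hl, if_true, if_false]; omega
      · have : T.degree v ≠ 1 := by simpa [hΛ] using hl
        simp only [hv, hl, if_false]; omega
  have hcount : (X.card : ℤ) - Λ.card ≤ -2 := by
    have h := Finset.sum_le_sum fun v (_ : v ∈ Finset.univ) => hbound v
    simp only [Finset.sum_sub_distrib, Finset.sum_ite_mem, Finset.univ_inter, Finset.sum_const,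
      hsum, Finset.card_univ] at h
    simp only [nsmul_eq_mul, mul_one] at h
    linarith
  have hnbr : ∀ u ∈ Λ, ∃ s, T.Adj u s ∧ ∀ b, T.Adj u b → b = s := by
    intro u hu
    have : T.degree u = 1 := (Finset.mem_filter.mp hu).2
    obtain ⟨s, hs, hu⟩ := (T.degree_eq_one_iff_existsUnique_adj).mp this
    exact ⟨s, hs, hu⟩
  have hw₀Λ : w₀ ∉ Λ := fun h => by
    have := hdeg3 w₀ hw₀
    have := (Finset.mem_filter.mp h).2
    omega
  refine HasStar.of_le (S := {v | v ∉ Λ}) (Λ := Λ) ?_ (by omega) ?_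
  · refine connected_induce_mono hTG ((connected_iff _).mpr
      ⟨hT.1.preconnected.induce_of_degree_eq_one ?_, ⟨⟨w₀, hw₀Λ⟩⟩⟩)
    intro v hv
    obtain ⟨s, -, hs⟩ := hnbr v (by simpa using hv)
    intro c hc d hd
    rw [hs c hc, hs d hd]
  · intro u hu
    obtain ⟨s, hus, hs⟩ := hnbr u hu
    -- Two adjacent leaves would be the whole tree, leaving no place for `w₀`.
    refine ⟨fun h => h hu, s, fun hsΛ => ?_, hTG hus.symm⟩
    obtain ⟨u', hu', hs'⟩ := hnbr s hsΛ
    have : w₀ ∈ ({u, s} : Set V) := hT.1.preconnected.mem_of_closed (x := u) (by simp) (by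
      rintro a (rfl | rfl) b hab
      · exact Or.inr (hs b hab)
      · exact Or.inl ((hs' b hab).trans (hs' _ hus.symm).symm))
    rcases this with rfl | rfl
    exacts [hw₀Λ hu, hw₀Λ hsΛ]

/-- A connected graph without a `K_{1,t}` minor has boundedly many vertices of degree at least
three. -/
theorem card_three_le_degree_le [Fintype V] {G : SimpleGraph V} [DecidableRel G.Adj]
    (hG : G.Connected) {t : ℕ} (ht : ¬ HasStar G t) :
    (Finset.univ.filter fun v => 3 ≤ G.degree v).card ≤ t * (t * t) := by
  classical
  set Y := Finset.univ.filter fun v => 3 ≤ G.degree v with hY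
  let good : Finset (Finset V) := Y.powerset.filter fun X =>
    ∀ v ∈ X, ∀ w ∈ X, v ≠ w → Disjoint (closedNbhd G v) (closedNbhd G w)
  obtain ⟨X, hXg, hmax⟩ := good.exists_max_image Finset.card ⟨∅, by simp [good]⟩
  obtain ⟨hXY, hXd⟩ := Finset.mem_filter.mp hXg
  rw [Finset.mem_powerset] at hXY
  have hX : X.card ≤ t := by
    by_contra! hlt
    have := hasStar_of_pairwise_disjoint_closedNbhd hG
      (fun w hw => (Finset.mem_filter.mp (hXY hw)).2) hXd
    obtain ⟨S, Λ, hS, hc, hΛ⟩ := this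
    exact ht (HasStar.of_le hS (by omega) hΛ)
  have hN : ∀ v, (closedNbhd G v).card ≤ t := fun v =>
    (Finset.card_insert_le _ _).trans (degree_lt_of_not_hasStar ht v)
  -- By maximality of `X`, every vertex of degree at least three is within distance two of `X`;
  -- closed neighbourhoods have at most `t` elements.
  have hcov : Y ⊆ X.biUnion fun w => (closedNbhd G w).biUnion fun u => closedNbhd G u := by
    intro v hv
    have hself : ∀ a, a ∈ closedNbhd G a := fun a => Finset.mem_insert_self _ _
    by_cases hvX : v ∈ X
    · exact Finset.mem_biUnion.mpr ⟨v, hvX, Finset.mem_biUnion.mpr ⟨v, hself v, hself v⟩⟩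
    by_contra hcon
    have hdis : ∀ w ∈ X, Disjoint (closedNbhd G v) (closedNbhd G w) := by
      intro w hw
      rw [Finset.disjoint_left]
      intro u hu hu'
      refine hcon (Finset.mem_biUnion.mpr ⟨w, hw, Finset.mem_biUnion.mpr ⟨u, hu', ?_⟩⟩)
      rcases Finset.mem_insert.mp hu with rfl | h
      · exact hself _
      · exact Finset.mem_insert_of_mem (by simpa [adj_comm] using h)
    have := hmax (insert v X) (Finset.mem_filter.mpr ⟨?_, ?_⟩)
    · rw [Finset.card_insert_of_notMem hvX] at this; omega
    · exact Finset.mem_powerset.mpr (Finset.insert_subset hv hXY)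
    · intro a ha b hb hab
      rcases Finset.mem_insert.mp ha with rfl | ha' <;>
        rcases Finset.mem_insert.mp hb with rfl | hb'
      exacts [absurd rfl hab, hdis b hb', (hdis a ha').symm, hXd a ha' b hb' hab]
  refine (Finset.card_le_card hcov).trans ((Finset.card_biUnion_le_card_mul _ _ (t * t) ?_).trans
    (Nat.mul_le_mul_right _ hX))
  intro w _
  exact (Finset.card_biUnion_le_card_mul _ _ t fun u _ => hN u).trans
    (Nat.mul_le_mul_right _ (hN w))

end SimpleGraph

end

/-! ### Partitioning the vertices of degree at most two into paths. -/

section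

open Set

namespace SimpleGraph

variable {U V W : Type*}

/-- A path inside `U` starting at a given vertex that cannot be prolonged at its other end. -/
theorem exists_maximal_path_in [DecidableEq V] (G : SimpleGraph V) (U : Finset V) {v : V}
    (hv : v ∈ U) :
    ∃ (l : ℕ) (q : ℕ → V), q 0 = v ∧ (∀ j ≤ l, q j ∈ U) ∧
      (∀ i ≤ l, ∀ j ≤ l, q i = q j → i = j) ∧ (∀ j < l, G.Adj (q j) (q (j + 1))) ∧
      ∀ w ∈ U, G.Adj (q l) w → ∃ j ≤ l, q j = w := by
  let P : ℕ → Prop := fun l => ∃ q : ℕ → V, q 0 = v ∧ (∀ j ≤ l, q j ∈ U) ∧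
      (∀ i ≤ l, ∀ j ≤ l, q i = q j → i = j) ∧ (∀ j < l, G.Adj (q j) (q (j + 1)))
  have h0 : P 0 := ⟨fun _ => v, rfl, fun _ _ => hv, fun i hi j hj _ => by omega, by simp⟩
  have hbd : ∀ l, P l → l < U.card := by
    rintro l ⟨q, -, hU, hinj, -⟩
    have : (Finset.range (l + 1)).card ≤ U.card := by
      refine Finset.card_le_card_of_injOn q (fun j hj => ?_) (fun i hi j hj h => ?_)
      · exact hU j (by simpa [Nat.lt_succ_iff] using hj)
      · exact hinj i (by simpa [Nat.lt_succ_iff] using hi) j (by simpa [Nat.lt_succ_iff] using hj) h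
    simpa using this
  obtain ⟨l, hl, hl'⟩ : ∃ l, P l ∧ ¬ P (l + 1) := by
    by_contra! hcon
    have : ∀ l, P l := fun l => Nat.rec h0 (fun l ih => hcon l ih) l
    exact lt_irrefl _ (hbd _ (this U.card))
  obtain ⟨q, hq0, hqU, hinj, hadj⟩ := hl
  refine ⟨l, q, hq0, hqU, hinj, hadj, fun w hw hlw => ?_⟩
  by_contra! hcon
  refine hl' ⟨fun j => if j ≤ l then q j else w, by simp [hq0], ?_, ?_, ?_⟩
  · intro j _
    by_cases h : j ≤ l <;> simp [h, hw, hqU j]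
  · intro i hi j hj hij
    by_cases h : i ≤ l <;> by_cases h' : j ≤ l <;> simp only [h, h', if_true, if_false] at hij
    · exact hinj i h j h' hij
    · exact absurd hij (hcon i h)
    · exact absurd hij.symm (hcon j h')
    · omega
  · intro j hj
    by_cases h : j + 1 ≤ l
    · simp only [h, show j ≤ l by omega, if_true]
      exact hadj j (by omega)
    · have : j = l := by omega
      subst this
      simpa using hlw

/-- A partition of `U` into the paths `p a 0, …, p a (len a)`, which start next to `X`, are attached
to `X` only at their ends and have no further edges between each other. -/
structure IsPathCover (G : SimpleGraph V) (X U : Set V) {m : ℕ} (p : Fin m → ℕ → V)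
    (len : Fin m → ℕ) : Prop where
  mem : ∀ a, ∀ j ≤ len a, p a j ∈ U
  inj : ∀ a a', ∀ j ≤ len a, ∀ j' ≤ len a', p a j = p a' j' → a = a' ∧ j = j'
  cover : ∀ v ∈ U, ∃ a, ∃ j ≤ len a, p a j = v
  chain : ∀ a, ∀ j < len a, G.Adj (p a j) (p a (j + 1))
  head : ∀ a, ∃ x ∈ X, G.Adj x (p a 0)
  ends : ∀ x ∈ X, ∀ a, ∀ j ≤ len a, G.Adj x (p a j) → j = 0 ∨ j = len a
  consecutive : ∀ a a', ∀ j ≤ len a, ∀ j' ≤ len a', G.Adj (p a j) (p a' j') →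
    a = a' ∧ (j' = j + 1 ∨ j = j' + 1)

/-- If all vertices outside `X` have degree at most two and each of them is connected to `X`, then
the complement of `X` is partitioned into paths. -/
theorem exists_isPathCover [DecidableEq V] {G : SimpleGraph V} (hG : G.Preconnected) {X : Set V}
    (hX : X.Nonempty) (N : ℕ) : ∀ (U : Finset V), U.card ≤ N → (∀ u ∈ U, u ∉ X) →
    (∀ u ∈ U, ∀ v, G.Adj u v → v ∈ U ∨ v ∈ X) →
    (∀ u ∈ U, ∀ a b c, G.Adj u a → G.Adj u b → G.Adj u c → a = b ∨ a = c ∨ b = c) →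
    ∃ (m : ℕ) (p : Fin m → ℕ → V) (len : Fin m → ℕ), IsPathCover G X U p len := by
  induction N with
  | zero =>
    intro U hU _ _ _
    have : U = ∅ := Finset.card_eq_zero.mp (by omega)
    subst this
    exact ⟨0, fun a => a.elim0, fun a => a.elim0, by
      constructor <;> first | exact fun a => a.elim0 | simp⟩
  | succ N ih =>
    intro U hU hUX hcl hdeg
    rcases U.eq_empty_or_nonempty with rfl | ⟨u₀, hu₀⟩
    · exact ih ∅ (by simp) hUX hcl hdeg
    -- Otherwise `U` would be closed under adjacency and connectedness would put `X` inside `U`.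
    -- Starting the path next to `X` uses up the second neighbour of its head, so a maximal path has
    -- no neighbours in the rest of `U` and can be split off.
    obtain ⟨v, hvU, x, hx, hxv⟩ : ∃ v ∈ U, ∃ x ∈ X, G.Adj x v := by
      by_contra! hcon
      obtain ⟨x, hx⟩ := hX
      have : x ∈ (U : Set V) := hG.mem_of_closed (x := u₀) hu₀ (fun a ha b hab => by
        rcases hcl a ha b hab with h | h
        · exact h
        · exact absurd hab.symm (hcon a ha b h))
      exact hUX x this hx
    obtain ⟨l, q, hq0, hqU, hinj, hadj, hmax⟩ := exists_maximal_path_in G U hvU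
    have hnX : ∀ j ≤ l, q j ∉ X := fun j hj => hUX _ (hqU j hj)
    -- all neighbours of a vertex of the path before its end
    have hint : ∀ j < l, ∀ w, G.Adj (q j) w → w = q (j + 1) ∨ (0 < j ∧ w = q (j - 1)) ∨
        (j = 0 ∧ w = x) := by
      intro j hj w hw
      have h1 := hadj j hj
      rcases Nat.eq_zero_or_pos j with rfl | hpos
      · have h2 : G.Adj (q 0) x := hq0 ▸ hxv.symm
        rcases hdeg _ (hqU 0 (by omega)) _ _ _ hw h1 h2 with h | h | h
        · exact Or.inl h
        · exact Or.inr (Or.inr ⟨rfl, h⟩)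
        · exact absurd (h ▸ hx) (hnX _ (by omega))
      · have h2 : G.Adj (q j) (q (j - 1)) := by
          have := hadj (j - 1) (by omega)
          rw [Nat.sub_add_cancel hpos] at this
          exact this.symm
        rcases hdeg _ (hqU j (by omega)) _ _ _ hw h1 h2 with h | h | h
        · exact Or.inl h
        · exact Or.inr (Or.inl ⟨hpos, h⟩)
        · have := hinj _ (by omega) _ (by omega) h
          omega
    have hlast : ∀ w, G.Adj (q l) w → w ∈ X ∨ (0 < l ∧ w = q (l - 1)) := by
      intro w hw
      rcases hcl _ (hqU l le_rfl) w hw with h | h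
      · right
        obtain ⟨j, hj, rfl⟩ := hmax w h hw
        have hjl : j ≠ l := fun h => hw.ne (h ▸ rfl)
        rcases hint j (by omega) _ hw.symm with h | ⟨h, h'⟩ | ⟨h, h'⟩
        · have := hinj _ le_rfl _ (by omega) h
          exact ⟨by omega, by rw [this]; rfl⟩
        · have := hinj _ le_rfl _ (by omega) h'
          omega
        · exact absurd (h' ▸ hx) (hnX l le_rfl)
      · exact Or.inl h
    have hends : ∀ y ∈ X, ∀ j ≤ l, G.Adj y (q j) → j = 0 ∨ j = l := by
      intro y hy j hj hyj
      by_contra! hcon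
      rcases hint j (by omega) y hyj.symm with h | ⟨h, h'⟩ | ⟨h, h'⟩
      · exact hnX _ (by omega) (h ▸ hy)
      · exact hnX _ (by omega) (h' ▸ hy)
      · exact hcon.1 h
    have hnbr : ∀ j ≤ l, ∀ w, w ∉ X → G.Adj (q j) w →
        ∃ j' ≤ l, w = q j' ∧ (j' = j + 1 ∨ j = j' + 1) := by
      intro j hj w hwX hw
      rcases hj.lt_or_eq with hlt | rfl
      · rcases hint j hlt w hw with h | ⟨h, h'⟩ | ⟨h, h'⟩
        · exact ⟨j + 1, hlt, h, Or.inl rfl⟩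
        · exact ⟨j - 1, by omega, h', Or.inr (by omega)⟩
        · exact absurd (h' ▸ hx) hwX
      · rcases hlast w hw with h | ⟨h, h'⟩
        · exact absurd h hwX
        · exact ⟨j - 1, by omega, h', Or.inr (by omega)⟩
    let Q : Finset V := (Finset.range (l + 1)).image q
    have hQ : ∀ w, w ∈ Q ↔ ∃ j ≤ l, q j = w := by
      intro w; simp [Q]
    have hvQ : v ∈ Q := (hQ v).mpr ⟨0, by omega, hq0⟩
    obtain ⟨m, p, len, hp⟩ := ih (U \ Q) (by
        have : (U \ Q).card < U.card :=
          Finset.card_lt_card ⟨Finset.sdiff_subset, fun h => (Finset.mem_sdiff.mp (h hvU)).2 hvQ⟩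
        omega)
      (fun u hu => hUX u (Finset.mem_sdiff.mp hu).1)
      (fun u hu w huw => by
        obtain ⟨hu1, hu2⟩ := Finset.mem_sdiff.mp hu
        rcases hcl u hu1 w huw with h | h
        · left
          refine Finset.mem_sdiff.mpr ⟨h, fun hw => hu2 ?_⟩
          obtain ⟨j, hj, rfl⟩ := (hQ w).mp hw
          obtain ⟨j', hj', h', -⟩ := hnbr j hj u (hUX u hu1) huw.symm
          exact (hQ u).mpr ⟨j', hj', h'.symm⟩
        · exact Or.inr h)
      (fun u hu => hdeg u (Finset.mem_sdiff.mp hu).1)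
    have hpU : ∀ a, ∀ j ≤ len a, p a j ∈ U ∧ p a j ∉ Q := fun a j hj =>
      Finset.mem_sdiff.mp (hp.mem a j hj)
    have hqp : ∀ j ≤ l, ∀ a, ∀ j' ≤ len a, q j ≠ p a j' := fun j hj a j' hj' h =>
      (hpU a j' hj').2 ((hQ _).mpr ⟨j, hj, h⟩)
    have hqpadj : ∀ j ≤ l, ∀ a, ∀ j' ≤ len a, ¬ G.Adj (q j) (p a j') := by
      intro j hj a j' hj' h
      obtain ⟨i, hi, h', -⟩ := hnbr j hj _ (hUX _ (hpU a j' hj').1) h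
      exact hqp i hi a j' hj' h'.symm
    refine ⟨m + 1, Fin.cons q p, Fin.cons l len, ?_, ?_, ?_, ?_, ?_, ?_, ?_⟩
    · refine Fin.cases ?_ ?_
      · simpa using hqU
      · intro a; simpa using fun j hj => (hpU a j hj).1
    · refine Fin.cases ?_ fun a => ?_ <;> refine Fin.cases ?_ fun a' => ?_
      · simpa using hinj
      · simpa using fun j hj j' hj' h => absurd h (hqp j hj a' j' hj')
      · simpa using fun j hj j' hj' h => absurd h.symm (hqp j' hj' a j hj)
      · simpa using fun j hj j' hj' h => hp.inj a a' j hj j' hj' h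
    · intro w hw
      by_cases hwQ : w ∈ Q
      · obtain ⟨j, hj, h⟩ := (hQ w).mp hwQ
        exact ⟨0, j, by simpa using hj, by simpa using h⟩
      · obtain ⟨a, j, hj, h⟩ := hp.cover w (Finset.mem_coe.mpr (Finset.mem_sdiff.mpr ⟨hw, hwQ⟩))
        exact ⟨a.succ, j, by simpa using hj, by simpa using h⟩
    · refine Fin.cases ?_ fun a => ?_
      · simpa using hadj
      · simpa using hp.chain a
    · refine Fin.cases ?_ fun a => ?_
      · exact ⟨x, hx, by simpa [hq0] using hxv⟩
      · simpa using hp.head a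
    · intro y hy
      refine Fin.cases ?_ fun a => ?_
      · simpa using hends y hy
      · simpa using hp.ends y hy a
    · refine Fin.cases ?_ fun a => ?_ <;> refine Fin.cases ?_ fun a' => ?_
      · simp only [Fin.cons_zero, true_and]
        intro j hj j' hj' h
        obtain ⟨i, hi, h', h''⟩ := hnbr j hj _ (hnX j' hj') h
        rwa [hinj _ hj' _ hi h']
      · simpa using fun j hj j' hj' h => absurd h (hqpadj j hj a' j' hj')
      · simpa using fun j hj j' hj' h => absurd h.symm (hqpadj j' hj' a j hj)
      · simpa using fun j hj j' hj' h => hp.consecutive a a' j hj j' hj' h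

end SimpleGraph

end

/-! ### Well-quasi-ordering of graphs without a fixed star minor. -/

section

open Set

namespace SimpleGraph

variable {U V W : Type*}

theorem connected_induce_image_Icc {G : SimpleGraph V} {q : ℕ → V} {i j : ℕ} (hij : i ≤ j)
    (h : ∀ a, i ≤ a → a < j → G.Adj (q a) (q (a + 1))) :
    (G.induce (q '' Icc i j)).Connected := by
  induction j, hij using Nat.le_induction with
  | base =>
    rw [Icc_self, image_singleton]
    exact connected_induce_singleton G (q i)
  | succ j hij ih =>
    have h1 := ih fun a ha haj => h a ha (by omega)
    have h2 := connected_induce_union h1.preconnected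
      (connected_induce_singleton G (q (j + 1))).preconnected
      ⟨j, ⟨hij, le_rfl⟩, rfl⟩ rfl (h j hij (by omega))
    have : q '' Icc i j ∪ {q (j + 1)} = q '' Icc i (j + 1) := by
      rw [← image_singleton, ← image_union]
      congr 1
      ext a
      simp only [mem_union, mem_Icc, mem_singleton_iff]
      omega
    rwa [this] at h2

/-- Shortening the paths of a path cover yields a minor. -/
theorem IsPathCover.minorOf {G : SimpleGraph V} {G' : SimpleGraph W} {b m : ℕ} {f : Fin b → V}
    {f' : Fin b → W} {p : Fin m → ℕ → V} {p' : Fin m → ℕ → W} {len len' : Fin m → ℕ}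
    (hf : Function.Injective f) (hf' : Function.Injective f')
    (hp : IsPathCover G (range f) (range f)ᶜ p len)
    (hp' : IsPathCover G' (range f') (range f')ᶜ p' len')
    (h₁ : ∀ i j, G.Adj (f i) (f j) → G'.Adj (f' i) (f' j))
    (h₂ : ∀ i a, G.Adj (f i) (p a 0) → G'.Adj (f' i) (p' a 0))
    (h₃ : ∀ i a, G.Adj (f i) (p a (len a)) → G'.Adj (f' i) (p' a (len' a)))
    (hlen : len ≤ len') : MinorOf G G' := by
  classical
  -- The last vertex of each shorter path receives the whole remaining tail of the longer path as
  -- its branch set; every other path vertex receives a single vertex.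
  let e : Fin m → ℕ → ℕ := fun a j => if j = len a then len' a else j
  have he : ∀ a, ∀ j ≤ len a, j ≤ e a j ∧ e a j ≤ len' a := by
    intro a j hj
    have : len a ≤ len' a := hlen a
    by_cases h : j = len a <;> simp only [e, h, if_true, if_false] <;> omega
  have hcov : ∀ v, ∃ S : Set W, (∀ i, f i = v → S = {f' i}) ∧
      ∀ a, ∀ j ≤ len a, p a j = v → S = p' a '' Icc j (e a j) := by
    intro v
    by_cases hv : v ∈ range f
    · obtain ⟨i, rfl⟩ := hv
      exact ⟨{f' i}, fun i' h => by rw [hf h],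
        fun a j hj h => absurd ⟨i, h.symm⟩ (hp.mem a j hj)⟩
    · obtain ⟨a, j, hj, rfl⟩ := hp.cover v hv
      refine ⟨p' a '' Icc j (e a j), fun i h => absurd ⟨i, h⟩ hv, fun a' j' hj' h => ?_⟩
      obtain ⟨rfl, rfl⟩ := hp.inj _ _ _ hj' _ hj h
      rfl
  choose B hBf hBp using hcov
  have hBf : ∀ i, B (f i) = {f' i} := fun i => hBf _ i rfl
  have hBp : ∀ a, ∀ j ≤ len a, B (p a j) = p' a '' Icc j (e a j) := fun a j hj => hBp _ a j hj rfl
  have hcases : ∀ v, (∃ i, v = f i) ∨ ∃ a, ∃ j ≤ len a, v = p a j := by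
    intro v
    by_cases hv : v ∈ range f
    · obtain ⟨i, rfl⟩ := hv
      exact Or.inl ⟨i, rfl⟩
    · obtain ⟨a, j, hj, rfl⟩ := hp.cover v hv
      exact Or.inr ⟨a, j, hj, rfl⟩
  have hfp : ∀ i a, ∀ j ≤ len a, Disjoint (B (f i)) (B (p a j)) := by
    intro i a j hj
    rw [hBf, hBp a j hj, disjoint_singleton_left]
    rintro ⟨k, hk, hk'⟩
    exact hp'.mem a k (hk.2.trans (he a j hj).2) ⟨i, hk'.symm⟩
  have hfpa : ∀ i a, ∀ j ≤ len a, G.Adj (f i) (p a j) →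
      ∃ x ∈ B (f i), ∃ y ∈ B (p a j), G'.Adj x y := by
    intro i a j hj hadj
    rw [hBf, hBp a j hj]
    rcases hp.ends _ ⟨i, rfl⟩ a j hj hadj with rfl | rfl
    · exact ⟨_, rfl, _, ⟨0, ⟨le_rfl, (he a 0 hj).1⟩, rfl⟩, h₂ i a hadj⟩
    · exact ⟨_, rfl, _, ⟨len' a, ⟨hlen a, by simp [e]⟩, rfl⟩, h₃ i a hadj⟩
  have hnext : ∀ a j, j + 1 ≤ len a →
      ∃ x ∈ B (p a j), ∃ y ∈ B (p a (j + 1)), G'.Adj x y := by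
    intro a j hj
    rw [hBp a j (by omega), hBp a _ hj]
    refine ⟨_, ⟨j, ⟨le_rfl, (he a j (by omega)).1⟩, rfl⟩, _,
      ⟨j + 1, ⟨le_rfl, (he a _ hj).1⟩, rfl⟩, hp'.chain a j ?_⟩
    have : len a ≤ len' a := hlen a
    omega
  refine ⟨B, ?_, ?_, ?_⟩
  · intro v
    rcases hcases v with ⟨i, rfl⟩ | ⟨a, j, hj, rfl⟩
    · rw [hBf]; exact connected_induce_singleton _ _
    · rw [hBp a j hj]
      refine connected_induce_image_Icc (he a j hj).1 fun k _ hk => hp'.chain a k ?_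
      exact lt_of_lt_of_le hk (he a j hj).2
  · intro v w hvw
    rcases hcases v with ⟨i, rfl⟩ | ⟨a, j, hj, rfl⟩ <;>
      rcases hcases w with ⟨i', rfl⟩ | ⟨a', j', hj', rfl⟩
    · rw [hBf, hBf, disjoint_singleton]
      exact fun h => hvw (by rw [hf' h])
    · exact hfp i a' j' hj'
    · exact (hfp i' a j hj).symm
    · rw [hBp a j hj, hBp a' j' hj', Set.disjoint_left]
      rintro _ ⟨k, hk, rfl⟩ ⟨k', hk', h⟩
      obtain ⟨rfl, rfl⟩ := hp'.inj _ _ _ (hk'.2.trans (he a' j' hj').2) _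
        (hk.2.trans (he a j hj).2) h
      have hne : j ≠ j' := fun h => hvw (by rw [h])
      have h1 := hk.1
      have h2 := hk.2
      have h3 := hk'.1
      have h4 := hk'.2
      simp only [e] at h2 h4
      split_ifs at h2 h4 <;> omega
  · intro v w hvw
    rcases hcases v with ⟨i, rfl⟩ | ⟨a, j, hj, rfl⟩ <;>
      rcases hcases w with ⟨i', rfl⟩ | ⟨a', j', hj', rfl⟩
    · rw [hBf, hBf]
      exact ⟨_, rfl, _, rfl, h₁ _ _ hvw⟩
    · exact hfpa i a' j' hj' hvw
    · obtain ⟨x, hx, y, hy, hxy⟩ := hfpa i' a j hj hvw.symm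
      exact ⟨y, hy, x, hx, hxy.symm⟩
    · obtain ⟨rfl, rfl | rfl⟩ := hp.consecutive _ _ _ hj _ hj' hvw
      · exact hnext a j hj'
      · obtain ⟨x, hx, y, hy, hxy⟩ := hnext a j' hj
        exact ⟨y, hy, x, hx, hxy.symm⟩

/-- A connected graph without a `K_{1,t}` minor is made of boundedly many vertices and paths. -/
theorem Connected.exists_isPathCover_of_not_hasStar [Finite V] {G : SimpleGraph V}
    (hG : G.Connected) {t : ℕ} (ht : ¬ HasStar G t) :
    ∃ b ≤ t * (t * t) + 1, ∃ m ≤ (t * (t * t) + 1) * t, ∃ (f : Fin b → V) (p : Fin m → ℕ → V)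
      (len : Fin m → ℕ), Function.Injective f ∧ IsPathCover G (range f) (range f)ᶜ p len := by
  classical
  have := Fintype.ofFinite V
  obtain ⟨v₀⟩ := hG.nonempty
  -- The arbitrary vertex `v₀` keeps `X` nonempty when no vertex has degree three or more.
  set X : Finset V := insert v₀ (Finset.univ.filter fun v => 3 ≤ G.degree v) with hX
  have hXcard : X.card ≤ t * (t * t) + 1 :=
    (Finset.card_insert_le _ _).trans (Nat.succ_le_succ (card_three_le_degree_le hG ht))
  obtain ⟨m, p, len, hp⟩ := exists_isPathCover hG.preconnected (X := (X : Set V))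
    ⟨v₀, by simp [hX]⟩ _ Xᶜ le_rfl (by simp) (fun u _ v _ => by
      simpa using (em (v ∈ X)).symm) (by
      intro u hu a b c ha hb hc
      by_contra! hcon
      have hu' : u ∉ X := by simpa using hu
      refine hu' (Finset.mem_insert_of_mem (Finset.mem_filter.mpr ⟨Finset.mem_univ _, ?_⟩))
      have hsub : ({a, b, c} : Finset V) ⊆ G.neighborFinset u := by
        intro w hw
        simp only [Finset.mem_insert, Finset.mem_singleton] at hw
        rw [mem_neighborFinset]
        rcases hw with rfl | rfl | rfl <;> assumption
      have h3 : ({a, b, c} : Finset V).card = 3 :=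
        Finset.card_eq_three.mpr ⟨a, b, c, hcon.1, hcon.2.1, hcon.2.2, rfl⟩
      exact h3 ▸ Finset.card_le_card hsub)
  let f : Fin X.card → V := fun i => (X.equivFin.symm i).1
  have hfinj : Function.Injective f := Subtype.val_injective.comp X.equivFin.symm.injective
  have hrange : range f = X := by
    ext v
    constructor
    · rintro ⟨i, rfl⟩
      exact (X.equivFin.symm i).2
    · exact fun hv => ⟨X.equivFin ⟨v, hv⟩, by simp [f]⟩
  refine ⟨X.card, hXcard, m, ?_, f, p, len, hfinj, ?_⟩
  -- The paths have distinct heads, all of them neighbours of `X`, and degrees are below `t`.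
  · have hsub : (Finset.univ : Finset (Fin m)).card ≤
        (X.biUnion fun x => G.neighborFinset x).card := by
      refine Finset.card_le_card_of_injOn (fun a => p a 0) (fun a _ => ?_) fun a _ a' _ h =>
        (hp.inj a a' 0 (Nat.zero_le _) 0 (Nat.zero_le _) h).1
      obtain ⟨x, hx, hxa⟩ := hp.head a
      exact Finset.mem_coe.mpr (Finset.mem_biUnion.mpr ⟨x, hx, (mem_neighborFinset _ _ _).mpr hxa⟩)
    rw [Finset.card_univ, Fintype.card_fin] at hsub
    refine hsub.trans ((Finset.card_biUnion_le_card_mul _ _ t fun x _ =>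
      (degree_lt_of_not_hasStar ht x).le).trans (Nat.mul_le_mul_right _ hXcard))
  · rw [hrange]
    simpa using hp

/-- Component-wise minors combine to a minor. -/
theorem MinorOf.of_components {G : SimpleGraph V} {G' : SimpleGraph W}
    (φ : G.ConnectedComponent → G'.ConnectedComponent) (hφ : Function.Injective φ)
    (h : ∀ c, MinorOf (G.induce c.supp) (G'.induce (φ c).supp)) : MinorOf G G' := by
  have h' := fun c => minorOf_induce_iff.mp (h c)
  choose B hB hBs using h'
  let C : V → Set W := fun v => B (G.connectedComponentMk v) ⟨v, rfl⟩
  have hC : ∀ c v (hv : v ∈ c.supp), C v = B c ⟨v, hv⟩ := by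
    rintro _ v rfl
    rfl
  refine ⟨C, fun v => (hB _).connected _, ?_, ?_⟩
  · intro v w hvw
    by_cases hc : G.connectedComponentMk w = G.connectedComponentMk v
    · rw [hC _ v rfl, hC _ w hc]
      exact (hB _).disjoint _ _ fun h => hvw (congrArg Subtype.val h)
    · refine Set.disjoint_left.mpr fun x hx hx' => hc (hφ ?_)
      have h1 : G'.connectedComponentMk x = _ := hBs _ _ hx
      have h2 : G'.connectedComponentMk x = _ := hBs _ _ hx'
      rw [← h1, ← h2]
  · intro v w hvw
    rw [hC _ v rfl, hC _ w (ConnectedComponent.sound hvw.symm.reachable)]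
    exact (hB _).adj _ _ hvw

end SimpleGraph

namespace FinGraph

open SimpleGraph

theorem isMinor_iff {H G : FinGraph} : H.IsMinor G ↔ MinorOf H.graph G.graph :=
  ⟨fun ⟨B, h₁, h₂, h₃⟩ => ⟨B, h₁, h₂, h₃⟩, fun ⟨B, h⟩ => ⟨B, h.connected, h.disjoint, h.adj⟩⟩

instance isPreorder_isMinor : IsPreorder FinGraph IsMinor where
  refl _ := isMinor_iff.mpr (MinorOf.refl _)
  trans _ _ _ h₁ h₂ := isMinor_iff.mpr ((isMinor_iff.mp h₁).trans (isMinor_iff.mp h₂))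

/-- For fixed `b` and `m` the adjacencies among the branch vertices and with the path ends form
finite data, so among infinitely many graphs two agree in it. The length vectors in `ℕ^m` are
well-quasi-ordered by Dickson's lemma, and longer paths contract to shorter ones. -/
theorem partiallyWellOrderedOn_isPathCover (b m : ℕ) :
    {G : FinGraph | ∃ (f : Fin b → G.V) (p : Fin m → ℕ → G.V) (len : Fin m → ℕ),
      Function.Injective f ∧ IsPathCover G.graph (range f) (range f)ᶜ p len}.PartiallyWellOrderedOn
      IsMinor := by
  rw [partiallyWellOrderedOn_iff_exists_lt]
  intro g hg
  choose f p len hf hp using hg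
  let code : ℕ → ((Fin b → Fin b → Prop) × (Fin b → Fin m → Prop) × (Fin b → Fin m → Prop)) ×
      (Fin m → ℕ) := fun n =>
    ((fun i j => (g n).graph.Adj (f n i) (f n j), fun i a => (g n).graph.Adj (f n i) (p n a 0),
      fun i a => (g n).graph.Adj (f n i) (p n a (len n a))), len n)
  obtain ⟨i, j, hij, h₁, h₂⟩ := ((Finite.wellQuasiOrdered (α := (Fin b → Fin b → Prop) ×
    (Fin b → Fin m → Prop) × (Fin b → Fin m → Prop)) (· = ·)).prod
    (wellQuasiOrdered_le (α := Fin m → ℕ))) code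
  refine ⟨i, j, hij, isMinor_iff.mpr (IsPathCover.minorOf (hf i) (hf j) (hp i) (hp j) ?_ ?_ ?_ h₂)⟩
  · intro a c h
    have := congrFun (congrFun (congrArg Prod.fst h₁) a) c
    exact this.mp h
  · intro a c h
    have := congrFun (congrFun (congrArg (fun q => q.2.1) h₁) a) c
    exact this.mp h
  · intro a c h
    have := congrFun (congrFun (congrArg (fun q => q.2.2) h₁) a) c
    exact this.mp h

theorem partiallyWellOrderedOn_connected (t : ℕ) :
    {G : FinGraph | G.graph.Connected ∧ ¬ HasStar G.graph t}.PartiallyWellOrderedOn IsMinor := by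
  have h : ∀ s : Finset (ℕ × ℕ), (⋃ q ∈ s, {G : FinGraph | ∃ (f : Fin q.1 → G.V)
      (p : Fin q.2 → ℕ → G.V) (len : Fin q.2 → ℕ), Function.Injective f ∧
      IsPathCover G.graph (range f) (range f)ᶜ p len}).PartiallyWellOrderedOn IsMinor := by
    exact fun s => s.partiallyWellOrderedOn_bUnion.mpr
      fun q _ => partiallyWellOrderedOn_isPathCover q.1 q.2
  refine (h ((Finset.range (t * (t * t) + 2)) ×ˢ
    (Finset.range ((t * (t * t) + 1) * t + 1)))).mono ?_
  rintro G ⟨hG, hs⟩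
  obtain ⟨b, hb, m, hm, hex⟩ := hG.exists_isPathCover_of_not_hasStar hs
  exact mem_biUnion (x := (b, m)) (by simp; omega) hex

/-- Graphs without a `K_{1,t}` minor are well-quasi-ordered by the minor relation. -/
theorem partiallyWellOrderedOn_not_hasStar (t : ℕ) :
    {G : FinGraph | ¬ HasStar G.graph t}.PartiallyWellOrderedOn IsMinor := by
  classical
  -- Higman's lemma, to be applied to the lists of components: some list embeds componentwise, as
  -- minors, into a sublist of a later one.
  have hig := PartiallyWellOrderedOn.partiallyWellOrderedOn_sublistForall₂ IsMinor
    (partiallyWellOrderedOn_connected t)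
  rw [partiallyWellOrderedOn_iff_exists_lt] at hig ⊢
  intro g hg
  have hfin : ∀ n, Finite (g n).graph.ConnectedComponent := fun n =>
    Finite.of_surjective (g n).graph.connectedComponentMk Quot.mk_surjective
  let _ : ∀ n, Fintype (g n).graph.ConnectedComponent := fun n => Fintype.ofFinite _
  let comps : ∀ n, List (g n).graph.ConnectedComponent := fun n => Finset.univ.toList
  let l : ℕ → List FinGraph := fun n => (comps n).map fun c => (g n).induce c.supp
  obtain ⟨i, j, hij, h⟩ := hig l (by
    intro n x hx
    obtain ⟨c, -, rfl⟩ := List.mem_map.mp hx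
    exact ⟨ConnectedComponent.connected_toSimpleGraph c, fun hs => hg n hs.of_induce⟩)
  refine ⟨i, j, hij, isMinor_iff.mpr ?_⟩
  obtain ⟨l', h₁, h₂⟩ := List.sublistForall₂_iff.mp h
  obtain ⟨l'', h₃, rfl⟩ := List.sublist_map_iff.mp h₂
  rw [List.forall₂_map_left_iff, List.forall₂_map_right_iff, List.forall₂_iff_get] at h₁
  obtain ⟨hl, hr⟩ := h₁
  have hnd : l''.Nodup := h₃.nodup (Finset.nodup_toList _)
  have hidx : ∀ c : (g i).graph.ConnectedComponent, (comps i).idxOf c < (comps i).length :=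
    fun c => List.idxOf_lt_length_iff.mpr (Finset.mem_toList.mpr (Finset.mem_univ _))
  refine MinorOf.of_components (fun c => l''.get ⟨(comps i).idxOf c, hl ▸ hidx c⟩) ?_ ?_
  · intro c c' hcc
    have := List.nodup_iff_injective_get.mp hnd hcc
    exact (List.idxOf_inj (Finset.mem_toList.mpr (Finset.mem_univ _))).mp (Fin.mk.inj this)
  · intro c
    have := isMinor_iff.mp (hr _ (hidx c) (hl ▸ hidx c))
    have hc : (comps i).get ⟨(comps i).idxOf c, hidx c⟩ = c := by simp
    rw [hc] at this
    exact this

end FinGraph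

end

/-! ### The parameter `γ`, reduction to bounded order, and irreducible subgraphs. -/

section

open Set

namespace FinGraph

open SimpleGraph

theorem ncard_le_alpha {H : FinGraph} {S : Set H.V}
    (hS : ∀ v ∈ S, ∀ w ∈ S, ¬ H.graph.Adj v w) : S.ncard ≤ H.alpha := by
  classical
  rw [ncard_eq_toFinset_card S (toFinite S)]
  refine IsIndepSet.card_le_indepNum ?_
  intro v hv w hw _
  exact hS v (by simpa using hv) w (by simpa using hw)

/-- If a maximum independent set missed at most one vertex, it would miss exactly one because `H`
has an edge. Positive minimum degree would join that vertex to all others, making `H` a star. The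
inequality gives `γ_H ≥ 1` and makes the natural subtraction in `gamma` exact. -/
theorem alpha_add_two_le_order {H : FinGraph} (hd : H.MinDegreePos) (hs : ¬ H.IsStar) :
    H.alpha + 2 ≤ H.order := by
  classical
  have := Fintype.ofFinite H.V
  obtain ⟨s, hind, hcard⟩ := exists_isNIndepSet_indepNum (G := H.graph)
  have hind' : ∀ v ∈ s, ∀ w ∈ s, ¬ H.graph.Adj v w := fun v hv w hw h => hind hv hw h.ne h
  by_contra! hlt
  have hcompl : s.card + sᶜ.card = H.order := by
    rw [order, Nat.card_eq_fintype_card]; exact Finset.card_add_card_compl s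
  have hα : s.card = H.alpha := hcard
  have hle : ∀ c ∉ s, ∀ d ∉ s, c = d := by
    intro c hc d hd
    exact Finset.card_le_one.mp (show sᶜ.card ≤ 1 by omega) c (by simpa using hc) d
      (by simpa using hd)
  obtain ⟨⟨v₀⟩, hdeg⟩ := hd
  obtain ⟨c, hc⟩ : ∃ c, c ∉ s := by
    obtain ⟨w, hw⟩ := hdeg v₀
    by_contra! hcon
    exact hind' v₀ (hcon _) w (hcon _) hw
  have hcs : ∀ v, v ≠ c ↔ v ∈ s := fun v =>
    ⟨fun hv => by_contra fun h => hv (hle v h c hc), fun hv h => hc (h ▸ hv)⟩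
  have hadj : ∀ v ∈ s, H.graph.Adj c v := by
    intro v hv
    obtain ⟨w, hw⟩ := hdeg v
    have : w ∉ s := fun h => hind' v hv w h hw
    rw [hle c hc w this]
    exact hw.symm
  let e : Fin s.card ≃ s := s.equivFin.symm
  let φ : Fin 1 ⊕ Fin s.card → H.V := Sum.elim (fun _ => c) fun i => (e i).1
  have hφ : Function.Bijective φ := by
    constructor
    · rintro (i | i) (j | j) h
      · rw [Subsingleton.elim i j]
      · exact absurd h.symm ((hcs _).mpr (e j).2)
      · exact absurd h ((hcs _).mpr (e i).2)
      · rw [e.injective (Subtype.ext h)]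
    · intro v
      by_cases hv : v = c
      · exact ⟨Sum.inl 0, hv.symm⟩
      · exact ⟨Sum.inr (e.symm ⟨v, (hcs v).mp hv⟩), by simp [φ]⟩
  refine hs ⟨s.card, ⟨RelIso.symm ⟨Equiv.ofBijective φ hφ, ?_⟩⟩⟩
  rintro (i | i) (j | j)
  · simp [φ]
  · simpa [φ] using hadj _ (e j).2
  · simpa [φ] using (hadj _ (e i).2).symm
  · simpa [φ] using hind' _ (e i).2 _ (e j).2

theorem one_le_gamma {H : FinGraph} (hd : H.MinDegreePos) (hs : ¬ H.IsStar) : 1 ≤ H.gamma := by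
  have := alpha_add_two_le_order hd hs
  unfold gamma; omega

theorem order_eq_gamma_add {H : FinGraph} (hd : H.MinDegreePos) (hs : ¬ H.IsStar) :
    H.order = H.gamma + H.alpha + 1 := by
  have := alpha_add_two_le_order hd hs
  unfold gamma; omega

theorem familyGamma_le {F : Set FinGraph} {H : FinGraph} (hH : H ∈ F) : familyGamma F ≤ H.gamma :=
  Nat.sInf_le ⟨H, hH, rfl⟩

theorem exists_gamma_eq_familyGamma {F : Set FinGraph} (hF : F.Nonempty) :
    ∃ H ∈ F, H.gamma = familyGamma F := by
  obtain ⟨H, hH, h⟩ := Nat.sInf_mem (hF.image gamma)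
  exact ⟨H, hH, h⟩

/-- A clique of at most `γ_H` vertices joined to an independent set does not contain `H` as a
minor. -/
theorem not_minorOf_joinGraph_bot {V : Type} [Finite V] {H : FinGraph}
    (ho : H.order = H.gamma + H.alpha + 1) {L : Set V} (hL : L.ncard ≤ H.gamma) :
    ¬ MinorOf H.graph (joinGraph L ⊥) := by
  intro h
  have ho' : Nat.card H.V = H.gamma + H.alpha + 1 := ho
  obtain ⟨S, hS, B, hB⟩ := (minorOf_joinGraph_iff (by omega)).mp h
  -- Only an edgeless graph is a minor of an edgeless graph, yet at least `α_H + 1` vertices survive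
  -- the deletion of `|L| ≤ γ_H`.
  have : S.ncard ≤ H.alpha := ncard_le_alpha fun v hv w hw hvw => by
    obtain ⟨x, -, y, -, hxy⟩ := hB.adj ⟨v, hv⟩ ⟨w, hw⟩ hvw
    exact hxy
  omega

/-- If `R` has a `K_{1,α_H}` minor then its join with a `γ_H`-clique contains `H` as a minor. -/
theorem not_hasStar_of_not_minorOf_joinGraph {V : Type} [Finite V] {H : FinGraph}
    (ho : H.order = H.gamma + H.alpha + 1) {L : Set V} {R : SimpleGraph V}
    (hL : L.ncard = H.gamma) (hH : ¬ MinorOf H.graph (joinGraph L R)) :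
    ¬ HasStar (R.induce Lᶜ) H.alpha := by
  classical
  rintro ⟨T, Λ, hT, hΛ, hTΛ⟩
  have := Fintype.ofFinite H.V
  have ho' : Nat.card H.V = H.gamma + H.alpha + 1 := ho
  obtain ⟨I, hind, hI⟩ := exists_isNIndepSet_indepNum (G := H.graph)
  have hI : I.card = H.alpha := hI
  obtain ⟨v, hv⟩ : ∃ v, v ∉ I := by
    by_contra! hcon
    have h1 : I = Finset.univ := Finset.eq_univ_of_forall hcon
    rw [h1, Finset.card_univ, ← Nat.card_eq_fintype_card] at hI
    omega
  let e : I ≃ Λ := Finset.equivOfCardEq (hI.trans hΛ.symm)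
  -- A maximum independent set and one more vertex `v` induce a subgraph of a star: `v` takes the
  -- connected centre and the independent vertices take the leaves. These are `α_H + 1 = |H| - γ_H`
  -- vertices.
  let B : ((insert v I : Finset H.V) : Set H.V) → Set (Lᶜ : Set V) := fun u =>
    if h : u.1 ∈ I then {(e ⟨u.1, h⟩).1} else T
  have hB₁ : ∀ u (h : u.1 ∈ I), B u = {(e ⟨u.1, h⟩).1} := fun u h => dif_pos h
  have hB₂ : ∀ u (_ : u.1 ∉ I), B u = T := fun u h => dif_neg h
  have hout : ∀ u : ((insert v I : Finset H.V) : Set H.V), u.1 ∉ I → u.1 = v := fun u hu =>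
    (Finset.mem_insert.mp u.2).resolve_right hu
  refine hH ((minorOf_joinGraph_iff (by omega)).mpr
    ⟨((insert v I : Finset H.V) : Set H.V), ?_, B, ?_, ?_, ?_⟩)
  · rw [ncard_coe_finset, Finset.card_insert_of_notMem hv]
    omega
  · intro u
    by_cases h : u.1 ∈ I
    · rw [hB₁ u h]; exact connected_induce_singleton _ _
    · rw [hB₂ u h]; exact hT
  · intro u w huw
    by_cases h : u.1 ∈ I <;> by_cases h' : w.1 ∈ I
    · rw [hB₁ u h, hB₁ w h', disjoint_singleton]
      intro heq
      have := e.injective (Subtype.ext heq)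
      exact huw (Subtype.ext (by simpa using this))
    · rw [hB₁ u h, hB₂ w h', disjoint_singleton_left]
      exact (hTΛ _ (e _).2).1
    · rw [hB₂ u h, hB₁ w h', disjoint_singleton_right]
      exact (hTΛ _ (e _).2).1
    · exact absurd (Subtype.ext ((hout u h).trans (hout w h').symm)) huw
  · intro u w huw
    by_cases h : u.1 ∈ I <;> by_cases h' : w.1 ∈ I
    · exact absurd huw (hind h h' (fun h => huw.ne (Subtype.ext h)))
    · rw [hB₁ u h, hB₂ w h']
      obtain ⟨s, hs, hsu⟩ := (hTΛ _ (e ⟨u.1, h⟩).2).2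
      exact ⟨_, rfl, s, hs, hsu.symm⟩
    · rw [hB₂ u h, hB₁ w h']
      obtain ⟨s, hs, hsu⟩ := (hTΛ _ (e ⟨w.1, h'⟩).2).2
      exact ⟨s, hs, _, rfl, hsu⟩
    · exact absurd (Subtype.ext ((hout u h).trans (hout w h').symm)) huw.ne

/-- For joins with a clique of `γ_F` vertices, minor-freeness is decided by the members of `F` of
bounded order. -/
theorem exists_order_bound {F : Set FinGraph} (hF : F.Nonempty)
    (ho : ∀ H ∈ F, H.order = H.gamma + H.alpha + 1) :
    ∃ h : ℕ, ∀ (V : Type) [Finite V] (L : Set V) (R : SimpleGraph V), L.ncard = familyGamma F →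
      (∀ H ∈ F, H.order ≤ h → ¬ MinorOf H.graph (joinGraph L R)) →
      ∀ H ∈ F, ¬ MinorOf H.graph (joinGraph L R) := by
  obtain ⟨H₀, hH₀, hγ⟩ := exists_gamma_eq_familyGamma hF
  by_contra! hcon
  -- The summand `H₀.order` ensures that `H₀` is among the excluded members for every `h`, which
  -- rules out the `K_{1,α}` minor outside the clique.
  choose V hV L R hL hfree H hH hminor using fun h => hcon (H₀.order + h)
  let g : ℕ → FinGraph := fun h => ⟨((L h)ᶜ : Set (V h)), (R h).induce (L h)ᶜ⟩
  have hle : ∀ h h', (L h).ncard ≤ Nat.card (H h').V := by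
    intro h h'
    have h1 := familyGamma_le (hH h')
    have h2 := ho _ (hH h')
    rw [order] at h2
    have h3 := hL h
    omega
  -- Along a monotone subsequence the member found in the first join is a minor of all later joins,
  -- including one whose order bound already covers that member.
  obtain ⟨φ, hφ⟩ := (partiallyWellOrderedOn_not_hasStar H₀.alpha).exists_monotone_subseq (f := g)
    (fun h => not_hasStar_of_not_minorOf_joinGraph (ho _ hH₀) ((hL h).trans hγ.symm)
      (hfree h H₀ hH₀ (by omega)))
  have hbig : (H (φ 0)).order ≤ φ (H (φ 0)).order := φ.strictMono.id_le _
  refine hfree (φ (H (φ 0)).order) (H (φ 0)) (hH _) (by omega) ?_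
  obtain ⟨S, hS, hSm⟩ := (minorOf_joinGraph_iff (hle _ _)).mp (hminor (φ 0))
  refine (minorOf_joinGraph_iff (hle _ _)).mpr ⟨S, by rw [hL] at hS ⊢; exact hS, ?_⟩
  exact hSm.trans (isMinor_iff.mp (hφ 0 _ (Nat.zero_le _)))

/-- If an induced subgraph of `H` is a minor of `G`, then so is an irreducible one of the same
order. -/
theorem exists_irreducibleInduced_isMinor {H G : FinGraph} {S : Set H.V}
    (hS : (H.induce S).IsMinor G) : ∃ K ∈ irreducibleInduced S.ncard H, K.IsMinor G := by
  classical
  -- Twice the number of edges inside `T`. A minimizer is irreducible: an induced subgraph of the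
  -- same order isomorphic to a proper subgraph would still be a minor and have fewer edges.
  let E : Set H.V → ℕ := fun T => {e : H.V × H.V | e.1 ∈ T ∧ e.2 ∈ T ∧ H.graph.Adj e.1 e.2}.ncard
  obtain ⟨T, ⟨hT, hTm⟩, hmin⟩ := exists_min_image
    {T : Set H.V | T.ncard = S.ncard ∧ (H.induce T).IsMinor G} E (toFinite _) ⟨S, rfl, hS⟩
  refine ⟨H.induce T, ⟨⟨T, hT, rfl⟩, ?_⟩, hTm⟩
  rintro _ ⟨T', hT', rfl⟩ ⟨K, hK, ⟨φ⟩⟩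
  let ψ : T' → T := fun v => (φ v).1
  have hψ : Function.Injective ψ := fun v w h => φ.injective (Subtype.ext h)
  have hψs : Function.Surjective ψ :=
    ((Nat.bijective_iff_injective_and_card ψ).mpr ⟨hψ, by
      rw [Nat.card_coe_set_eq, Nat.card_coe_set_eq, hT, hT']⟩).2
  have hadj : ∀ v w : T', H.graph.Adj v w → K.Adj (ψ v) (ψ w) := fun v w h =>
    φ.map_rel_iff.mpr h
  have hminor : (H.induce T').IsMinor (H.induce T) := isMinor_iff.mpr
    (MinorOf.of_injective ψ hψ fun v w h => K.adj_sub (hadj v w h))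
  have hle := hmin T' ⟨hT', _root_.trans hminor hTm⟩
  obtain ⟨a, b, hab, hKab⟩ : ∃ a b : T, H.graph.Adj a b ∧ ¬ K.Adj a b := by
    by_contra! hcon
    refine hK (Subgraph.ext (eq_univ_of_forall fun v => ?_) ?_)
    · obtain ⟨w, rfl⟩ := hψs v
      exact (φ w).2
    · ext a b
      exact ⟨fun h => K.adj_sub h, fun h => hcon a b h⟩
  let Φ : H.V × H.V → H.V × H.V := fun e =>
    if h : e.1 ∈ T' ∧ e.2 ∈ T' then ((ψ ⟨e.1, h.1⟩).1, (ψ ⟨e.2, h.2⟩).1) else e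
  refine absurd hle (not_le.mpr ?_)
  have hsub : Φ '' {e | e.1 ∈ T' ∧ e.2 ∈ T' ∧ H.graph.Adj e.1 e.2} ⊂
      {e | e.1 ∈ T ∧ e.2 ∈ T ∧ H.graph.Adj e.1 e.2} := by
    refine (ssubset_iff_of_subset ?_).mpr ⟨(a.1, b.1), ⟨a.2, b.2, hab⟩, ?_⟩
    · rintro _ ⟨⟨u, w⟩, ⟨hu, hw, huw⟩, rfl⟩
      simp only [Φ, hu, hw, and_self, dif_pos]
      exact ⟨Subtype.coe_prop _, Subtype.coe_prop _, K.adj_sub (hadj ⟨u, hu⟩ ⟨w, hw⟩ huw)⟩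
    · rintro ⟨⟨u, w⟩, ⟨hu, hw, huw⟩, h⟩
      simp only [Φ, hu, hw, and_self, dif_pos, Prod.mk.injEq] at h
      refine hKab ?_
      rw [← Subtype.ext h.1, ← Subtype.ext h.2]
      exact hadj ⟨u, hu⟩ ⟨w, hw⟩ huw
  have hinj : InjOn Φ {e | e.1 ∈ T' ∧ e.2 ∈ T' ∧ H.graph.Adj e.1 e.2} := by
    rintro ⟨u, w⟩ ⟨hu, hw, -⟩ ⟨u', w'⟩ ⟨hu', hw', -⟩ h
    simp only at hu hw hu' hw'
    simp only [Φ, hu, hw, hu', hw', and_self, dif_pos, Prod.mk.injEq] at h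
    have h1 := congrArg Subtype.val (hψ (Subtype.ext h.1))
    have h2 := congrArg Subtype.val (hψ (Subtype.ext h.2))
    exact Prod.ext h1 h2
  have := ncard_lt_ncard hsub (toFinite _)
  rwa [hinj.ncard_image] at this

end FinGraph

end

/-! ### Consequences of excluding a minor: sparsity and few common neighbours. -/

section

open Set

namespace SimpleGraph

variable {U V W : Type*}

/-- A model of `H[S]` whose vertices are all adjacent to the vertices `l v`, `v ∉ S`, extends to a
model of `H` if there are further common neighbours `w v` to contract into the vertices `l v`. -/
theorem MinorOf.of_common_neighbors {H : SimpleGraph U} {G : SimpleGraph V} {S : Set U}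
    {B : S → Set V} (hB : IsModel (H.induce S) G B) {l w : (Sᶜ : Set U) → V}
    (hl : Function.Injective l) (hw : Function.Injective w) (hlw : ∀ u v, G.Adj (l u) (w v))
    (hlB : ∀ u v, ∀ x ∈ B v, G.Adj (l u) x) (hwB : ∀ u v, w u ∉ B v) : MinorOf H G := by
  classical
  let B' : U → Set V := fun v => if h : v ∈ S then B ⟨v, h⟩ else ∅
  -- Contracting `l v` with its own `w v` makes these branch sets pairwise adjacent even when the
  -- vertices `l v` are not.
  let C : U → Set V := fun v => if h : v ∈ S then ∅ else {l ⟨v, h⟩, w ⟨v, h⟩}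
  have hB' : ∀ v (h : v ∈ S), B' v = B ⟨v, h⟩ := fun v h => dif_pos h
  have hC : ∀ v (h : v ∉ S), C v = {l ⟨v, h⟩, w ⟨v, h⟩} := fun v h => dif_neg h
  refine MinorOf.glue (S := S) (B := B') (C := C) ?_ ?_ ?_ ?_ ?_ ?_ ?_ ?_
  · intro v hv
    rw [hB' v hv]; exact hB.connected _
  · intro v hv u hu hvu
    rw [hB' v hv, hB' u hu]
    exact hB.disjoint _ _ fun h => hvu (congrArg Subtype.val h)
  · intro v hv u hu hvu
    rw [hB' v hv, hB' u hu]
    exact hB.adj ⟨v, hv⟩ ⟨u, hu⟩ hvu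
  · intro v hv
    rw [hC v hv]
    exact induce_pair_connected_of_adj (hlw _ _)
  · intro v hv u hu hvu
    rw [hC v hv, hC u hu, Set.disjoint_left]
    rintro x (rfl | rfl) (h | h)
    · exact hvu (congrArg Subtype.val (hl h))
    · exact (hlw ⟨v, hv⟩ ⟨u, hu⟩).ne h
    · exact (hlw ⟨u, hu⟩ ⟨v, hv⟩).ne h.symm
    · exact hvu (congrArg Subtype.val (hw h))
  · intro v hv u hu hvu
    rw [hC v hv, hC u hu]
    exact ⟨_, Or.inl rfl, _, Or.inr rfl, hlw _ _⟩
  · intro v hv u hu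
    rw [hB' v hv, hC u hu, Set.disjoint_left]
    rintro x hx (rfl | rfl)
    · exact (hlB ⟨u, hu⟩ ⟨v, hv⟩ _ hx).ne rfl
    · exact hwB _ _ hx
  · intro v hv u hu _
    rw [hB' v hv, hC u hu]
    obtain ⟨x, hx⟩ := hB.nonempty ⟨v, hv⟩
    exact ⟨x, hx, _, Or.inl rfl, (hlB _ _ x hx).symm⟩

section Mader

variable [DecidableEq V] (G : SimpleGraph V) [DecidableRel G.Adj]

/-- Twice the number of edges of `G[W]`. -/
def degSum (W : Finset V) : ℕ := ∑ v ∈ W, (W.filter (G.Adj v)).card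

theorem degSum_erase {W : Finset V} {v : V} (hv : v ∈ W) :
    degSum G (W.erase v) + 2 * (W.filter (G.Adj v)).card = degSum G W := by
  have h1 : ∀ u ∈ W.erase v, (W.filter (G.Adj u)).card =
      ((W.erase v).filter (G.Adj u)).card + if G.Adj u v then 1 else 0 := by
    intro u _
    rw [Finset.filter_erase]
    by_cases h : G.Adj u v
    · have hm : v ∈ W.filter (G.Adj u) := Finset.mem_filter.mpr ⟨hv, h⟩
      simp only [h, if_true]
      exact (Finset.card_erase_add_one hm).symm
    · simp [h]
  have h2 : ∑ u ∈ W.erase v, (if G.Adj u v then 1 else 0) = (W.filter (G.Adj v)).card := by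
    rw [← Finset.card_filter]
    congr 1
    ext u
    simp only [Finset.mem_filter, Finset.mem_erase, G.adj_comm u v]
    exact ⟨fun h => ⟨h.1.2, h.2⟩, fun h => ⟨⟨h.2.ne', h.1⟩, h.2⟩⟩
  unfold degSum
  rw [← Finset.add_sum_erase W _ hv, Finset.sum_congr rfl h1, Finset.sum_add_distrib, h2]
  omega

/-- Mader's theorem: a graph with at least `2 ^ r |W| / 2` edges on a nonempty vertex set `W` has a
complete minor on `r` vertices. -/
theorem exists_top_model_of_le_degSum (r : ℕ) : ∀ W : Finset V, W.Nonempty →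
    2 ^ r * W.card ≤ degSum G W →
    ∃ B : Fin r → Set V, IsModel ⊤ G B ∧ ∀ i, B i ⊆ W := by
  induction r with
  | zero => exact fun W _ _ => ⟨fun i => i.elim0, ⟨fun i => i.elim0, fun i => i.elim0,
      fun i => i.elim0⟩, fun i => i.elim0⟩
  | succ r ihr =>
    intro W
    induction W using Finset.strongInduction with
    | H W ihW =>
      intro hW hdeg
      let N : Finset V → Finset V := fun U => (W \ U).filter fun v => ∃ u ∈ U, G.Adj u v
      -- Connected sets whose contraction to one vertex preserves the density: the right side is
      -- twice the number of edges after contraction, and `W.card + 1 - U.card` is the number of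
      -- vertices.
      let good : Finset (Finset V) := W.powerset.filter fun U => (G.induce (U : Set V)).Connected ∧
        2 ^ (r + 1) * (W.card + 1 - U.card) ≤ degSum G (W \ U) + 2 * (N U).card
      obtain ⟨w₀, hw₀⟩ := hW
      have hgood : good.Nonempty := by
        refine ⟨{w₀}, Finset.mem_filter.mpr ⟨by simpa using hw₀, ?_, ?_⟩⟩
        · rw [Finset.coe_singleton]; exact connected_induce_singleton G w₀
        · have hN : N {w₀} = W.filter (G.Adj w₀) := by
            ext v
            simp only [N, Finset.mem_filter, Finset.mem_sdiff, Finset.mem_singleton,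
              exists_eq_left]
            exact ⟨fun h => ⟨h.1.1, h.2⟩, fun h => ⟨⟨h.1, h.2.ne'⟩, h.2⟩⟩
          rw [hN, Finset.sdiff_singleton_eq_erase, degSum_erase G hw₀]
          simpa using hdeg
      obtain ⟨U, hU, hmax⟩ := good.exists_max_image Finset.card hgood
      obtain ⟨hUW, hUc, hUd⟩ := Finset.mem_filter.mp hU
      rw [Finset.mem_powerset] at hUW
      have hUcard := Finset.card_le_card hUW
      have hUne : U.Nonempty := Finset.coe_nonempty.mp (connected_induce_iff_closed.mp hUc).1
      have hsd : (W \ U).card = W.card - U.card := Finset.card_sdiff_of_subset hUW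
      have hpow : 0 < 2 ^ (r + 1) := by positivity
      rcases (N U).eq_empty_or_nonempty with hN | hN
      · rw [hN, Finset.card_empty, Nat.mul_zero, Nat.add_zero] at hUd
        have hle : 2 ^ (r + 1) * (W \ U).card ≤ degSum G (W \ U) :=
          le_trans (Nat.mul_le_mul_left _ (by omega)) hUd
        have hne : (W \ U).Nonempty := by
          rw [Finset.nonempty_iff_ne_empty]
          intro h0
          rw [h0] at hUd
          have : 1 ≤ W.card + 1 - U.card := by omega
          have := Nat.mul_le_mul_left (2 ^ (r + 1)) this
          simp only [degSum, Finset.sum_empty] at hUd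
          omega
        obtain ⟨B, hB, hBW⟩ := ihW (W \ U) (Finset.sdiff_ssubset hUW hUne) hne hle
        exact ⟨B, hB, fun i => (hBW i).trans (by simp)⟩
      -- Absorbing `v` into `U` costs one edge plus one for each neighbour of `v` in `N U`. With
      -- fewer than `2 ^ r` such neighbours the density would survive, contradicting maximality. So
      -- `N U` is dense enough for `r`, and `U` supplies the extra branch set.
      · have hmin : ∀ v ∈ N U, 2 ^ r ≤ ((N U).filter (G.Adj v)).card := by
          intro v hv
          obtain ⟨hvW, u, huU, huv⟩ := Finset.mem_filter.mp hv
          obtain ⟨hvW, hvU⟩ := Finset.mem_sdiff.mp hvW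
          by_contra! hlt
          have hcon : (G.induce ((insert v U : Finset V) : Set V)).Connected := by
            rw [Finset.coe_insert, Set.insert_eq, Set.union_comm]
            exact connected_induce_union hUc.preconnected
              (connected_induce_singleton G v).preconnected huU rfl huv
          have hins : W \ insert v U = (W \ U).erase v := by
            ext x; simp only [Finset.mem_sdiff, Finset.mem_insert, Finset.mem_erase]; tauto
          have hNins : N (insert v U) =
              (N U).erase v ∪ ((W \ U) \ N U).filter (G.Adj v) := by
            ext x
            simp only [N, hins, Finset.mem_filter, Finset.mem_sdiff, Finset.mem_erase,
              Finset.mem_union, Finset.mem_insert, exists_eq_or_imp]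
            have hne : G.Adj v x → x ≠ v := fun h => h.ne'
            generalize (∃ a ∈ U, G.Adj a x) = P
            by_cases hP : P <;> simp only [hP, or_true, or_false, and_true, and_false,
              not_false_eq_true, false_or] <;> tauto
          have hcardN : (N (insert v U)).card =
              ((N U).card - 1) + (((W \ U) \ N U).filter (G.Adj v)).card := by
            rw [hNins, Finset.card_union_of_disjoint, Finset.card_erase_of_mem hv]
            rw [Finset.disjoint_left]
            intro x hx hx'
            exact (Finset.mem_sdiff.mp (Finset.mem_filter.mp hx').1).2 (Finset.mem_of_mem_erase hx)
          have hsplit : ((W \ U).filter (G.Adj v)).card =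
              ((N U).filter (G.Adj v)).card + (((W \ U) \ N U).filter (G.Adj v)).card := by
            rw [← Finset.card_union_of_disjoint, ← Finset.filter_union,
              Finset.union_sdiff_of_subset (Finset.filter_subset _ _)]
            exact Finset.disjoint_filter_filter Finset.disjoint_sdiff
          have hers := degSum_erase G (Finset.mem_sdiff.mpr ⟨hvW, hvU⟩)
          have hNpos : 1 ≤ (N U).card := Finset.card_pos.mpr ⟨v, hv⟩
          have := hmax (insert v U) (Finset.mem_filter.mpr
            ⟨Finset.mem_powerset.mpr (Finset.insert_subset hvW hUW), hcon, ?_⟩)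
          · rw [Finset.card_insert_of_notMem hvU] at this; omega
          · have hc : U.card + 1 ≤ W.card := by
              rw [← Finset.card_insert_of_notMem hvU]
              exact Finset.card_le_card (Finset.insert_subset hvW hUW)
            rw [Finset.card_insert_of_notMem hvU, hins, hcardN]
            have e1 : W.card + 1 - U.card = (W.card + 1 - (U.card + 1)) + 1 := by omega
            rw [e1, Nat.mul_add, Nat.mul_one, pow_succ] at hUd
            rw [pow_succ]
            omega
        obtain ⟨B, hB, hBN⟩ := ihr (N U) hN (by
          rw [Nat.mul_comm, ← smul_eq_mul]
          exact Finset.card_nsmul_le_sum _ _ _ hmin)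
        have hNW : ∀ x ∈ N U, x ∈ W ∧ x ∉ U ∧ ∃ u ∈ U, G.Adj u x := fun x hx =>
          ⟨(Finset.mem_sdiff.mp (Finset.mem_filter.mp hx).1).1,
            (Finset.mem_sdiff.mp (Finset.mem_filter.mp hx).1).2, (Finset.mem_filter.mp hx).2⟩
        have hd : ∀ i, Disjoint (U : Set V) (B i) := fun i =>
          Set.disjoint_left.mpr fun x hx hx' => (hNW x (hBN i hx')).2.1 hx
        have ha : ∀ i, ∃ x ∈ (U : Set V), ∃ y ∈ B i, G.Adj x y := fun i => by
          obtain ⟨y, hy⟩ := hB.nonempty i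
          obtain ⟨u, hu, huy⟩ := (hNW y (hBN i hy)).2.2
          exact ⟨u, hu, y, hy, huy⟩
        refine ⟨Fin.cons (U : Set V) B, ⟨?_, ?_, ?_⟩, ?_⟩
        · refine Fin.cases hUc fun i => hB.connected i
        · refine Fin.cases ?_ fun i => ?_ <;> refine Fin.cases ?_ fun j => ?_
          · exact fun h => absurd rfl h
          · exact fun _ => hd j
          · exact fun _ => (hd i).symm
          · exact fun h => hB.disjoint i j fun h' => h (by rw [h'])
        · refine Fin.cases ?_ fun i => ?_ <;> refine Fin.cases ?_ fun j => ?_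
          · exact fun h => absurd rfl h.ne
          · exact fun _ => ha j
          · intro _
            obtain ⟨x, hx, y, hy, hxy⟩ := ha i
            exact ⟨y, hy, x, hx, hxy.symm⟩
          · exact fun h => hB.adj i j fun h' => h.ne (by rw [h'])
        · refine Fin.cases (by simpa using hUW) fun i x hx => (hNW x (hBN i hx)).1

/-- A graph without `H` as a minor is sparse. -/
theorem degSum_le_of_not_minorOf [Finite U] {H : SimpleGraph U} (h : ¬ MinorOf H G)
    (W : Finset V) : degSum G W ≤ 2 ^ Nat.card U * W.card := by
  by_contra! hlt
  have hW : W.Nonempty := by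
    rw [Finset.nonempty_iff_ne_empty]
    rintro rfl
    simp [degSum] at hlt
  obtain ⟨B, hB, -⟩ := exists_top_model_of_le_degSum G (Nat.card U) W hW hlt.le
  refine h (MinorOf.trans (H := (⊤ : SimpleGraph (Fin (Nat.card U)))) ?_ ⟨B, hB⟩)
  exact MinorOf.of_injective (Finite.equivFin U) (Finite.equivFin U).injective
    fun v w hvw h => hvw.ne ((Finite.equivFin U).injective h)

end Mader

end SimpleGraph

namespace FinGraph

open SimpleGraph

/-- A graph without `H` as a minor has no large complete bipartite subgraph `K_{γ_H + 1, M}`. -/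
theorem card_common_neighbors_lt {V : Type*} [Fintype V] {G : SimpleGraph V} [DecidableRel G.Adj]
    {H : FinGraph} (ho : H.order = H.gamma + H.alpha + 1) (hH : ¬ MinorOf H.graph G)
    {X : Finset V} (hX : X.card = H.gamma + 1) :
    (Finset.univ.filter fun v => ∀ x ∈ X, G.Adj x v).card < H.order := by
  by_contra! hle
  set Y := Finset.univ.filter fun v => ∀ x ∈ X, G.Adj x v
  have hYX : ∀ y : Y, ∀ x ∈ X, G.Adj x y.1 := fun y => (Finset.mem_filter.mp y.2).2
  classical
  have := Fintype.ofFinite H.V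
  obtain ⟨I, hind, hI⟩ := exists_isNIndepSet_indepNum (G := H.graph)
  have hI : I.card = H.alpha := hI
  -- A maximum independent set is placed in `Y`; the other `γ_H + 1` vertices of `H` are matched
  -- with `X`, each contracted with a further private vertex of `Y`.
  obtain ⟨e⟩ : Nonempty (H.V ↪ Y) := Function.Embedding.nonempty_of_card_le (by
    rw [Fintype.card_coe, ← Nat.card_eq_fintype_card]; exact hle)
  have hcard : Fintype.card ((I : Set H.V)ᶜ : Set H.V) = Fintype.card X := by
    rw [Fintype.card_coe, ← Nat.card_eq_fintype_card, Nat.card_coe_set_eq]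
    have h1 := ncard_add_ncard_compl (I : Set H.V)
    rw [ncard_coe_finset] at h1
    have h2 : Nat.card H.V = H.gamma + H.alpha + 1 := ho
    omega
  let τ := Fintype.equivOfCardEq hcard
  refine hH (MinorOf.of_common_neighbors (S := (I : Set H.V)) (B := fun v => {(e v.1).1})
    (l := fun v => (τ v).1) (w := fun v => (e v.1).1) ⟨?_, ?_, ?_⟩ ?_ ?_ ?_ ?_ ?_)
  · exact fun v => connected_induce_singleton _ _
  · intro v w hvw
    rw [disjoint_singleton]
    exact fun h => hvw (Subtype.ext (e.injective (Subtype.ext h)))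
  · exact fun v w hvw => absurd hvw (hind v.2 w.2 fun h => hvw.ne (Subtype.ext h))
  · exact fun v w h => τ.injective (Subtype.ext h)
  · exact fun v w h => Subtype.ext (e.injective (Subtype.ext h))
  · exact fun u v => hYX _ _ (τ u).2
  · rintro u v x rfl
    exact hYX _ _ (τ u).2
  · intro u v h
    have := e.injective (Subtype.ext (mem_singleton_iff.mp h))
    exact u.2 (this ▸ v.2)

end FinGraph

end

/-! ### The spectral radius as a maximum of the quadratic form. -/

section

open Set Matrix

namespace SimpleGraph

section QuadForm

variable {V : Type*} [Fintype V] (G : SimpleGraph V) [DecidableRel G.Adj]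

/-- The quadratic form of the adjacency matrix. -/
def quadForm (y : V → ℝ) : ℝ :=
  ∑ u, ∑ v, if G.Adj u v then y u * y v else 0

theorem dotProduct_adjMatrix_mulVec (y : V → ℝ) :
    y ⬝ᵥ (G.adjMatrix ℝ *ᵥ y) = quadForm G y := by
  simp only [dotProduct, mulVec, quadForm, Finset.mul_sum, adjMatrix_apply]
  refine Finset.sum_congr rfl fun u _ => Finset.sum_congr rfl fun v _ => ?_
  split_ifs <;> simp

theorem quadForm_abs_ge (y : V → ℝ) : |quadForm G y| ≤ quadForm G fun v => |y v| := by
  refine (Finset.abs_sum_le_sum_abs _ _).trans (Finset.sum_le_sum fun u _ => ?_)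
  refine (Finset.abs_sum_le_sum_abs _ _).trans (Finset.sum_le_sum fun v _ => ?_)
  split_ifs <;> simp [abs_mul]

theorem quadForm_smul (c : ℝ) (y : V → ℝ) : quadForm G (fun v => c * y v) = c ^ 2 * quadForm G y := by
  simp only [quadForm, Finset.mul_sum]
  refine Finset.sum_congr rfl fun u _ => Finset.sum_congr rfl fun v _ => ?_
  split_ifs
  · ring
  · simp

theorem continuous_quadForm : Continuous fun y : V → ℝ => quadForm G y := by
  unfold quadForm
  refine continuous_finsetSum _ fun u _ => continuous_finsetSum _ fun v _ => ?_
  split_ifs <;> fun_prop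

/-- The largest value of the quadratic form on the unit sphere is attained by a nonnegative
vector. -/
theorem exists_nonneg_max_quadForm [Nonempty V] :
    ∃ x : V → ℝ, (∀ v, 0 ≤ x v) ∧ ∑ v, x v ^ 2 = 1 ∧
    ∀ y : V → ℝ, quadForm G y ≤ quadForm G x * ∑ v, y v ^ 2 := by
  classical
  set K : Set (V → ℝ) := {y | ∑ v, y v ^ 2 = 1} with hK
  have hKc : IsCompact K := by
    refine IsCompact.of_isClosed_subset (isCompact_univ_pi fun _ : V => isCompact_Icc (a := (-1 : ℝ))
      (b := 1)) (isClosed_eq (by fun_prop) continuous_const) ?_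
    intro y hy v _
    have h1 : y v ^ 2 ≤ ∑ v, y v ^ 2 :=
      Finset.single_le_sum (f := fun v => y v ^ 2) (fun v _ => sq_nonneg _) (Finset.mem_univ v)
    rw [show ∑ v, y v ^ 2 = 1 from hy, sq_le_one_iff_abs_le_one] at h1
    exact abs_le.mp h1
  have hKn : K.Nonempty := by
    obtain ⟨v⟩ := ‹Nonempty V›
    exact ⟨Pi.single v 1, by simp [hK, Pi.single_apply]⟩
  obtain ⟨y₀, hy₀, hmax⟩ := hKc.exists_isMaxOn hKn (continuous_quadForm G).continuousOn
  have hsq : ∑ v, |y₀ v| ^ 2 = 1 := by simp only [sq_abs]; exact hy₀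
  refine ⟨fun v => |y₀ v|, fun v => abs_nonneg _, hsq, fun y => ?_⟩
  have hmax' : ∀ y ∈ K, quadForm G y ≤ quadForm G fun v => |y₀ v| := fun y hy =>
    (hmax hy).trans ((le_abs_self _).trans (quadForm_abs_ge G y₀))
  rcases (Finset.sum_nonneg fun v (_ : v ∈ Finset.univ) => sq_nonneg (y v)).eq_or_lt with h0 | hpos
  · have : ∀ v, y v = 0 := fun v => by
      have := (Finset.sum_eq_zero_iff_of_nonneg fun v _ => sq_nonneg (y v)).mp h0.symm v
        (Finset.mem_univ v)
      exact pow_eq_zero_iff (two_ne_zero) |>.mp this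
    simp [quadForm, this]
  · set s := ∑ v, y v ^ 2 with hs
    have hsqrt : Real.sqrt s ^ 2 = s := Real.sq_sqrt hpos.le
    have hmem : (fun v => (Real.sqrt s)⁻¹ * y v) ∈ K := by
      simp only [hK, mem_ofPred_eq, mul_pow, ← Finset.mul_sum, ← hs, inv_pow, hsqrt]
      exact inv_mul_cancel₀ hpos.ne'
    have h1 := hmax' _ hmem
    rw [quadForm_smul, inv_pow, hsqrt, inv_mul_le_iff₀ hpos] at h1
    linarith

/-- The spectral radius of a graph is the maximum of its quadratic form on the unit sphere; it is an
eigenvalue with a nonnegative eigenvector. -/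
theorem exists_perron [Nonempty V] [DecidableEq V] :
    ∃ r : ℝ, 0 ≤ r ∧ spectralRadius ℝ (G.adjMatrix ℝ) = ENNReal.ofReal r ∧
      (∀ y : V → ℝ, quadForm G y ≤ r * ∑ v, y v ^ 2) ∧
      ∃ x : V → ℝ, (∀ v, 0 ≤ x v) ∧ (∃ v, x v ≠ 0) ∧
        ∀ u, ∑ v ∈ G.neighborFinset u, x v = r * x u := by
  obtain ⟨x, hx, hx1, hmax⟩ := exists_nonneg_max_quadForm G
  set r := quadForm G x with hr
  have hdot : ∀ y : V → ℝ, y ⬝ᵥ y = ∑ v, y v ^ 2 := fun y => by simp [dotProduct, sq]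
  have hr0 : 0 ≤ r := Finset.sum_nonneg fun u _ => Finset.sum_nonneg fun v _ => by
    split_ifs
    exacts [mul_nonneg (hx u) (hx v), le_rfl]
  have hval : ∀ y : V → ℝ, y ⬝ᵥ ((r • (1 : Matrix V V ℝ) - G.adjMatrix ℝ) *ᵥ y) =
      r * ∑ v, y v ^ 2 - quadForm G y := by
    intro y
    rw [sub_mulVec, dotProduct_sub, smul_mulVec, one_mulVec, dotProduct_smul, hdot,
      dotProduct_adjMatrix_mulVec, smul_eq_mul]
  -- A positive semidefinite matrix annihilates every vector on which its form vanishes; applied to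
  -- the maximizer `x`, this is the eigenvalue equation.
  have hpsd : (r • (1 : Matrix V V ℝ) - G.adjMatrix ℝ).PosSemidef := by
    refine PosSemidef.of_dotProduct_mulVec_nonneg ?_ fun y => ?_
    · refine IsHermitian.sub ?_ (isHermitian_adjMatrix ℝ G)
      rw [IsHermitian, conjTranspose_smul, conjTranspose_one]
      simp
    · rw [star_trivial, hval]
      linarith [hmax y]
  have heig : G.adjMatrix ℝ *ᵥ x = r • x := by
    have := (hpsd.dotProduct_mulVec_zero_iff x).mp (by rw [star_trivial, hval, hx1, ← hr]; ring)
    rw [sub_mulVec, smul_mulVec, one_mulVec, sub_eq_zero] at this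
    exact this.symm
  have hxne : x ≠ 0 := by
    rintro rfl
    simp at hx1
  have hspec : ∀ c : ℝ, c ∈ spectrum ℝ (G.adjMatrix ℝ) ↔ ∃ y : V → ℝ, y ≠ 0 ∧
      G.adjMatrix ℝ *ᵥ y = c • y := by
    intro c
    rw [← spectrum_toLin', ← Module.End.hasEigenvalue_iff_mem_spectrum]
    constructor
    · intro h
      obtain ⟨y, hy⟩ := h.exists_hasEigenvector
      exact ⟨y, hy.2, by simpa using hy.apply_eq_smul⟩
    · rintro ⟨y, hy, h⟩
      exact Module.End.hasEigenvalue_of_hasEigenvector (x := y)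
        ⟨Module.End.mem_eigenspace_iff.mpr (by simpa using h), hy⟩
  refine ⟨r, hr0, le_antisymm ?_ ?_, hmax, x, hx, ?_, ?_⟩
  · refine iSup₂_le fun c hc => ?_
    obtain ⟨y, hy, hyc⟩ := (hspec c).mp hc
    have hpos : 0 < ∑ v, y v ^ 2 := by
      rw [← hdot]
      exact lt_of_le_of_ne (by rw [hdot]; exact Finset.sum_nonneg fun v _ => sq_nonneg _)
        fun h => hy (dotProduct_self_eq_zero.mp h.symm)
    have h1 : quadForm G y = c * ∑ v, y v ^ 2 := by
      rw [← dotProduct_adjMatrix_mulVec, hyc, dotProduct_smul, hdot, smul_eq_mul]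
    have h2 : |c| * ∑ v, y v ^ 2 ≤ r * ∑ v, y v ^ 2 := by
      have h3 := (quadForm_abs_ge G y).trans (hmax _)
      rw [h1, abs_mul, abs_of_pos hpos] at h3
      simpa [sq_abs] using h3
    have h3 : |c| ≤ r := le_of_mul_le_mul_right h2 hpos
    rw [← enorm_eq_nnnorm, ← ofReal_norm, Real.norm_eq_abs]
    exact ENNReal.ofReal_le_ofReal h3
  · have hmem : r ∈ spectrum ℝ (G.adjMatrix ℝ) := (hspec r).mpr ⟨x, hxne, heig⟩
    refine le_trans (le_of_eq ?_) (le_iSup₂ (f := fun (c : ℝ)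
      (_ : c ∈ spectrum ℝ (G.adjMatrix ℝ)) => (‖c‖₊ : ENNReal)) r hmem)
    rw [← enorm_eq_nnnorm, ← ofReal_norm, Real.norm_eq_abs, abs_of_nonneg hr0]
  · by_contra! h
    exact hxne (funext h)
  · intro u
    rw [← adjMatrix_mulVec_apply, heig]
    rfl

end QuadForm

end SimpleGraph

namespace FinGraph

open SimpleGraph

theorem exists_perron (G : FinGraph) [Fintype G.V] [DecidableRel G.graph.Adj] [Nonempty G.V] :
    ∃ r : ℝ, 0 ≤ r ∧ G.rho = ENNReal.ofReal r ∧
      (∀ y : G.V → ℝ, quadForm G.graph y ≤ r * ∑ v, y v ^ 2) ∧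
      ∃ x : G.V → ℝ, (∀ v, 0 ≤ x v) ∧ (∃ v, x v ≠ 0) ∧
        ∀ u, ∑ v ∈ G.graph.neighborFinset u, x v = r * x u := by
  classical
  have h := SimpleGraph.exists_perron G.graph
  have hrho : G.rho = spectralRadius ℝ (G.graph.adjMatrix ℝ) := by
    unfold rho
    congr!
  rwa [hrho]

end FinGraph

end

/-! ### Eigenvectors of sparse graphs and the dominant vertices. -/

section

open Set

namespace SimpleGraph

theorem quadForm_eq_of_eigen {V : Type*} [Fintype V] {G : SimpleGraph V} [DecidableRel G.Adj]
    {r : ℝ} {x : V → ℝ} (h : ∀ u, ∑ v ∈ G.neighborFinset u, x v = r * x u) :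
    quadForm G x = r * ∑ v, x v ^ 2 := by
  rw [quadForm, Finset.mul_sum]
  refine Finset.sum_congr rfl fun u _ => ?_
  rw [← Finset.sum_filter, ← Finset.mul_sum, ← G.neighborFinset_eq_filter, h]
  ring

theorem degree_le_card {V : Type*} [Fintype V] (G : SimpleGraph V) [DecidableRel G.Adj] (v : V) :
    (G.degree v : ℝ) ≤ Fintype.card V := by
  rw [← card_neighborFinset_eq_degree]; exact_mod_cast Finset.card_le_univ _

/-- A sparse graph with a nonnegative eigenvector with largest entry at most one. -/
structure SparseEigen {V : Type*} [Fintype V] [DecidableEq V] (G : SimpleGraph V)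
    [DecidableRel G.Adj] (C : ℕ) (r : ℝ) (x : V → ℝ) : Prop where
  sparse : ∀ W : Finset V, degSum G W ≤ C * W.card
  r_nonneg : 0 ≤ r
  nonneg : ∀ v, 0 ≤ x v
  le_one : ∀ v, x v ≤ 1
  eigen : ∀ u, ∑ v ∈ G.neighborFinset u, x v = r * x u

namespace SparseEigen

variable {V : Type*} [Fintype V] [DecidableEq V] {G : SimpleGraph V} [DecidableRel G.Adj]
  {C : ℕ} {r : ℝ} {x : V → ℝ}

theorem sum_degree_le (h : SparseEigen G C r x) :
    ∑ v, (G.degree v : ℝ) ≤ C * Fintype.card V := by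
  have := h.sparse Finset.univ
  simp only [degSum, Finset.card_univ] at this
  have h2 : ∀ v, (Finset.univ.filter (G.Adj v)).card = G.degree v := fun v => by
    rw [← card_neighborFinset_eq_degree, neighborFinset_eq_filter]
  simp only [h2] at this
  exact_mod_cast this

/-- All these adjacent pairs lie inside `N(u) ∪ L`, where sparsity applies. -/
theorem sum_inter_le (h : SparseEigen G C r x) (u : V) (L : Finset V) :
    ∑ v ∈ G.neighborFinset u, ((G.neighborFinset v ∩ L).card : ℝ) ≤ C * (G.degree u + L.card) := by
  have h1 := h.sparse (G.neighborFinset u ∪ L)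
  have h2 : ∑ v ∈ G.neighborFinset u, (G.neighborFinset v ∩ L).card ≤
      degSum G (G.neighborFinset u ∪ L) := by
    unfold degSum
    refine (Finset.sum_le_sum_of_subset Finset.subset_union_left).trans
      (Finset.sum_le_sum fun v _ => Finset.card_le_card fun w hw => ?_)
    rw [Finset.mem_inter, mem_neighborFinset] at hw
    exact Finset.mem_filter.mpr ⟨Finset.mem_union_right _ hw.2, hw.1⟩
  have h3 : (G.neighborFinset u ∪ L).card ≤ G.degree u + L.card := Finset.card_union_le _ _
  have h4 := h2.trans (h1.trans (Nat.mul_le_mul_left C h3))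
  exact_mod_cast h4

/-- Counting walks of length two from `u`, the entries outside `L` contribute little. -/
theorem sq_mul_le (h : SparseEigen G C r x) {L : Finset V} {ε : ℝ} (hε : 0 ≤ ε)
    (hL : ∀ w ∉ L, x w ≤ ε) (u : V) :
    r ^ 2 * x u ≤ ∑ v ∈ G.neighborFinset u, ∑ w ∈ G.neighborFinset v ∩ L, x w +
      ε * (C * Fintype.card V) := by
  have h1 : r ^ 2 * x u = ∑ v ∈ G.neighborFinset u, ∑ w ∈ G.neighborFinset v, x w := by
    simp only [h.eigen, ← Finset.mul_sum]; ring
  have h2 : ∀ v, ∑ w ∈ G.neighborFinset v, x w ≤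
      ∑ w ∈ G.neighborFinset v ∩ L, x w + ε * G.degree v := by
    intro v
    rw [← Finset.sum_inter_add_sum_sdiff (G.neighborFinset v) L]
    gcongr
    refine (Finset.sum_le_card_nsmul _ _ ε fun w hw => hL w (Finset.mem_sdiff.mp hw).2).trans ?_
    rw [nsmul_eq_mul, mul_comm]
    gcongr
    exact Finset.card_le_card Finset.sdiff_subset
  rw [h1]
  refine (Finset.sum_le_sum fun v _ => h2 v).trans ?_
  rw [Finset.sum_add_distrib, ← Finset.mul_sum]
  gcongr
  refine (Finset.sum_le_sum_of_subset_of_nonneg (Finset.subset_univ _) fun v _ _ => by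
    positivity).trans h.sum_degree_le

theorem sq_mul_le_card (h : SparseEigen G C r x) {L : Finset V} {ε : ℝ} (hε : 0 ≤ ε)
    (hL : ∀ w ∉ L, x w ≤ ε) (u : V) :
    r ^ 2 * x u ≤ ∑ v ∈ G.neighborFinset u, ((G.neighborFinset v ∩ L).card : ℝ) +
      ε * (C * Fintype.card V) := by
  refine (h.sq_mul_le hε hL u).trans ?_
  gcongr with v _
  refine (Finset.sum_le_card_nsmul _ _ 1 fun w _ => h.le_one w).trans (by simp)

/-- Summing the eigenvalue equation over all vertices bounds `r` times the total of the entries by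
the total degree. This is only a first estimate, which `card_large_le` improves to a constant. -/
theorem card_large_mul_le (h : SparseEigen G C r x) (ε : ℝ) :
    ((Finset.univ.filter fun v => ε < x v).card : ℝ) * ε * r ≤ C * Fintype.card V := by
  have h1 : ((Finset.univ.filter fun v => ε < x v).card : ℝ) * ε ≤ ∑ v, x v := by
    rw [← nsmul_eq_mul]
    refine (Finset.card_nsmul_le_sum _ _ ε fun v hv => (Finset.mem_filter.mp hv).2.le).trans ?_
    exact Finset.sum_le_sum_of_subset_of_nonneg (Finset.subset_univ _) fun v _ _ => h.nonneg v
  refine (mul_le_mul_of_nonneg_right h1 h.r_nonneg).trans ?_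
  have h2 : (∑ v, x v) * r = ∑ v, ∑ w ∈ G.neighborFinset v, x w := by
    simp only [h.eigen, ← Finset.mul_sum]; ring
  rw [h2]
  refine le_trans (Finset.sum_le_sum fun v _ => ?_) h.sum_degree_le
  refine (Finset.sum_le_card_nsmul _ _ 1 fun w _ => h.le_one w).trans (by simp)

/-- There are boundedly many entries above a fixed threshold. -/
theorem card_large_le (h : SparseEigen G C r x) (hC : 1 ≤ C) {η : ℝ} (hη : 0 < η)
    (hr : (Fintype.card V : ℝ) / 2 ≤ r ^ 2)
    (hn : 2 * C ^ 2 / (η / (8 * C)) ^ 4 ≤ (Fintype.card V : ℝ)) :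
    ((Finset.univ.filter fun v => η < x v).card : ℝ) ≤ 4 * C ^ 2 / η := by
  set n : ℝ := (Fintype.card V : ℝ) with hn'
  have hC' : (1 : ℝ) ≤ C := by exact_mod_cast hC
  have hC0 : (0 : ℝ) < C := by linarith
  -- With this `ε` both error terms in the two-step walk count are at most `ηn / 8`. An entry above
  -- `η` then forces degree at least `ηn / (4C)`, and the total degree allows only boundedly many
  -- such vertices.
  set ε : ℝ := η / (8 * C) with hε
  have hε0 : 0 < ε := by positivity
  have hn0 : 0 < n := lt_of_lt_of_le (by positivity) hn
  have hrε : C / ε ^ 2 ≤ r := by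
    refine le_of_sq_le_sq ?_ h.r_nonneg
    refine le_trans ?_ hr
    rw [div_pow, ← pow_mul]
    norm_num
    rw [div_le_iff₀ (by positivity)] at hn
    rw [div_le_iff₀ (by positivity)]
    linarith
  have hr0 : 0 < r := lt_of_lt_of_le (by positivity) hrε
  have hcard : ((Finset.univ.filter fun v => ε < x v).card : ℝ) ≤ ε * n := by
    have h1 := h.card_large_mul_le ε
    rw [div_le_iff₀ (by positivity)] at hrε
    refine le_of_mul_le_mul_right ?_ (mul_pos hε0 hr0)
    calc _ = ((Finset.univ.filter fun v => ε < x v).card : ℝ) * ε * r := by ring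
      _ ≤ C * n := h1
      _ ≤ (r * ε ^ 2) * n := by gcongr
      _ = _ := by ring
  have hdeg : ∀ u, η < x u → η * n / 4 ≤ C * G.degree u := by
    intro u hu
    have h1 := h.sq_mul_le_card hε0.le (L := Finset.univ.filter fun v => ε < x v)
      (fun w hw => by simpa using hw) u
    have h2 := h.sum_inter_le u (Finset.univ.filter fun v => ε < x v)
    have h3 : n / 2 * η ≤ r ^ 2 * x u := by gcongr
    have h4 : (C : ℝ) * (Finset.univ.filter fun v => ε < x v).card ≤ C * (ε * n) := by gcongr
    have h5 : C * (ε * n) = η * n / 8 := by rw [hε]; field_simp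
    have h6 : ε * (C * n) = η * n / 8 := by rw [hε]; field_simp
    rw [mul_add] at h2
    linarith
  have h1 : ((Finset.univ.filter fun v => η < x v).card : ℝ) * (η * n / 4) ≤ C * (C * n) := by
    rw [← nsmul_eq_mul]
    refine (Finset.card_nsmul_le_sum _ (fun u => (C : ℝ) * G.degree u) _ fun v hv =>
      hdeg v (Finset.mem_filter.mp hv).2).trans ?_
    rw [← Finset.mul_sum]
    gcongr
    exact (Finset.sum_le_sum_of_subset_of_nonneg (Finset.subset_univ _) fun v _ _ => by
      positivity).trans h.sum_degree_le
  rw [le_div_iff₀ hη]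
  refine le_of_mul_le_mul_right ?_ hn0
  linarith

/-- In a graph without `K_{k+1,M}`, few vertices have more than `k` neighbours in a small set. -/
theorem sum_inter_le_of_forall_common (G : SimpleGraph V) [DecidableRel G.Adj] {k M K : ℕ}
    (hK : ∀ X : Finset V, X.card = k + 1 →
      (Finset.univ.filter fun v => ∀ y ∈ X, G.Adj y v).card < M)
    {L : Finset V} (hL : L.card ≤ K) (u : V) :
    ∑ v ∈ G.neighborFinset u, ((G.neighborFinset v ∩ L).card : ℝ) ≤
      k * G.degree u + (2 ^ K * M * K : ℕ) := by
  set Q : Finset V := Finset.univ.filter fun v => k < (G.neighborFinset v ∩ L).card with hQ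
  have hQcard : Q.card ≤ 2 ^ K * M := by
    have hsub : Q ⊆ (L.powersetCard (k + 1)).biUnion fun X =>
        Finset.univ.filter fun v => ∀ y ∈ X, G.Adj y v := by
      intro v hv
      obtain ⟨X, hX, hXc⟩ := Finset.exists_subset_card_eq (Nat.succ_le_of_lt (Finset.mem_filter.mp hv).2)
      refine Finset.mem_biUnion.mpr ⟨X, Finset.mem_powersetCard.mpr
        ⟨hX.trans Finset.inter_subset_right, hXc⟩, Finset.mem_filter.mpr ⟨Finset.mem_univ _, ?_⟩⟩
      intro y hy
      have := Finset.mem_inter.mp (hX hy)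
      exact ((mem_neighborFinset _ _ _).mp this.1).symm
    refine (Finset.card_le_card hsub).trans ((Finset.card_biUnion_le_card_mul _ _ M fun X hX =>
      (hK X (Finset.mem_powersetCard.mp hX).2).le).trans (Nat.mul_le_mul_right _ ?_))
    rw [Finset.card_powersetCard]
    exact (Nat.choose_le_two_pow _ _).trans (Nat.pow_le_pow_right (by norm_num) hL)
  have h1 : ∀ v, (G.neighborFinset v ∩ L).card ≤ k + if v ∈ Q then K else 0 := by
    intro v
    by_cases hv : v ∈ Q
    · simp only [hv, if_true]
      exact (Finset.card_le_card Finset.inter_subset_right).trans (by omega)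
    · simp only [hv, if_false]
      simpa [hQ] using hv
  have h2 : ∑ v ∈ G.neighborFinset u, (G.neighborFinset v ∩ L).card ≤
      k * G.degree u + 2 ^ K * M * K := by
    refine (Finset.sum_le_sum fun v _ => h1 v).trans ?_
    rw [Finset.sum_add_distrib, Finset.sum_const, card_neighborFinset_eq_degree, smul_eq_mul,
      Finset.sum_ite_mem, Finset.sum_const, smul_eq_mul, mul_comm k]
    gcongr
    exact (Finset.card_le_card Finset.inter_subset_right).trans hQcard
  exact_mod_cast h2

/-- The vertices that miss a neighbour in `X` are few if the vertices of `X` have large degree. -/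
theorem card_sub_le_card_common (G : SimpleGraph V) [DecidableRel G.Adj] {X : Finset V} {d : ℝ}
    (hX : ∀ y ∈ X, (Fintype.card V : ℝ) - G.degree y ≤ d) :
    (Fintype.card V : ℝ) - X.card * d ≤
      (Finset.univ.filter fun v => ∀ y ∈ X, G.Adj y v).card := by
  have hcov : (Finset.univ : Finset V) ⊆ (Finset.univ.filter fun v => ∀ y ∈ X, G.Adj y v) ∪
      X.biUnion fun y => (G.neighborFinset y)ᶜ := by
    intro v _
    by_cases hv : ∀ y ∈ X, G.Adj y v
    · exact Finset.mem_union_left _ (Finset.mem_filter.mpr ⟨Finset.mem_univ _, hv⟩)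
    · push Not at hv
      obtain ⟨y, hy, hyv⟩ := hv
      exact Finset.mem_union_right _ (Finset.mem_biUnion.mpr ⟨y, hy, by simpa using hyv⟩)
  have h1 := (Finset.card_le_card hcov).trans ((Finset.card_union_le _ _).trans
    (Nat.add_le_add_left Finset.card_biUnion_le _))
  have h2 : ∑ y ∈ X, (((G.neighborFinset y)ᶜ.card : ℕ) : ℝ) ≤ X.card * d := by
    rw [← nsmul_eq_mul]
    refine Finset.sum_le_card_nsmul _ _ _ fun y hy => ?_
    rw [Finset.card_compl, card_neighborFinset_eq_degree, Nat.cast_sub (by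
      rw [← card_neighborFinset_eq_degree]; exact Finset.card_le_univ _)]
    exact hX y hy
  have h3 : (Fintype.card V : ℝ) ≤ (Finset.univ.filter fun v => ∀ y ∈ X, G.Adj y v).card +
      ∑ y ∈ X, (((G.neighborFinset y)ᶜ.card : ℕ) : ℝ) := by
    rw [Finset.card_univ] at h1
    exact_mod_cast h1
  linarith

/-- Walks of length two give `k(n - k) x_u ≤ r² x_u ≤ k deg(u) + c + Cηn`; dividing by `k` shows
that an entry near one forces almost full degree. -/
theorem mul_sub_le_degree (h : SparseEigen G C r x) {k c : ℕ} (hk : 1 ≤ k) {η : ℝ} (hη : 0 ≤ η)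
    {L : Finset V} (hL : ∀ w ∉ L, x w ≤ η)
    (hsum : ∀ u, ∑ v ∈ G.neighborFinset u, ((G.neighborFinset v ∩ L).card : ℝ) ≤
      k * G.degree u + c)
    (hr : (k : ℝ) * (Fintype.card V - k) ≤ r ^ 2) (hn : (c : ℝ) + k ^ 2 ≤ C * η * Fintype.card V)
    (u : V) : Fintype.card V * x u - 2 * (C * η) * Fintype.card V ≤ G.degree u := by
  have hk' : (1 : ℝ) ≤ k := by exact_mod_cast hk
  have h1 := (h.sq_mul_le_card hη hL u).trans (add_le_add_left (hsum u) _)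
  have h2 : (k : ℝ) * (Fintype.card V - k) * x u ≤ r ^ 2 * x u :=
    mul_le_mul_of_nonneg_right hr (h.nonneg u)
  have h3 : (k : ℝ) ^ 2 * x u ≤ k ^ 2 := mul_le_of_le_one_right (by positivity) (h.le_one u)
  have h5 : (0 : ℝ) ≤ C * η * Fintype.card V := by positivity
  have h7 : C * η * Fintype.card V ≤ k * (C * η * Fintype.card V) := le_mul_of_one_le_left h5 hk'
  refine le_of_mul_le_mul_left (a := (k : ℝ)) ?_ (by linarith)
  calc (k : ℝ) * (Fintype.card V * x u - 2 * (C * η) * Fintype.card V)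
      = k * (Fintype.card V - k) * x u + k ^ 2 * x u - 2 * (k * (C * η * Fintype.card V)) := by ring
    _ ≤ k * G.degree u := by linarith

/-- At `z` the walk count is almost tight, so the deficits `1 - x_w`, summed over walks `z v w` with
`w ∈ L`, total at most `2Cηn`. A given `w` is reached through at least `n(x_w - 4Cη)` vertices `v`.
Hence the entry is either close to zero or close to one. -/
theorem entry_gap (h : SparseEigen G C r x) {k c : ℕ} (hk : 1 ≤ k) {η : ℝ} (hη : 0 ≤ η)
    {L : Finset V} (hL : ∀ w ∉ L, x w ≤ η)
    (hsum : ∀ u, ∑ v ∈ G.neighborFinset u, ((G.neighborFinset v ∩ L).card : ℝ) ≤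
      k * G.degree u + c)
    (hr : (k : ℝ) * (Fintype.card V - k) ≤ r ^ 2) (hn : (c : ℝ) + k ^ 2 ≤ C * η * Fintype.card V)
    {z : V} (hz : x z = 1) {w : V} (hw : w ∈ L) :
    Fintype.card V * ((x w - 4 * (C * η)) * (1 - x w)) ≤ Fintype.card V * (2 * (C * η)) := by
  have h0 : 0 ≤ 1 - x w := by linarith [h.le_one w]
  have hgap : ((G.neighborFinset z ∩ G.neighborFinset w).card : ℝ) * (1 - x w) ≤
      2 * (C * η) * Fintype.card V := by
    have h1 := h.sq_mul_le hη hL z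
    have h2 := hsum z
    have h3 : (k : ℝ) * G.degree z ≤ k * Fintype.card V :=
      mul_le_mul_of_nonneg_left (degree_le_card G z) (by positivity)
    have h4 : ∑ v ∈ G.neighborFinset z, ∑ w ∈ G.neighborFinset v ∩ L, (1 - x w) ≤
        2 * (C * η) * Fintype.card V := by
      simp only [Finset.sum_sub_distrib, Finset.sum_const, nsmul_eq_mul, mul_one]
      rw [hz] at h1
      linarith
    refine le_trans ?_ h4
    have h5 : ∀ v ∈ G.neighborFinset z, (if v ∈ G.neighborFinset w then 1 - x w else 0) ≤
        ∑ w ∈ G.neighborFinset v ∩ L, (1 - x w) := by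
      intro v _
      have hnn : ∀ w ∈ G.neighborFinset v ∩ L, 0 ≤ 1 - x w := fun w _ => by
        linarith [h.le_one w]
      split_ifs with hv
      · refine Finset.single_le_sum (f := fun w => 1 - x w) hnn (Finset.mem_inter.mpr ⟨?_, hw⟩)
        rw [mem_neighborFinset] at hv ⊢
        exact hv.symm
      · exact Finset.sum_nonneg hnn
    refine le_trans (le_of_eq ?_) (Finset.sum_le_sum h5)
    rw [Finset.sum_ite_mem, Finset.sum_const, nsmul_eq_mul]
  have hcommon : Fintype.card V * (x w - 4 * (C * η)) ≤
      ((G.neighborFinset z ∩ G.neighborFinset w).card : ℝ) := by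
    have h1 := h.mul_sub_le_degree hk hη hL hsum hr hn z
    have h2 := h.mul_sub_le_degree hk hη hL hsum hr hn w
    have h3 := Finset.card_union_add_card_inter (G.neighborFinset z) (G.neighborFinset w)
    have h4 : (G.neighborFinset z ∪ G.neighborFinset w).card ≤ Fintype.card V :=
      Finset.card_le_univ _
    rw [card_neighborFinset_eq_degree, card_neighborFinset_eq_degree] at h3
    have h5 : (G.degree z : ℝ) + G.degree w ≤
        Fintype.card V + (G.neighborFinset z ∩ G.neighborFinset w).card := by
      exact_mod_cast (by omega : G.degree z + G.degree w ≤ Fintype.card V +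
        (G.neighborFinset z ∩ G.neighborFinset w).card)
    rw [hz] at h1
    linarith
  have h4 := (mul_le_mul_of_nonneg_right hcommon h0).trans hgap
  linarith

end SparseEigen

/-- If `r² ≥ k (n - k)` is attained in a sparse graph without `K_{k+1,M}` and `n` is large, then
exactly `k` entries of the eigenvector are close to the maximum, at vertices of almost full degree,
and all other entries are small. -/
theorem exists_dominant_set {k C : ℕ} (hk : 1 ≤ k) (hC : 1 ≤ C) (M : ℕ) {δ : ℝ} (hδ : 0 < δ) :
    ∃ N : ℕ, ∀ {V : Type} [Fintype V] [DecidableEq V] (G : SimpleGraph V) [DecidableRel G.Adj]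
      (r : ℝ) (x : V → ℝ) (z : V), N ≤ Fintype.card V → SparseEigen G C r x →
      (∀ X : Finset V, X.card = k + 1 →
        (Finset.univ.filter fun v => ∀ y ∈ X, G.Adj y v).card < M) →
      (k : ℝ) * (Fintype.card V - k) ≤ r ^ 2 → x z = 1 →
      ∃ L : Finset V, L.card = k ∧
        (∀ v ∈ L, 1 - δ ≤ x v ∧ (1 - δ) * Fintype.card V ≤ G.degree v) ∧ ∀ v ∉ L, x v ≤ δ := by
  have hC' : (1 : ℝ) ≤ C := by exact_mod_cast hC
  have hk' : (1 : ℝ) ≤ k := by exact_mod_cast hk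
  -- The bounds serve, in order, the final estimates, the exclusion of `k + 1` large entries, and
  -- the exclusion of fewer than `k`.
  obtain ⟨θ, hθ0, hθδ, hθk, hθC⟩ : ∃ θ : ℝ, 0 < θ ∧ 2 * θ ≤ δ ∧ (k + 1) * (2 * θ) ≤ 1 / 2 ∧
      θ * C ≤ 1 / 4 := by
    refine ⟨min (δ / 2) (min (1 / (4 * (k + 1))) (1 / (4 * C))), by positivity, ?_, ?_, ?_⟩
    · have := min_le_left (δ / 2) (min (1 / (4 * ((k : ℝ) + 1))) (1 / (4 * C)))
      linarith
    · have h1 : min (δ / 2) (min (1 / (4 * ((k : ℝ) + 1))) (1 / (4 * C))) ≤ 1 / (4 * ((k : ℝ) + 1)) :=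
        (min_le_right _ _).trans (min_le_left _ _)
      rw [le_div_iff₀ (by positivity)] at h1
      linarith
    · have h1 : min (δ / 2) (min (1 / (4 * ((k : ℝ) + 1))) (1 / (4 * C))) ≤ 1 / (4 * C) :=
        (min_le_right _ _).trans (min_le_right _ _)
      rw [le_div_iff₀ (by positivity)] at h1
      linarith
  have hθ1 : θ ≤ 1 / 8 := by
    have : 2 * (2 * θ) ≤ ((k : ℝ) + 1) * (2 * θ) := by gcongr; linarith
    linarith
  have hθ2 : θ ^ 2 ≤ θ / 8 := by
    have := mul_le_mul_of_nonneg_left hθ1 hθ0.le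
    rw [sq]; linarith
  set η : ℝ := θ ^ 2 / (8 * C) with hη
  have hη0 : 0 < η := by positivity
  have hCη : C * η = θ ^ 2 / 8 := by rw [hη]; field_simp
  have hηθ : η < θ := by
    have : η ≤ C * η := le_mul_of_one_le_left hη0.le hC'
    linarith
  set K : ℕ := ⌈4 * (C : ℝ) ^ 2 / η⌉₊ with hK
  set c : ℕ := 2 ^ K * M * K with hc
  obtain ⟨N, hN⟩ := exists_nat_ge (2 * (k : ℝ) + 2 * C ^ 2 / (η / (8 * C)) ^ 4 +
    (c + k ^ 2) / (C * η) + 2 * M + 4 * k ^ 2 + 1)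
  refine ⟨N, ?_⟩
  intro V _ _ G _ r x z hNV hx hKM hr hz
  set n : ℝ := (Fintype.card V : ℝ) with hn
  have hNn : (N : ℝ) ≤ n := by rw [hn]; exact_mod_cast hNV
  have p1 : 0 ≤ 2 * (C : ℝ) ^ 2 / (η / (8 * C)) ^ 4 := by positivity
  have p2 : 0 ≤ ((c : ℝ) + k ^ 2) / (C * η) := by positivity
  have p3 : 0 ≤ (M : ℝ) := by positivity
  have p4 : 0 ≤ (k : ℝ) ^ 2 := by positivity
  have n1 : 2 * (k : ℝ) ≤ n := by linarith
  have n2 : 2 * (C : ℝ) ^ 2 / (η / (8 * C)) ^ 4 ≤ n := by linarith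
  have n3 : (c : ℝ) + k ^ 2 ≤ C * η * n := by
    have : ((c : ℝ) + k ^ 2) / (C * η) ≤ n := by linarith
    rw [div_le_iff₀ (by positivity)] at this
    linarith
  have n4 : 2 * (M : ℝ) ≤ n := by linarith
  have n5 : 4 * (k : ℝ) ^ 2 ≤ n := by linarith
  have n6 : 0 < n := by linarith
  clear hNn hN
  have hr2 : n / 2 ≤ r ^ 2 := by
    have h1 : 0 ≤ ((k : ℝ) - 1) * (n - k) := mul_nonneg (by linarith) (by linarith)
    have h2 : ((k : ℝ) - 1) * (n - k) = k * (n - k) - (n - k) := by ring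
    linarith
  set L : Finset V := Finset.univ.filter fun v => η < x v with hL
  have hLK : L.card ≤ K := by
    have := hx.card_large_le hC hη0 hr2 n2
    exact Nat.cast_le.mp (this.trans (Nat.le_ceil _))
  have hLη : ∀ w ∉ L, x w ≤ η := fun w hw => by simpa [hL] using hw
  have hsum : ∀ u, ∑ v ∈ G.neighborFinset u, ((G.neighborFinset v ∩ L).card : ℝ) ≤
      k * G.degree u + c := fun u => SparseEigen.sum_inter_le_of_forall_common G hKM hLK u
  have hdeg : ∀ u, n * x u - 2 * (C * η) * n ≤ G.degree u :=
    hx.mul_sub_le_degree hk hη0.le hLη hsum hr n3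
  -- Since `Cη = θ² / 8`, the dichotomy of `entry_gap` leaves no entry in the interval from `θ` to
  -- `1 - θ`.
  have hlarge : ∀ w, θ ≤ x w → 1 - θ ≤ x w := by
    intro w hw
    have hwL : w ∈ L := by simp only [hL, Finset.mem_filter, Finset.mem_univ, true_and]; linarith
    have h1 := le_of_mul_le_mul_left (hx.entry_gap hk hη0.le hLη hsum hr n3 hz hwL) n6
    have h3 : 0 ≤ 1 - x w := by linarith [hx.le_one w]
    have h5 : (x w - 4 * (θ ^ 2 / 8)) * (1 - x w) ≤ 2 * (θ ^ 2 / 8) := by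
      rwa [hCη] at h1
    have h6 : θ / 2 * (1 - x w) ≤ (x w - 4 * (θ ^ 2 / 8)) * (1 - x w) := by
      gcongr
      linarith
    have h7 : θ / 2 * (1 - x w) ≤ θ / 2 * θ := by
      have : θ / 2 * θ = θ ^ 2 / 2 := by ring
      have := sq_nonneg θ
      linarith
    linarith [le_of_mul_le_mul_left h7 (by linarith)]
  have hlargedeg : ∀ w, θ ≤ x w → (1 - 2 * θ) * n ≤ G.degree w := by
    intro w hw
    have h1 := hdeg w
    have h2 := hlarge w hw
    rw [hCη] at h1
    have h3 : (1 - 2 * θ) ≤ x w - 2 * (θ ^ 2 / 8) := by linarith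
    have h4 := mul_le_mul_of_nonneg_right h3 n6.le
    linarith
  set L' : Finset V := Finset.univ.filter fun v => θ ≤ x v with hL'
  have hmem : ∀ v, v ∈ L' ↔ θ ≤ x v := fun v => by simp [hL']
  -- Any `k + 1` of these vertices would have at least `n / 2 ≥ M` common neighbours.
  have hle : L'.card ≤ k := by
    by_contra! hlt
    obtain ⟨X, hX, hXc⟩ := Finset.exists_subset_card_eq (Nat.succ_le_of_lt hlt)
    have h1 := SparseEigen.card_sub_le_card_common G (X := X) (d := 2 * θ * n) fun y hy => by
      linarith [hlargedeg y ((hmem y).mp (hX hy))]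
    have h2 : ((Finset.univ.filter fun v => ∀ y ∈ X, G.Adj y v).card : ℝ) < M := by
      exact_mod_cast hKM X hXc
    rw [hXc] at h1
    push_cast at h1
    have h3 := mul_le_mul_of_nonneg_right hθk n6.le
    linarith
  -- With fewer than `k` large entries the walk count at `z` is at most `(k - 1)n + n / 4`, which is
  -- below `k(n - k)`.
  have hge : k ≤ L'.card := by
    by_contra! hlt
    have h1 := hx.sq_mul_le_card hθ0.le (L := L') (fun w hw => by
      rw [hmem, not_le] at hw; exact hw.le) z
    have h2 : ∑ v ∈ G.neighborFinset z, ((G.neighborFinset v ∩ L').card : ℝ) ≤ n * (k - 1) := by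
      have h3 : ((L'.card : ℕ) : ℝ) ≤ k - 1 := by
        have : L'.card + 1 ≤ k := hlt
        have : ((L'.card + 1 : ℕ) : ℝ) ≤ k := by exact_mod_cast this
        push_cast at this
        linarith
      refine (Finset.sum_le_card_nsmul _ _ ((k : ℝ) - 1) fun v _ => ?_).trans ?_
      · refine le_trans ?_ h3
        exact_mod_cast Finset.card_le_card Finset.inter_subset_right
      · rw [nsmul_eq_mul, card_neighborFinset_eq_degree]
        exact mul_le_mul_of_nonneg_right (degree_le_card G z) (by linarith)
    rw [hz] at h1
    have h4 := mul_le_mul_of_nonneg_right hθC n6.le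
    linarith
  refine ⟨L', le_antisymm hle hge, fun v hv => ⟨?_, ?_⟩, fun v hv => ?_⟩
  · linarith [hlarge v ((hmem v).mp hv)]
  · refine le_trans ?_ (hlargedeg v ((hmem v).mp hv))
    gcongr
  · rw [hmem, not_le] at hv
    linarith

end SimpleGraph

end

/-! ### Rerouting minors through the reserve, and estimates for edge sums. -/

section

open Set

namespace SimpleGraph

/-- If all edges of the graph are removed except those between common neighbours of `L` outside a
reserve `W` and then all vertices of `L` are made dominating, no minor of small order is created. -/
theorem MinorOf.of_joinGraph_restrict {U V : Type*} [Finite U] [Finite V] {H : SimpleGraph U}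
    {G R : SimpleGraph V} {L P : Set V} {W : Finset V} {h : ℕ} (hU : Nat.card U ≤ h)
    (hLU : L.ncard ≤ Nat.card U) (hW : h + L.ncard ≤ W.card)
    (hR : ∀ u v, R.Adj u v → G.Adj u v ∧ u ∈ P ∧ v ∈ P) (hPW : ∀ v ∈ W, v ∉ P)
    (hLP : ∀ l ∈ L, ∀ v ∈ P, G.Adj l v) (hLW : ∀ l ∈ L, ∀ v ∈ W, G.Adj l v)
    (hH : MinorOf H (joinGraph L R)) : MinorOf H G := by
  classical
  obtain ⟨S, hS, hM⟩ := (minorOf_joinGraph_iff hLU).mp hH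
  obtain ⟨B, hB, -⟩ := minorOf_induce_iff.mp hM
  have hSc := ncard_add_ncard_compl S
  obtain ⟨τ⟩ : Nonempty ((Sᶜ : Set U) ≃ L) := Finite.card_eq.mp (by
    rw [Nat.card_coe_set_eq, Nat.card_coe_set_eq]; omega)
  have := Fintype.ofFinite U
  obtain ⟨e⟩ : Nonempty (U ⊕ Fin L.ncard ↪ W) := Function.Embedding.nonempty_of_card_le (by
    rw [Fintype.card_sum, Fintype.card_fin, Fintype.card_coe, ← Nat.card_eq_fintype_card]; omega)
  have hcard : L.ncard = Nat.card L := (Nat.card_coe_set_eq L).symm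
  let ι : L ≃ Fin L.ncard := (Finite.equivFin L).trans (finCongr hcard.symm)
  have hclosed : ∀ s, ∀ a ∈ B s, a ∈ P → B s ⊆ P := fun s a ha haP =>
    (connected_induce_iff_closed.mp (hB.connected s)).2 P ⟨a, ha, haP⟩
      fun x _ _ y _ hxy => (hR x y hxy).2.2
  -- A branch set not contained in `P` misses `P` and meets no edge of `R`, so its vertex is
  -- isolated in `H[S]` and can move to a fresh vertex of `W`. Further vertices of `W` are
  -- contracted into `L`, which need not be a clique in `G`; hence the size `h + |L|`.
  let B' : S → Set V := fun s => if B s ⊆ P then B s else {(e (Sum.inl s.1)).1}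
  have hB'₁ : ∀ s, B s ⊆ P → B' s = B s := fun s hs => if_pos hs
  have hB'₂ : ∀ s, ¬ B s ⊆ P → B' s = {(e (Sum.inl s.1)).1} := fun s hs => if_neg hs
  have hB'm : ∀ s, ∀ a ∈ B' s, a ∈ P ∨ a = (e (Sum.inl s.1)).1 := by
    intro s a ha
    by_cases hs : B s ⊆ P
    · rw [hB'₁ s hs] at ha; exact Or.inl (hs ha)
    · rw [hB'₂ s hs] at ha; exact Or.inr ha
  refine MinorOf.of_common_neighbors (B := B') (l := fun v => (τ v).1)
    (w := fun v => (e (Sum.inr (ι (τ v)))).1) ⟨?_, ?_, ?_⟩ ?_ ?_ ?_ ?_ ?_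
  · intro s
    by_cases hs : B s ⊆ P
    · rw [hB'₁ s hs]
      exact connected_induce_mono (fun u v h => (hR u v h).1) (hB.connected s)
    · rw [hB'₂ s hs]; exact connected_induce_singleton _ _
  · intro s t hst
    by_cases hs : B s ⊆ P <;> by_cases ht : B t ⊆ P
    · rw [hB'₁ s hs, hB'₁ t ht]; exact hB.disjoint s t hst
    · rw [hB'₁ s hs, hB'₂ t ht, disjoint_singleton_right]
      exact fun h => hPW _ (e _).2 (hs h)
    · rw [hB'₂ s hs, hB'₁ t ht, disjoint_singleton_left]
      exact fun h => hPW _ (e _).2 (ht h)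
    · rw [hB'₂ s hs, hB'₂ t ht, disjoint_singleton]
      intro h
      exact hst (Subtype.ext (Sum.inl_injective (e.injective (Subtype.ext h))))
  · intro s t hst
    obtain ⟨x, hx, y, hy, hxy⟩ := hB.adj s t hst
    obtain ⟨h1, h2, h3⟩ := hR x y hxy
    rw [hB'₁ s (hclosed s x hx h2), hB'₁ t (hclosed t y hy h3)]
    exact ⟨x, hx, y, hy, h1⟩
  · exact fun u v h => τ.injective (Subtype.ext h)
  · exact fun u v h => τ.injective (ι.injective (Sum.inr_injective (e.injective (Subtype.ext h))))
  · exact fun u v => hLW _ (τ u).2 _ (e _).2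
  · intro u v a ha
    rcases hB'm v a ha with h | rfl
    · exact hLP _ (τ u).2 a h
    · exact hLW _ (τ u).2 _ (e _).2
  · intro u v ha
    rcases hB'm v _ ha with h | h
    · exact hPW _ (e _).2 h
    · exact absurd (e.injective (Subtype.ext h)) (by simp)

section Sums

variable {V : Type*} [DecidableEq V] (G : SimpleGraph V) [DecidableRel G.Adj]

/-- The quadratic form of a sparse graph is bounded by a linear form for small entries. -/
theorem sum_adj_le_of_sparse {C : ℕ} (hsp : ∀ W : Finset V, degSum G W ≤ C * W.card) {x : V → ℝ}
    {δ : ℝ} (hx0 : ∀ v, 0 ≤ x v) (A : Finset V) (hx : ∀ v ∈ A, x v ≤ δ) :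
    ∑ u ∈ A, ∑ v ∈ A, (if G.Adj u v then x u * x v else 0) ≤ 2 * C * δ * ∑ v ∈ A, x v := by
  induction A using Finset.strongInduction with
  | H A ih =>
    rcases A.eq_empty_or_nonempty with rfl | hA
    · simp
    -- Degeneracy: the average degree inside `A` is at most `C`. Removing `a` loses one row and one
    -- column, each at most `C * δ * x a`.
    obtain ⟨a, ha, hdeg⟩ : ∃ a ∈ A, (A.filter (G.Adj a)).card ≤ C := by
      by_contra! hcon
      have h1 : ∑ _a ∈ A, C < degSum G A := Finset.sum_lt_sum_of_nonempty hA hcon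
      have h2 := hsp A
      rw [Finset.sum_const, smul_eq_mul, mul_comm] at h1
      omega
    have ih' := ih (A.erase a) (Finset.erase_ssubset ha)
      fun v hv => hx v (Finset.mem_of_mem_erase hv)
    have hδ : 0 ≤ δ := (hx0 a).trans (hx a ha)
    have hrow : ∑ v ∈ A, (if G.Adj a v then x a * x v else 0) ≤ C * δ * x a := by
      rw [← Finset.sum_filter]
      refine (Finset.sum_le_card_nsmul _ _ (x a * δ) fun v hv =>
        mul_le_mul_of_nonneg_left (hx v (Finset.mem_filter.mp hv).1) (hx0 a)).trans ?_
      rw [nsmul_eq_mul]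
      have h1 : ((A.filter (G.Adj a)).card : ℝ) ≤ C := by exact_mod_cast hdeg
      have h2 := mul_le_mul_of_nonneg_right h1 (mul_nonneg (hx0 a) hδ)
      linarith
    have hcol : ∑ u ∈ A.erase a, (if G.Adj u a then x u * x a else 0) ≤ C * δ * x a := by
      refine le_trans ?_ hrow
      refine (Finset.sum_le_sum_of_subset_of_nonneg (Finset.erase_subset a A) fun u _ _ => ?_).trans
        (le_of_eq (Finset.sum_congr rfl fun u _ => ?_))
      · split_ifs
        exacts [mul_nonneg (hx0 _) (hx0 _), le_rfl]
      · simp only [G.adj_comm u a, mul_comm]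
    rw [← Finset.add_sum_erase A _ ha, ← Finset.add_sum_erase A x ha]
    have hinner : ∑ u ∈ A.erase a, ∑ v ∈ A, (if G.Adj u v then x u * x v else 0) =
        ∑ u ∈ A.erase a, (if G.Adj u a then x u * x a else 0) +
        ∑ u ∈ A.erase a, ∑ v ∈ A.erase a, (if G.Adj u v then x u * x v else 0) := by
      rw [← Finset.sum_add_distrib]
      exact Finset.sum_congr rfl fun u _ => (Finset.add_sum_erase A _ ha).symm
    rw [hinner]
    linarith

/-- Edges from a set `A` to a set `B` in which every vertex of `A` has at most `M` neighbours. -/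
theorem sum_adj_le_of_card_inter_le [Fintype V] {M : ℕ} {x : V → ℝ} {δ : ℝ} (hx0 : ∀ v, 0 ≤ x v) (hδ : 0 ≤ δ)
    {A B : Finset V} (hM : ∀ u ∈ A, (G.neighborFinset u ∩ B).card ≤ M) (hx : ∀ v ∈ B, x v ≤ δ) :
    ∑ u ∈ A, ∑ v ∈ B, (if G.Adj u v then x u * x v else 0) ≤ M * δ * ∑ u ∈ A, x u := by
  rw [Finset.mul_sum]
  refine Finset.sum_le_sum fun u hu => ?_
  rw [← Finset.sum_filter]
  refine (Finset.sum_le_card_nsmul _ _ (x u * δ) fun v hv =>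
    mul_le_mul_of_nonneg_left (hx v (Finset.mem_filter.mp hv).1) (hx0 u)).trans ?_
  rw [nsmul_eq_mul]
  have h0 : B.filter (G.Adj u) = G.neighborFinset u ∩ B := by
    ext v; simp [and_comm]
  have h1 : ((B.filter (G.Adj u)).card : ℝ) ≤ M := by rw [h0]; exact_mod_cast hM u hu
  have h2 := mul_le_mul_of_nonneg_right h1 (mul_nonneg (hx0 u) hδ)
  linarith

end Sums

/-- Raising an entry to at least `1 / (2r)` leaves a linear gain exceeding the cost in squared norm
by at least `1 / (16r)`. This is needed because the nonnegative eigenvector may vanish on `A`, while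
the loss at the reserve is of order `1 / r`. -/
theorem entry_gain {r x : ℝ} (hr : 0 < r) (hx : 0 ≤ x) :
    1 / (16 * r) ≤ x + max 0 (1 / (2 * r) - x) - 2 * r * x * max 0 (1 / (2 * r) - x) -
      r * max 0 (1 / (2 * r) - x) ^ 2 := by
  have hinv : 1 / (16 * r) = 1 / r / 16 := by field_simp
  have hinv2 : 1 / (2 * r) = 1 / r / 2 := by field_simp
  have hri : r * (1 / r) = 1 := mul_one_div_cancel hr.ne'
  have hp : 0 < 1 / r := by positivity
  rw [hinv, hinv2]
  set i := 1 / r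
  rcases le_total (i / 2) x with h | h
  · rw [max_eq_left (by linarith)]
    simp only [mul_zero, sub_zero, add_zero, ne_eq, OfNat.ofNat_ne_zero, not_false_eq_true, zero_pow]
    linarith
  · rw [max_eq_right (by linarith)]
    have key : x + (i / 2 - x) - 2 * r * x * (i / 2 - x) - r * (i / 2 - x) ^ 2 =
        x + r * (i / 2 - x) ^ 2 + (1 - r * i) * (i / 2 - x) := by ring
    rw [key, hri]
    rcases le_total (i / 4) x with h' | h'
    · have : 0 ≤ r * (i / 2 - x) ^ 2 := by positivity
      linarith
    · have h1 : (i / 4) ^ 2 ≤ (i / 2 - x) ^ 2 := by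
        apply pow_le_pow_left₀ <;> linarith
      have h2 := mul_le_mul_of_nonneg_left h1 hr.le
      have h3 : r * (i / 4) ^ 2 = (r * i) * i / 16 := by ring
      rw [h3, hri] at h2
      linarith

end SimpleGraph

end

/-! ### Comparing quadratic forms before and after the exchange. -/

section

open Set

namespace SimpleGraph

variable {V : Type*} [DecidableEq V]

theorem sum_sum_ite_mem_and [Fintype V] (A B : Finset V) (p : V → V → Prop) [DecidableRel p] (f : V → V → ℝ) :
    ∑ u, ∑ v, (if u ∈ A ∧ v ∈ B ∧ p u v then f u v else 0) =
      ∑ u ∈ A, ∑ v ∈ B, if p u v then f u v else 0 := by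
  have h : ∀ u, ∑ v, (if u ∈ A ∧ v ∈ B ∧ p u v then f u v else 0) =
      if u ∈ A then ∑ v ∈ B, (if p u v then f u v else 0) else 0 := by
    intro u
    by_cases hu : u ∈ A
    · simp only [hu, true_and, if_true, ite_and, Finset.sum_ite_mem, Finset.univ_inter]
    · simp [hu]
  simp only [h, Finset.sum_ite_mem, Finset.univ_inter]

/-- `B` consists of the common neighbours of `L`, `A` of the remaining vertices outside `L`, and `R`
keeps the edges inside `B` except those at the vertices of the set `W ⊆ B`, which has no neighbours
in `A`. -/
structure IsExchange (G : SimpleGraph V) (L A B W : Finset V) (R : SimpleGraph V) : Prop where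
  cover : ∀ v ∉ L, v ∈ A ∨ v ∈ B
  notMem_of_A : ∀ v ∈ A, v ∉ L
  missing : ∀ v ∈ A, ∃ l ∈ L, ¬ G.Adj v l
  notMem_of_B : ∀ v ∈ B, v ∉ L
  adj_of_B : ∀ v ∈ B, ∀ l ∈ L, G.Adj v l
  subset : W ⊆ B
  not_adj : ∀ w ∈ W, ∀ a ∈ A, ¬ G.Adj w a
  adj_iff : ∀ u v, R.Adj u v ↔ G.Adj u v ∧ u ∈ B \ W ∧ v ∈ B \ W

namespace IsExchange

variable {G R : SimpleGraph V} {L A B W : Finset V}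
  [DecidableRel (joinGraph (L : Set V) R).Adj]

/-- The new edges are the missing pairs between `A` and `L` and inside `L`; every lost edge lies
inside `A`, between `A` and `B`, or between `W` and `B`. Counting a loss twice only weakens the
bound, as the entries are nonnegative. -/
theorem entry_ge [DecidableRel G.Adj] (h : IsExchange G L A B W R) {x : V → ℝ} (hx : ∀ v, 0 ≤ x v) (u v : V) :
    (if u ∈ A ∧ v ∈ L ∧ ¬ G.Adj u v then x u * x v else 0) +
      (if v ∈ A ∧ u ∈ L ∧ ¬ G.Adj v u then x v * x u else 0) +
      (if u ∈ L ∧ v ∈ L ∧ (u ≠ v ∧ ¬ G.Adj u v) then x u * x v else 0) -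
      (if u ∈ A ∧ v ∈ A ∧ G.Adj u v then x u * x v else 0) -
      (if u ∈ A ∧ v ∈ B ∧ G.Adj u v then x u * x v else 0) -
      (if v ∈ A ∧ u ∈ B ∧ G.Adj v u then x v * x u else 0) -
      (if u ∈ W ∧ v ∈ B ∧ G.Adj u v then x u * x v else 0) -
      (if v ∈ W ∧ u ∈ B ∧ G.Adj v u then x v * x u else 0) +
      (if G.Adj u v then x u * x v else 0) ≤
    if (joinGraph (L : Set V) R).Adj u v then x u * x v else 0 := by
  have hnn : 0 ≤ x u * x v := mul_nonneg (hx u) (hx v)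
  have hnn' : 0 ≤ x v * x u := mul_nonneg (hx v) (hx u)
  have hjoin : (joinGraph (L : Set V) R).Adj u v ↔ u ≠ v ∧ (u ∈ L ∨ v ∈ L ∨ R.Adj u v) := Iff.rfl
  have hAL := h.notMem_of_A
  have hBL := h.notMem_of_B
  have hWL : ∀ v ∈ W, v ∉ L := fun v hv => hBL v (h.subset hv)
  have hcomm := G.adj_comm u v
  by_cases hu : u ∈ L
  · have uA : u ∉ A := fun hh => hAL u hh hu
    have uB : u ∉ B := fun hh => hBL u hh hu
    have uW : u ∉ W := fun hh => hWL u hh hu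
    by_cases hv : v ∈ L
    · have vA : v ∉ A := fun hh => hAL v hh hv
      have vB : v ∉ B := fun hh => hBL v hh hv
      have vW : v ∉ W := fun hh => hWL v hh hv
      by_cases hadj : G.Adj u v
      · simp [hu, hv, uA, uB, uW, vA, vB, vW, hadj, hjoin, hadj.ne]
      · by_cases huv : u = v <;> simp [hu, hv, uA, uB, uW, vA, vB, vW, hadj, hjoin, huv]
    · have huv : u ≠ v := fun hh => hv (hh ▸ hu)
      rcases h.cover v hv with vA | vB
      · by_cases hadj : G.Adj u v <;>
          simp [hu, hv, uA, uB, uW, vA, hadj, hcomm.symm, hjoin, huv, mul_comm]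
      · have hadj : G.Adj u v := (h.adj_of_B v vB u hu).symm
        have vA : v ∉ A := fun hh => by
          obtain ⟨l, hl, hvl⟩ := h.missing v hh
          exact hvl (h.adj_of_B v vB l hl)
        simp [hu, hv, uA, uB, uW, vA, vB, hadj, hjoin, huv]
  · by_cases hv : v ∈ L
    · have vA : v ∉ A := fun hh => hAL v hh hv
      have vB : v ∉ B := fun hh => hBL v hh hv
      have vW : v ∉ W := fun hh => hWL v hh hv
      have huv : u ≠ v := fun hh => hu (hh ▸ hv)
      rcases h.cover u hu with uA | uB
      · by_cases hadj : G.Adj u v <;>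
          simp [hu, hv, vA, vB, vW, uA, hadj, hjoin, huv]
      · have hadj : G.Adj u v := h.adj_of_B u uB v hv
        have uA : u ∉ A := fun hh => by
          obtain ⟨l, hl, hvl⟩ := h.missing u hh
          exact hvl (h.adj_of_B u uB l hl)
        simp [hu, hv, vA, vB, vW, uA, uB, hadj, hjoin, huv]
    · have c1 : 0 ≤ if u ∈ A ∧ v ∈ A ∧ G.Adj u v then x u * x v else 0 := by
        split_ifs <;> simp [hnn]
      have c2 : 0 ≤ if u ∈ A ∧ v ∈ B ∧ G.Adj u v then x u * x v else 0 := by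
        split_ifs <;> simp [hnn]
      have c3 : 0 ≤ if v ∈ A ∧ u ∈ B ∧ G.Adj v u then x v * x u else 0 := by
        split_ifs <;> simp [hnn']
      have c4 : 0 ≤ if u ∈ W ∧ v ∈ B ∧ G.Adj u v then x u * x v else 0 := by
        split_ifs <;> simp [hnn]
      have c5 : 0 ≤ if v ∈ W ∧ u ∈ B ∧ G.Adj v u then x v * x u else 0 := by
        split_ifs <;> simp [hnn']
      have a1 : (if u ∈ A ∧ v ∈ L ∧ ¬ G.Adj u v then x u * x v else 0) = 0 := by simp [hv]
      have a2 : (if v ∈ A ∧ u ∈ L ∧ ¬ G.Adj v u then x v * x u else 0) = 0 := by simp [hu]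
      have a3 : (if u ∈ L ∧ v ∈ L ∧ (u ≠ v ∧ ¬ G.Adj u v) then x u * x v else 0) = 0 := by
        simp [hu]
      have a4 : 0 ≤ if (joinGraph (L : Set V) R).Adj u v then x u * x v else 0 := by
        split_ifs <;> simp [hnn]
      by_cases hadj : G.Adj u v
      · rw [if_pos hadj]
        by_cases hR : R.Adj u v
        · have : (joinGraph (L : Set V) R).Adj u v := ⟨hadj.ne, Or.inr (Or.inr hR)⟩
          rw [if_pos this]
          linarith
        · rw [h.adj_iff] at hR
          rcases h.cover u hu with uA | uB
          · rcases h.cover v hv with vA | vB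
            · rw [if_pos (⟨uA, vA, hadj⟩ : u ∈ A ∧ v ∈ A ∧ G.Adj u v)] at *
              linarith
            · rw [if_pos (⟨uA, vB, hadj⟩ : u ∈ A ∧ v ∈ B ∧ G.Adj u v)] at *
              linarith
          · rcases h.cover v hv with vA | vB
            · rw [if_pos (⟨vA, uB, hadj.symm⟩ : v ∈ A ∧ u ∈ B ∧ G.Adj v u)] at *
              linarith [mul_comm (x u) (x v)]
            · by_cases uW : u ∈ W
              · rw [if_pos (⟨uW, vB, hadj⟩ : u ∈ W ∧ v ∈ B ∧ G.Adj u v)] at *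
                linarith
              · have vW : v ∈ W := by
                  by_contra vW
                  exact hR ⟨hadj, Finset.mem_sdiff.mpr ⟨uB, uW⟩, Finset.mem_sdiff.mpr ⟨vB, vW⟩⟩
                rw [if_pos (⟨vW, uB, hadj.symm⟩ : v ∈ W ∧ u ∈ B ∧ G.Adj v u)] at *
                linarith [mul_comm (x u) (x v)]
      · rw [if_neg hadj]
        linarith

theorem quadForm_ge [Fintype V] [DecidableRel G.Adj] (h : IsExchange G L A B W R)
    {x : V → ℝ} (hx : ∀ v, 0 ≤ x v) :
    2 * ∑ u ∈ A, ∑ v ∈ L, (if ¬ G.Adj u v then x u * x v else 0) +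
      ∑ u ∈ L, ∑ v ∈ L, (if u ≠ v ∧ ¬ G.Adj u v then x u * x v else 0) -
      ∑ u ∈ A, ∑ v ∈ A, (if G.Adj u v then x u * x v else 0) -
      2 * ∑ u ∈ A, ∑ v ∈ B, (if G.Adj u v then x u * x v else 0) -
      2 * ∑ u ∈ W, ∑ v ∈ B, (if G.Adj u v then x u * x v else 0) + quadForm G x ≤
    quadForm (joinGraph (L : Set V) R) x := by
  have hsum := Finset.sum_le_sum fun u (_ : u ∈ Finset.univ) =>
    Finset.sum_le_sum fun v (_ : v ∈ Finset.univ) => h.entry_ge hx u v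
  simp only [Finset.sum_add_distrib, Finset.sum_sub_distrib] at hsum
  rw [Finset.sum_comm (f := fun u v => if v ∈ A ∧ u ∈ L ∧ ¬ G.Adj v u then x v * x u else 0),
    Finset.sum_comm (f := fun u v => if v ∈ A ∧ u ∈ B ∧ G.Adj v u then x v * x u else 0),
    Finset.sum_comm (f := fun u v => if v ∈ W ∧ u ∈ B ∧ G.Adj v u then x v * x u else 0)] at hsum
  rw [sum_sum_ite_mem_and A L (fun u v => ¬ G.Adj u v) fun u v => x u * x v,
    sum_sum_ite_mem_and L L (fun u v => u ≠ v ∧ ¬ G.Adj u v) fun u v => x u * x v,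
    sum_sum_ite_mem_and A A (fun u v => G.Adj u v) fun u v => x u * x v,
    sum_sum_ite_mem_and A B (fun u v => G.Adj u v) fun u v => x u * x v,
    sum_sum_ite_mem_and W B (fun u v => G.Adj u v) fun u v => x u * x v] at hsum
  unfold quadForm
  linarith

/-- The effect on the quadratic form of raising the entries on `A`. -/
theorem quadForm_add_ge [Fintype V] (h : IsExchange G L A B W R) {x z : V → ℝ} (hx : ∀ v, 0 ≤ x v)
    (hz : ∀ v, 0 ≤ z v) :
    quadForm (joinGraph (L : Set V) R) x + 2 * ∑ u ∈ A, ∑ v ∈ L, z u * x v ≤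
      quadForm (joinGraph (L : Set V) R) fun v => x v + z v := by
  have hpt : ∀ u v, (if (joinGraph (L : Set V) R).Adj u v then x u * x v else 0) +
      (if u ∈ A ∧ v ∈ L ∧ True then z u * x v else 0) + (if v ∈ A ∧ u ∈ L ∧ True then z v * x u else 0) ≤
      if (joinGraph (L : Set V) R).Adj u v then (x u + z u) * (x v + z v) else 0 := by
    intro u v
    have n1 := mul_nonneg (hz u) (hx v)
    have n2 := mul_nonneg (hz v) (hx u)
    have n3 := mul_nonneg (hz u) (hz v)
    have hexp : (x u + z u) * (x v + z v) = x u * x v + z u * x v + z v * x u + z u * z v := by ring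
    have b1 : (if u ∈ A ∧ v ∈ L ∧ True then z u * x v else 0) ≤ z u * x v := by
      split_ifs <;> simp [n1]
    have b2 : (if v ∈ A ∧ u ∈ L ∧ True then z v * x u else 0) ≤ z v * x u := by
      split_ifs <;> simp [n2]
    by_cases hadj : (joinGraph (L : Set V) R).Adj u v
    · rw [if_pos hadj, if_pos hadj, hexp]
      linarith
    · have h1 : ¬ (u ∈ A ∧ v ∈ L ∧ True) := fun hh =>
        hadj ⟨fun e => h.notMem_of_A u hh.1 (e ▸ hh.2.1), Or.inr (Or.inl hh.2.1)⟩
      have h2 : ¬ (v ∈ A ∧ u ∈ L ∧ True) := fun hh =>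
        hadj ⟨fun e => h.notMem_of_A v hh.1 (e ▸ hh.2.1), Or.inl hh.2.1⟩
      rw [if_neg hadj, if_neg hadj, if_neg h1, if_neg h2]
      simp
  have hsum := Finset.sum_le_sum fun u (_ : u ∈ Finset.univ) =>
    Finset.sum_le_sum fun v (_ : v ∈ Finset.univ) => hpt u v
  simp only [Finset.sum_add_distrib] at hsum
  rw [Finset.sum_comm (f := fun u v => if v ∈ A ∧ u ∈ L ∧ True then z v * x u else 0),
    sum_sum_ite_mem_and A L (fun _ _ => True) fun u v => z u * x v] at hsum
  simp only [if_true] at hsum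
  unfold quadForm
  beta_reduce
  linarith

end IsExchange

end SimpleGraph

end

/-! ### The exchange raises the spectral radius. -/

section

open Set

namespace SimpleGraph

/-- Making the vertices of `L` dominating at the expense of the edges at `A` and `W` increases the
spectral radius. -/
theorem IsExchange.exists_lt_quadForm {V : Type*} [Fintype V] [DecidableEq V]
    {G R : SimpleGraph V} [DecidableRel G.Adj] {L A B W : Finset V}
    [DecidableRel (joinGraph (L : Set V) R).Adj] (h : IsExchange G L A B W R) {C M : ℕ} {r δ : ℝ}
    {x : V → ℝ} (hx : SparseEigen G C r x) (hr : 1 ≤ r) (hδ : 0 ≤ δ) (hL : L.Nonempty)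
    (hxL : ∀ v ∈ L, 1 - δ ≤ x v) (hxR : ∀ v ∉ L, x v ≤ δ)
    (hM : ∀ v ∉ L, (G.neighborFinset v ∩ B).card ≤ M) (hδ₁ : δ * (1 + C + M) ≤ 1 / 2)
    (hδ₂ : 2 * (M * δ * (W.card * (L.card + 1))) < 1 / 16)
    (hne : A.Nonempty ∨ ∃ u ∈ L, ∃ v ∈ L, u ≠ v ∧ ¬ G.Adj u v) :
    ∃ y : V → ℝ, r * ∑ v, y v ^ 2 < quadForm (joinGraph (L : Set V) R) y := by
  have hr0 : 0 < r := by linarith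
  have hCδ : (0 : ℝ) ≤ C * δ := by positivity
  have hMδ : (0 : ℝ) ≤ M * δ := by positivity
  have hδ₁' : δ + C * δ + M * δ ≤ 1 / 2 := by linarith
  have hδh : δ ≤ 1 / 2 := by linarith
  have hAL := h.notMem_of_A
  have hBL := h.notMem_of_B
  have hxA0 : 0 ≤ ∑ u ∈ A, x u := Finset.sum_nonneg fun u _ => hx.nonneg u
  -- missing edges between `A` and `L`
  have s1 : (1 - δ) * ∑ u ∈ A, x u ≤
      ∑ u ∈ A, ∑ v ∈ L, (if ¬ G.Adj u v then x u * x v else 0) := by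
    rw [Finset.mul_sum]
    refine Finset.sum_le_sum fun u hu => ?_
    obtain ⟨l, hl, hul⟩ := h.missing u hu
    refine le_trans ?_ (Finset.single_le_sum (f := fun v => if ¬ G.Adj u v then x u * x v else 0)
      (fun v _ => ?_) hl)
    · rw [if_pos hul, mul_comm]
      exact mul_le_mul_of_nonneg_left (hxL l hl) (hx.nonneg u)
    · split_ifs
      exacts [le_rfl, mul_nonneg (hx.nonneg _) (hx.nonneg _)]
  have hbnn : ∀ u ∈ L, 0 ≤ ∑ v ∈ L, (if u ≠ v ∧ ¬ G.Adj u v then x u * x v else 0) :=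
    fun u _ => Finset.sum_nonneg fun v _ => by
      split_ifs
      exacts [mul_nonneg (hx.nonneg _) (hx.nonneg _), le_rfl]
  have s2 : 0 ≤ ∑ u ∈ L, ∑ v ∈ L, (if u ≠ v ∧ ¬ G.Adj u v then x u * x v else 0) :=
    Finset.sum_nonneg hbnn
  have s2' : (∃ u ∈ L, ∃ v ∈ L, u ≠ v ∧ ¬ G.Adj u v) →
      1 / 4 ≤ ∑ u ∈ L, ∑ v ∈ L, (if u ≠ v ∧ ¬ G.Adj u v then x u * x v else 0) := by
    rintro ⟨u, hu, v, hv, huv⟩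
    refine le_trans ?_ (Finset.single_le_sum hbnn hu)
    refine le_trans ?_ (Finset.single_le_sum
      (f := fun v => if u ≠ v ∧ ¬ G.Adj u v then x u * x v else 0) (fun v _ => ?_) hv)
    · rw [if_pos huv]
      have h1 : (1 / 2 : ℝ) ≤ x u := by linarith [hxL u hu]
      have h2 : (1 / 2 : ℝ) ≤ x v := by linarith [hxL v hv]
      have := mul_le_mul h1 h2 (by norm_num) (hx.nonneg u)
      linarith
    · split_ifs
      exacts [mul_nonneg (hx.nonneg _) (hx.nonneg _), le_rfl]
  have s3 := sum_adj_le_of_sparse G hx.sparse hx.nonneg A fun v hv => hxR v (hAL v hv)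
  have s4 := sum_adj_le_of_card_inter_le G hx.nonneg hδ (A := A) (B := B)
    (fun u hu => hM u (hAL u hu)) fun v hv => hxR v (hBL v hv)
  have s5 := sum_adj_le_of_card_inter_le G hx.nonneg hδ (A := W) (B := B)
    (fun u hu => hM u (hBL u (h.subset hu))) fun v hv => hxR v (hBL v hv)
  -- entries on the reserve
  have hxW : ∀ w ∈ W, x w ≤ (L.card + 1) / r := by
    intro w hw
    rw [le_div_iff₀ hr0, mul_comm, ← hx.eigen]
    -- Because the reserve has no neighbours in `A`, its entries are of order `1 / r`, which is what
    -- keeps the loss there below the gain.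
    have hsub : G.neighborFinset w ⊆ L ∪ (G.neighborFinset w ∩ B) := by
      intro v hv
      by_cases hvL : v ∈ L
      · exact Finset.mem_union_left _ hvL
      · rcases h.cover v hvL with hA | hB
        · exact absurd ((mem_neighborFinset _ _ _).mp hv) (h.not_adj w hw v hA)
        · exact Finset.mem_union_right _ (Finset.mem_inter.mpr ⟨hv, hB⟩)
    have h1 := Finset.sum_le_sum_of_subset_of_nonneg hsub fun v _ _ => hx.nonneg v
    have h2 : ∑ v ∈ L ∪ (G.neighborFinset w ∩ B), x v ≤
        ∑ v ∈ L, x v + ∑ v ∈ G.neighborFinset w ∩ B, x v := by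
      rw [← Finset.sum_union_inter]
      exact le_add_of_nonneg_right (Finset.sum_nonneg fun v _ => hx.nonneg v)
    have h3 : ∑ v ∈ L, x v ≤ L.card := by
      refine (Finset.sum_le_card_nsmul _ _ 1 fun v _ => hx.le_one v).trans (by simp)
    have h4 : ∑ v ∈ G.neighborFinset w ∩ B, x v ≤ M * δ := by
      refine (Finset.sum_le_card_nsmul _ _ δ fun v hv =>
        hxR v (hBL v (Finset.mem_inter.mp hv).2)).trans ?_
      rw [nsmul_eq_mul]
      have : ((G.neighborFinset w ∩ B).card : ℝ) ≤ M := by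
        exact_mod_cast hM w (hBL w (h.subset hw))
      exact mul_le_mul_of_nonneg_right this hδ
    linarith
  have s6 : ∑ w ∈ W, x w ≤ W.card * ((L.card + 1) / r) := by
    rw [← nsmul_eq_mul]
    exact Finset.sum_le_card_nsmul _ _ _ hxW
  have s7 : 2 * (M * δ * ∑ w ∈ W, x w) ≤ 2 * (M * δ * (W.card * (L.card + 1))) / r := by
    have := mul_le_mul_of_nonneg_left s6 hMδ
    calc 2 * (M * δ * ∑ w ∈ W, x w) ≤ 2 * (M * δ * (W.card * ((L.card + 1) / r))) := by linarith
      _ = _ := by ring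
  have hD := h.quadForm_ge hx.nonneg
  have hG : quadForm G x = r * ∑ v, x v ^ 2 := quadForm_eq_of_eigen hx.eigen
  -- The gain `2(1 - δ)` per unit of entry on `A` outweighs the losses `2Cδ + 2Mδ` with at least one
  -- unit to spare.
  have hmain : ∑ u ∈ A, x u +
      ∑ u ∈ L, ∑ v ∈ L, (if u ≠ v ∧ ¬ G.Adj u v then x u * x v else 0) -
      2 * (M * δ * (W.card * (L.card + 1))) / r + r * ∑ v, x v ^ 2 ≤
      quadForm (joinGraph (L : Set V) R) x := by
    have h1 : (δ + C * δ + M * δ) * ∑ u ∈ A, x u ≤ 1 / 2 * ∑ u ∈ A, x u :=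
      mul_le_mul_of_nonneg_right hδ₁' hxA0
    linarith
  -- raise the entries on `A`
  let z : V → ℝ := fun v => if v ∈ A then max 0 (1 / (2 * r) - x v) else 0
  have hz : ∀ v, 0 ≤ z v := fun v => by
    simp only [z]
    split_ifs
    exacts [le_max_left _ _, le_rfl]
  have hZ := h.quadForm_add_ge hx.nonneg hz
  have hcross : ∑ u ∈ A, z u ≤ 2 * ∑ u ∈ A, ∑ v ∈ L, z u * x v := by
    rw [Finset.mul_sum]
    refine Finset.sum_le_sum fun u _ => ?_
    obtain ⟨l, hl⟩ := hL
    have h1 := Finset.single_le_sum (f := fun v => z u * x v)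
      (fun v _ => mul_nonneg (hz u) (hx.nonneg v)) hl
    have h2 : (1 / 2 : ℝ) ≤ x l := by linarith [hxL l hl]
    have h3 := mul_le_mul_of_nonneg_left h2 (hz u)
    linarith
  have hsq : ∑ v, (x v + z v) ^ 2 = ∑ v, x v ^ 2 + ∑ u ∈ A, (2 * x u * z u + z u ^ 2) := by
    have h1 : ∀ v, (x v + z v) ^ 2 =
        x v ^ 2 + if v ∈ A then (2 * x v * z v + z v ^ 2) else 0 := by
      intro v
      by_cases hv : v ∈ A
      · rw [if_pos hv]; ring
      · simp [z, hv]
    simp only [h1, Finset.sum_add_distrib, Finset.sum_ite_mem, Finset.univ_inter]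
  have hgain : A.card * (1 / (16 * r)) ≤
      ∑ u ∈ A, x u + ∑ u ∈ A, z u - r * ∑ u ∈ A, (2 * x u * z u + z u ^ 2) := by
    rw [Finset.mul_sum, ← Finset.sum_add_distrib, ← Finset.sum_sub_distrib, ← nsmul_eq_mul]
    refine Finset.card_nsmul_le_sum _ _ _ fun u hu => ?_
    have := entry_gain hr0 (hx.nonneg u)
    simp only [z, hu, if_true]
    linarith
  refine ⟨fun v => x v + z v, ?_⟩
  rw [hsq, mul_add]
  have hκ : 2 * (M * δ * (W.card * (L.card + 1))) / r < 1 / 16 / r :=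
    div_lt_div_of_pos_right hδ₂ hr0
  have hcard0 : 0 ≤ A.card * (1 / (16 * r)) := by positivity
  rcases hne with hA | hcl
  · have h1 : (1 : ℝ) ≤ A.card := by exact_mod_cast Finset.card_pos.mpr hA
    have h2 : 1 * (1 / (16 * r)) ≤ A.card * (1 / (16 * r)) :=
      mul_le_mul_of_nonneg_right h1 (by positivity)
    have h3 : 1 / 16 / r = 1 * (1 / (16 * r)) := by field_simp
    linarith
  · have h1 := s2' hcl
    have h2 : 1 / 16 / r ≤ 1 / 16 := div_le_self (by norm_num) hr
    linarith

end SimpleGraph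

end

/-! ### Constructing the exchange and using extremality. -/

section

open Set

namespace SimpleGraph

/-- At most `M(n - |B|)` vertices of `B` have a neighbour in `A`, so enough of `B` remains from
which to choose the reserve. -/
theorem exists_isExchange {V : Type*} [Fintype V] [DecidableEq V] (G : SimpleGraph V)
    [DecidableRel G.Adj] {L B : Finset V} {M w : ℕ}
    (hB : ∀ v, v ∈ B ↔ ∀ l ∈ L, G.Adj l v)
    (hM : ∀ v ∉ L, (G.neighborFinset v ∩ B).card ≤ M)
    (hw : w + M * (Fintype.card V - B.card) ≤ B.card) :
    ∃ (W : Finset V) (R : SimpleGraph V), W.card = w ∧ IsExchange G L (L ∪ B)ᶜ B W R := by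
  have hBL : ∀ v ∈ B, v ∉ L := fun v hv hl => (((hB v).1 hv) v hl).ne rfl
  set A : Finset V := (L ∪ B)ᶜ with hA
  have hAB : A.card ≤ Fintype.card V - B.card := by
    rw [← Finset.card_compl]
    exact Finset.card_le_card (Finset.compl_subset_compl.2 Finset.subset_union_right)
  have hbad : (A.biUnion fun a => G.neighborFinset a ∩ B).card ≤
      M * (Fintype.card V - B.card) := by
    refine (Finset.card_biUnion_le_card_mul _ _ M fun a ha => hM a ?_).trans ?_
    · simp only [hA, Finset.mem_compl, Finset.mem_union, not_or] at ha
      exact ha.1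
    · rw [mul_comm]
      exact Nat.mul_le_mul_left _ hAB
  obtain ⟨W, hW, hWc⟩ := Finset.exists_subset_card_eq (s := B \ A.biUnion fun a =>
      G.neighborFinset a ∩ B) (n := w) (by
    have := Finset.le_card_sdiff (A.biUnion fun a => G.neighborFinset a ∩ B) B
    omega)
  refine ⟨W, { Adj := fun u v => G.Adj u v ∧ u ∈ B \ W ∧ v ∈ B \ W
               symm := ⟨fun u v h => ⟨h.1.symm, h.2.2, h.2.1⟩⟩
               loopless := ⟨fun u h => h.1.ne rfl⟩ }, hWc, ?_⟩
  refine ⟨fun v hv => ?_, fun v hv => ?_, fun v hv => ?_, hBL, fun v hv l hl =>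
    ((hB v).1 hv l hl).symm, hW.trans Finset.sdiff_subset, fun w hw a ha hwa => ?_,
    fun u v => Iff.rfl⟩
  · by_cases h : v ∈ B
    · exact Or.inr h
    · exact Or.inl (by simp [hA, hv, h])
  · simp only [hA, Finset.mem_compl, Finset.mem_union, not_or] at hv
    exact hv.1
  · simp only [hA, Finset.mem_compl, Finset.mem_union, not_or, hB, not_forall] at hv
    obtain ⟨-, l, hl, h⟩ := hv
    exact ⟨l, hl, fun h' => h h'.symm⟩
  · have hw' := Finset.mem_sdiff.1 (hW hw)
    exact hw'.2 (Finset.mem_biUnion.2 ⟨a, ha, Finset.mem_inter.2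
      ⟨(G.mem_neighborFinset a w).2 hwa.symm, hw'.1⟩⟩)

theorem le_quadForm_joinGraph_bot {V : Type*} [Fintype V] [DecidableEq V] (L : Finset V)
    [DecidableRel (joinGraph (L : Set V) ⊥).Adj] {a b : ℝ} (ha : 0 ≤ a) :
    2 * (L.card * (Fintype.card V - L.card) * (a * b)) ≤
      quadForm (joinGraph (L : Set V) ⊥) (fun v => if v ∈ L then a else b) := by
  have h1 : ∀ u v : V, (if u ∈ L then if v ∈ Lᶜ then a * b else 0 else 0) +
      (if u ∈ Lᶜ then if v ∈ L then a * b else 0 else 0) ≤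
      if (joinGraph (L : Set V) ⊥).Adj u v then
        (if u ∈ L then a else b) * (if v ∈ L then a else b) else 0 := by
    intro u v
    have hj : (joinGraph (L : Set V) ⊥).Adj u v ↔ u ≠ v ∧ (u ∈ L ∨ v ∈ L) := by
      simp [joinGraph]
    simp only [hj, Finset.mem_compl]
    by_cases hu : u ∈ L <;> by_cases hv : v ∈ L
    · simp only [hu, hv, not_true_eq_false, if_true, if_false, add_zero]
      split_ifs <;> positivity
    · have : u ≠ v := fun h => hv (h ▸ hu)
      simp [hu, hv, this]
    · have : u ≠ v := fun h => hu (h ▸ hv)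
      simp [hu, hv, this, mul_comm]
    · simp [hu, hv]
  refine le_trans (le_of_eq ?_) (Finset.sum_le_sum fun u _ => Finset.sum_le_sum fun v _ => h1 u v)
  have hc : ((Lᶜ : Finset V).card : ℝ) = Fintype.card V - L.card := by
    rw [Finset.card_compl, Nat.cast_sub (Finset.card_le_univ L)]
  have h2 : ∀ (S T : Finset V), ∑ u, ∑ v, (if u ∈ S then if v ∈ T then a * b else 0 else 0) =
      S.card * T.card * (a * b) := by
    intro S T
    have : ∀ u, ∑ v, (if u ∈ S then if v ∈ T then a * b else 0 else 0) =
        if u ∈ S then T.card * (a * b) else 0 := by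
      intro u
      split_ifs <;> simp
    simp only [this, Finset.sum_ite_mem, Finset.univ_inter, Finset.sum_const, nsmul_eq_mul,
      mul_assoc]
  simp only [Finset.sum_add_distrib, h2, hc]
  ring

/-- A bound for the quadratic form of the join of a `k`-set with an independent set gives
`k (n - k) ≤ r ^ 2`. -/
theorem mul_card_sub_le_sq {V : Type*} [Fintype V] [DecidableEq V] (L : Finset V)
    [DecidableRel (joinGraph (L : Set V) ⊥).Adj] {r : ℝ}
    (h : ∀ y, quadForm (joinGraph (L : Set V) ⊥) y ≤ r * ∑ v, y v ^ 2) :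
    (L.card : ℝ) * (Fintype.card V - L.card) ≤ r ^ 2 := by
  set k : ℝ := (L.card : ℝ) with hk
  have hc : ((Lᶜ : Finset V).card : ℝ) = Fintype.card V - k := by
    rw [Finset.card_compl, Nat.cast_sub (Finset.card_le_univ L)]
  set m : ℝ := (Fintype.card V : ℝ) - k with hm
  have hk0 : 0 ≤ k := Nat.cast_nonneg _
  have hm0 : 0 ≤ m := hc ▸ Nat.cast_nonneg _
  -- The test vector is `√(n - k)` on `L` and `√k` elsewhere, the Perron vector of `K_{k,n-k}` when
  -- both sides are nonempty.
  have h1 := (le_quadForm_joinGraph_bot L (b := √k) (Real.sqrt_nonneg m)).trans (h _)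
  have h2 : ∑ v, (if v ∈ L then √m else √k) ^ 2 = 2 * (k * m) := by
    have : ∀ v, (if v ∈ L then √m else √k) ^ 2 =
        (if v ∈ L then m else 0) + (if v ∈ Lᶜ then k else 0) := by
      intro v
      by_cases hv : v ∈ L <;> simp [hv, Real.sq_sqrt, hk0, hm0]
    simp only [this, Finset.sum_add_distrib, Finset.sum_ite_mem, Finset.univ_inter,
      Finset.sum_const, nsmul_eq_mul, hc]
    ring
  rw [h2, ← hk, ← hm] at h1
  rcases (mul_nonneg hk0 hm0).eq_or_lt with h0 | h0
  · rw [← h0]; positivity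
  have h3 : √m * √k ≤ r := by
    by_contra hlt
    push Not at hlt
    nlinarith [mul_pos h0 (sub_pos.2 hlt)]
  calc k * m = (√m * √k) ^ 2 := by rw [mul_pow, Real.sq_sqrt hk0, Real.sq_sqrt hm0, mul_comm]
    _ ≤ r ^ 2 := by gcongr

end SimpleGraph

namespace FinGraph

open SimpleGraph

/-- Extremality in the form used throughout: a competitor on the same vertices can be refuted by a
single test vector. -/
theorem quadForm_le_of_mem_SPEX {n : ℕ} {F : Set FinGraph} {G : FinGraph} (hG : G ∈ SPEX n F)
    [Fintype G.V] [Nonempty G.V] {r : ℝ} (hr : 0 ≤ r) (hrho : G.rho = ENNReal.ofReal r)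
    {J : SimpleGraph G.V} [DecidableRel J.Adj] (hJ : ∀ H ∈ F, ¬ MinorOf H.graph J)
    (y : G.V → ℝ) : quadForm J y ≤ r * ∑ v, y v ^ 2 := by
  have h1 := hG.2.2 ⟨G.V, J⟩ hG.1 fun H hH h => hJ H hH (isMinor_iff.1 h)
  obtain ⟨s, -, hs, hq, -⟩ := exists_perron ⟨G.V, J⟩
  rw [hs, hrho, ENNReal.ofReal_le_ofReal_iff hr] at h1
  exact (hq y).trans (mul_le_mul_of_nonneg_right h1 (Finset.sum_nonneg fun v _ => sq_nonneg _))

theorem exists_sparseEigen {n : ℕ} {F : Set FinGraph} {G : FinGraph} (hG : G ∈ SPEX n F)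
    [Fintype G.V] [DecidableEq G.V] [DecidableRel G.graph.Adj] [Nonempty G.V] {H : FinGraph}
    (hH : H ∈ F) :
    ∃ (r : ℝ) (x : G.V → ℝ) (z : G.V), G.rho = ENNReal.ofReal r ∧
      SparseEigen G.graph (2 ^ H.order) r x ∧ x z = 1 := by
  obtain ⟨r, hr, hrho, -, x, hx, ⟨v, hv⟩, heig⟩ := exists_perron G
  obtain ⟨z, -, hz⟩ := Finset.exists_max_image Finset.univ x ⟨v, Finset.mem_univ v⟩
  have hzpos : 0 < x z := ((hx v).lt_of_ne' hv).trans_le (hz v (Finset.mem_univ v))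
  refine ⟨r, fun u => x u / x z, z, hrho, ⟨fun W => ?_, hr, fun u => ?_, fun u => ?_,
    fun u => ?_⟩, div_self hzpos.ne'⟩
  · exact degSum_le_of_not_minorOf G.graph (fun h => hG.2.1 H hH (isMinor_iff.2 h)) W
  · exact div_nonneg (hx u) hzpos.le
  · exact (div_le_one hzpos).2 (hz u (Finset.mem_univ u))
  · rw [← Finset.sum_div, heig, mul_div_assoc]

theorem not_minorOf_joinGraph_of_isExchange {F : Set FinGraph} {h : ℕ} {V : Type} [Finite V]
    [DecidableEq V] {G R : SimpleGraph V} {L A B W : Finset V} (hex : IsExchange G L A B W R)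
    (hF : ∀ H ∈ F, ¬ MinorOf H.graph G) (hLF : ∀ H ∈ F, L.card ≤ H.order)
    (hW : h + L.card ≤ W.card) : ∀ H ∈ F, H.order ≤ h →
      ¬ MinorOf H.graph (joinGraph (L : Set V) R) := by
  intro H hH hh hm
  refine hF H hH (MinorOf.of_joinGraph_restrict (P := ((B \ W : Finset V) : Set V)) (W := W) hh
    (by rw [ncard_coe_finset]; exact hLF H hH) (by rwa [ncard_coe_finset])
    (fun u v huv => (hex.adj_iff u v).1 huv) (fun v hv hv' => ?_) (fun l hl v hv => ?_)
    (fun l hl v hv => (hex.adj_of_B v (hex.subset hv) l hl).symm) hm)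
  · exact (Finset.mem_sdiff.1 (Finset.mem_coe.1 hv')).2 hv
  · exact (hex.adj_of_B v (Finset.mem_sdiff.1 (Finset.mem_coe.1 hv)).1 l hl).symm

end FinGraph

end

/-! ### Existence of the dominating vertices. -/

section

open Set

namespace FinGraph

open SimpleGraph

theorem exists_small_parameter (C M w k : ℕ) :
    ∃ δ : ℝ, 0 < δ ∧ δ * (1 + C + M) ≤ 1 / 2 ∧ 2 * (M * δ * (w * (k + 1))) < 1 / 16 ∧
      k * δ * (M + 1) ≤ 1 / 2 := by
  have hlim : ∀ c ε : ℝ, 0 < ε → ∀ᶠ δ : ℝ in nhdsWithin 0 (Ioi 0), c * δ < ε := by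
    intro c ε hε
    have h : Filter.Tendsto (fun δ : ℝ => c * δ) (nhds 0) (nhds (c * 0)) :=
      (continuous_const.mul continuous_id).tendsto 0
    rw [mul_zero] at h
    exact (h.mono_left nhdsWithin_le_nhds).eventually_lt_const hε
  obtain ⟨δ, ⟨⟨h₁, h₂⟩, h₃⟩, h₀⟩ := (((hlim (1 + C + M) (1 / 2) (by norm_num)).and
    (hlim (2 * M * (w * (k + 1))) (1 / 16) (by norm_num))).and
    (hlim (k * (M + 1)) (1 / 2) (by norm_num))).and self_mem_nhdsWithin |>.exists
  exact ⟨δ, h₀, by linarith, by linarith, by linarith⟩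

theorem add_mul_sub_le_of_near_full {n b M w k : ℕ} {δ : ℝ} (hb : b ≤ n) (hw : 2 * w ≤ n)
    (hn : (n : ℝ) - k * (δ * n) ≤ b) (hδ : k * δ * (M + 1) ≤ 1 / 2) : w + M * (n - b) ≤ b := by
  have hw' : (2 : ℝ) * w ≤ n := by exact_mod_cast hw
  have h₁ := mul_le_mul_of_nonneg_right hδ (Nat.cast_nonneg (α := ℝ) n)
  have h₂ := mul_le_mul_of_nonneg_left hn (by positivity : (0 : ℝ) ≤ (M : ℝ) + 1)
  have h₃ : (w : ℝ) + M * (n - b) ≤ b := by linarith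
  rw [← Nat.cast_sub hb] at h₃
  exact_mod_cast h₃

/-- A large spectral extremal graph has `γ_F` dominating vertices. -/
theorem exists_card_eq_familyGamma_dominating {F : Set FinGraph} (hF : F.Nonempty)
    (hdeg : ∀ H ∈ F, H.MinDegreePos) (hstar : ∀ H ∈ F, ¬ H.IsStar) :
    ∃ N : ℕ, ∀ n : ℕ, N ≤ n → ∀ G ∈ SPEX n F, ∃ L : Finset G.V,
      L.card = familyGamma F ∧ ∀ l ∈ L, G.graph.IsUniversal l := by
  classical
  have ho : ∀ H ∈ F, H.order = H.gamma + H.alpha + 1 := fun H hH =>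
    order_eq_gamma_add (hdeg H hH) (hstar H hH)
  obtain ⟨H₀, hH₀, hγ⟩ := exists_gamma_eq_familyGamma hF
  obtain ⟨h, hh⟩ := exists_order_bound hF ho
  have hk : 1 ≤ familyGamma F := hγ ▸ one_le_gamma (hdeg H₀ hH₀) (hstar H₀ hH₀)
  have hkF : ∀ H ∈ F, familyGamma F ≤ H.order := fun H hH =>
    (familyGamma_le hH).trans (by rw [ho H hH]; omega)
  set k := familyGamma F with hkdef
  set M := H₀.order with hM
  -- Room in the reserve for the vertices of a member of order at most `h` and for the `k` vertices
  -- contracted into `L`.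
  set w := h + k with hw
  obtain ⟨δ, hδ0, hδ₁, hδ₂, hδ₃⟩ := exists_small_parameter (2 ^ M) M w k
  obtain ⟨N, hN⟩ := exists_dominant_set hk Nat.one_le_two_pow M hδ0
  refine ⟨N + 2 * w + 2 * k + 2, fun n hn G hG => ?_⟩
  let _ := Fintype.ofFinite G.V
  have hcard : Fintype.card G.V = n := by rw [← Nat.card_eq_fintype_card]; exact hG.1
  have : Nonempty G.V := Fintype.card_pos_iff.1 (by omega)
  have hGF : ∀ H ∈ F, ¬ MinorOf H.graph G.graph := fun H hH hm => hG.2.1 H hH (isMinor_iff.2 hm)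
  obtain ⟨r, x, z, hrho, hx, hz⟩ := exists_sparseEigen hG hH₀
  have hcommon : ∀ X : Finset G.V, X.card = k + 1 →
      (Finset.univ.filter fun v => ∀ y ∈ X, G.graph.Adj y v).card < M := by
    intro X hX
    convert card_common_neighbors_lt (ho H₀ hH₀) (hGF H₀ hH₀) (X := X) (by rw [hX, hγ])
  have hr2 : (k : ℝ) * (Fintype.card G.V - k) ≤ r ^ 2 := by
    obtain ⟨L₀, -, hL₀⟩ := Finset.exists_subset_card_eq (s := (Finset.univ : Finset G.V)) (n := k)
      (by rw [Finset.card_univ]; omega)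
    rw [← hL₀]
    refine mul_card_sub_le_sq L₀ fun y =>
      quadForm_le_of_mem_SPEX hG hx.r_nonneg hrho (fun H hH => ?_) y
    exact not_minorOf_joinGraph_bot (ho H hH)
      (by rw [ncard_coe_finset, hL₀]; exact familyGamma_le hH)
  have hr1 : 1 ≤ r := by
    have h1 : (1 : ℝ) ≤ k := by exact_mod_cast hk
    have h2 : (2 : ℝ) * k + 2 ≤ Fintype.card G.V := by rw [hcard]; exact_mod_cast (by omega)
    nlinarith [hx.r_nonneg]
  obtain ⟨L, hLk, hLx, hLδ⟩ := hN G.graph r x z (by omega) hx hcommon hr2 hz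
  have hLne : L.Nonempty := Finset.card_pos.1 (by omega)
  set B : Finset G.V := Finset.univ.filter fun v => ∀ l ∈ L, G.graph.Adj l v with hB
  have hBmem : ∀ v, v ∈ B ↔ ∀ l ∈ L, G.graph.Adj l v := by simp [hB]
  -- Neighbours of `v` in `B` are common neighbours of the `k + 1` vertices `L ∪ {v}`.
  have hMB : ∀ v ∉ L, (G.graph.neighborFinset v ∩ B).card ≤ M := by
    intro v hv
    refine le_trans (Finset.card_le_card fun u hu => ?_)
      (hcommon (insert v L) (by rw [Finset.card_insert_of_notMem hv, hLk])).le
    rw [Finset.mem_inter, mem_neighborFinset, hBmem] at hu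
    simpa using hu
  have hBcard : (Fintype.card G.V : ℝ) - k * (δ * Fintype.card G.V) ≤ B.card := by
    rw [← hLk]
    refine SparseEigen.card_sub_le_card_common G.graph fun y hy => ?_
    linarith [(hLx y hy).2]
  have hwB : w + M * (Fintype.card G.V - B.card) ≤ B.card :=
    add_mul_sub_le_of_near_full (Finset.card_le_univ B) (by omega) hBcard hδ₃
  obtain ⟨W, R, hWw, hex⟩ := exists_isExchange G.graph hBmem hMB hwB
  -- Rerouting through the reserve excludes only members of order at most `h`; the choice of `h`
  -- extends this to the whole family.
  have hJ : ∀ H ∈ F, ¬ MinorOf H.graph (joinGraph (L : Set G.V) R) :=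
    hh G.V L R (by rw [ncard_coe_finset, hLk]) (not_minorOf_joinGraph_of_isExchange hex hGF
      (fun H hH => hLk ▸ hkF H hH) (by rw [hLk, hWw]))
  have hno : ¬ ((L ∪ B)ᶜ.Nonempty ∨ ∃ u ∈ L, ∃ v ∈ L, u ≠ v ∧ ¬ G.graph.Adj u v) := by
    intro hne
    obtain ⟨y, hy⟩ := hex.exists_lt_quadForm hx hr1 hδ0.le hLne (fun v hv => (hLx v hv).1) hLδ hMB
      hδ₁ (by rw [hWw, hLk]; exact hδ₂) hne
    exact absurd hy (quadForm_le_of_mem_SPEX hG hx.r_nonneg hrho hJ y).not_gt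
  push Not at hno
  refine ⟨L, hLk, fun l hl v hlv => ?_⟩
  by_cases hv : v ∈ L
  · exact hno.2 l hl v hv hlv
  · have h1 : v ∉ (L ∪ B)ᶜ := by rw [hno.1]; simp
    have h2 : v ∈ B := by simpa [hv] using h1
    exact (hBmem v).1 h2 l hl

end FinGraph

end

/-! ### Saturation outside the dominating vertices. -/

section

open Set

namespace SimpleGraph

theorem joinGraph_eq_self {V : Type*} {G : SimpleGraph V} {L : Set V}
    (hL : ∀ l ∈ L, G.IsUniversal l) : joinGraph L G = G := by
  ext u v
  constructor
  · rintro ⟨hne, hu | hv | h⟩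
    · exact hL u hu hne
    · exact (hL v hv hne.symm).symm
    · exact h
  · exact fun h => ⟨h.ne, Or.inr (Or.inr h)⟩

theorem induce_sup_edge {V : Type*} (G : SimpleGraph V) {S : Set V} (u v : S) :
    (G ⊔ edge (u : V) v).induce S = G.induce S ⊔ edge u v := by
  ext a b
  simp [edge_adj, Subtype.ext_iff]

theorem quadForm_lt_of_le {V : Type*} [Fintype V] {G G' : SimpleGraph V} [DecidableRel G.Adj]
    [DecidableRel G'.Adj] (hle : G ≤ G') {x : V → ℝ} (hx : ∀ v, 0 ≤ x v) {u v : V}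
    (h : ¬ G.Adj u v) (h' : G'.Adj u v) (hu : 0 < x u) (hv : 0 < x v) :
    quadForm G x < quadForm G' x := by
  have hterm : ∀ a b, (if G.Adj a b then x a * x b else 0) ≤
      if G'.Adj a b then x a * x b else 0 := by
    intro a b
    have := mul_nonneg (hx a) (hx b)
    by_cases hab : G.Adj a b
    · simp [hab, hle hab]
    · rw [if_neg hab]
      split_ifs <;> simp [this]
  refine Finset.sum_lt_sum (fun a _ => Finset.sum_le_sum fun b _ => hterm a b)
    ⟨u, Finset.mem_univ u, Finset.sum_lt_sum (fun b _ => hterm u b) ⟨v, Finset.mem_univ v, ?_⟩⟩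
  rw [if_neg h, if_pos h']
  exact mul_pos hu hv

/-- If `x l` vanished, the eigenvalue equation at `l` would kill all entries; every other vertex
sees `l`, so its entry is positive too. -/
theorem pos_of_eigen_of_isUniversal {V : Type*} [Fintype V] {G : SimpleGraph V}
    [DecidableRel G.Adj] {r : ℝ} {x : V → ℝ} (hr : 0 ≤ r) (hx : ∀ v, 0 ≤ x v)
    (hne : ∃ v, x v ≠ 0) (h : ∀ u, ∑ v ∈ G.neighborFinset u, x v = r * x u) {l : V}
    (hl : G.IsUniversal l) (u : V) : 0 < x u := by
  have hle : ∀ a b, G.Adj a b → x b ≤ r * x a := fun a b hab => h a ▸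
    Finset.single_le_sum (f := x) (fun v _ => hx v) ((G.mem_neighborFinset a b).2 hab)
  have hxl : 0 < x l := by
    refine (hx l).lt_of_ne' fun h0 => ?_
    obtain ⟨v, hv⟩ := hne
    have hlv : l ≠ v := fun hh => hv (hh ▸ h0)
    have := hle l v (hl hlv)
    rw [h0, mul_zero] at this
    exact hv (le_antisymm this (hx v))
  by_cases hul : l = u
  · exact hul ▸ hxl
  · exact pos_of_mul_pos_right (hxl.trans_le (hle u l (hl hul).symm)) hr

end SimpleGraph

namespace FinGraph

open SimpleGraph

/-- A graph in which `D` is universal equals its own join with `D`, so the join criterion applies,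
followed by descent to an irreducible subgraph. No extremality is assumed, so the equivalence also
serves for `G + uv`. -/
theorem exists_isMinor_iff_exists_mem_Gam {F : Set FinGraph} (hF : ∀ H ∈ F, familyGamma F ≤ H.order)
    {G : FinGraph} {D : Set G.V} (hD : D.ncard = familyGamma F)
    (hU : ∀ v ∈ D, G.graph.IsUniversal v) :
    (∃ H ∈ F, H.IsMinor G) ↔ ∃ K ∈ Gam F, K.IsMinor (G.delete D) := by
  have key : ∀ H ∈ F, H.IsMinor G ↔ ∃ S : Set H.V, S.ncard = H.order - familyGamma F ∧
      (H.induce S).IsMinor (G.delete D) := by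
    intro H hH
    have hle : familyGamma F ≤ Nat.card H.V := hF H hH
    have h := minorOf_joinGraph_iff (H := H.graph) (R := G.graph) (hD.trans_le hle)
    rw [joinGraph_eq_self hU] at h
    rw [isMinor_iff, h]
    refine exists_congr fun S => and_congr ?_
      (isMinor_iff (H := H.induce S) (G := G.delete D)).symm
    rw [hD, order]
    omega
  constructor
  · rintro ⟨H, hH, hm⟩
    obtain ⟨S, hS, hm⟩ := (key H hH).1 hm
    obtain ⟨K, hK, hm⟩ := exists_irreducibleInduced_isMinor hm
    rw [hS] at hK
    exact ⟨K, mem_biUnion hH hK, hm⟩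
  · rintro ⟨K, hK, hm⟩
    obtain ⟨H, hH, ⟨⟨S, hS, rfl⟩, -⟩⟩ := mem_iUnion₂.1 hK
    exact ⟨H, hH, (key H hH).2 ⟨S, hS, hm⟩⟩

/-- Otherwise `G + uv` would be a competitor with a strictly larger quadratic form at the positive
Perron vector of `G`. -/
theorem not_minorFree_addEdge_of_mem_SPEX {n : ℕ} {F : Set FinGraph} {G : FinGraph}
    (hG : G ∈ SPEX n F) {l u v : G.V} (hl : G.graph.IsUniversal l) (huv : u ≠ v)
    (hadj : ¬ G.graph.Adj u v) : ∃ H ∈ F, H.IsMinor (G.addEdge u v) := by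
  classical
  let _ := Fintype.ofFinite G.V
  have : Nonempty G.V := ⟨l⟩
  by_contra! hno
  obtain ⟨r, hr, hrho, -, x, hx, hne, heig⟩ := exists_perron G
  have hpos := pos_of_eigen_of_isUniversal hr hx hne heig hl
  have h1 := quadForm_le_of_mem_SPEX hG hr hrho (J := G.graph ⊔ edge u v)
    (fun H hH hm => hno H hH (isMinor_iff.2 hm)) x
  have h2 := quadForm_lt_of_le (G := G.graph) (G' := G.graph ⊔ edge u v) le_sup_left hx hadj
    (by simp [edge_adj, huv]) (hpos u) (hpos v)
  rw [quadForm_eq_of_eigen heig] at h2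
  exact absurd h2 h1.not_gt

theorem delete_mem_SAT_of_mem_SPEX {n : ℕ} {F : Set FinGraph}
    (hF : ∀ H ∈ F, familyGamma F ≤ H.order) (hk : 1 ≤ familyGamma F) {G : FinGraph}
    (hG : G ∈ SPEX n F) {D : Set G.V} (hD : D.ncard = familyGamma F)
    (hU : ∀ v ∈ D, G.graph.IsUniversal v) :
    G.delete D ∈ SAT (n - familyGamma F) (Gam F) := by
  obtain ⟨l, hl⟩ : D.Nonempty := nonempty_of_ncard_ne_zero (by omega)
  refine ⟨?_, fun K hK hm => ?_, fun u v huv hadj => ?_⟩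
  · have h := ncard_add_ncard_compl D
    rw [hD, show Nat.card G.V = n from hG.1] at h
    rw [show (G.delete D).order = Dᶜ.ncard from Nat.card_coe_set_eq _]
    omega
  · obtain ⟨H, hH, hm⟩ := (exists_isMinor_iff_exists_mem_Gam hF hD hU).2 ⟨K, hK, hm⟩
    exact hG.2.1 H hH hm
  · obtain ⟨u, hu⟩ := u
    obtain ⟨v, hv⟩ := v
    have hU' : ∀ w ∈ D, (G.addEdge u v).graph.IsUniversal w := fun w hw a hwa =>
      Or.inl (hU w hw hwa)
    obtain ⟨K, hK, hm⟩ := (exists_isMinor_iff_exists_mem_Gam (G := G.addEdge u v) hF hD hU').1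
      (not_minorFree_addEdge_of_mem_SPEX hG (hU l hl) (fun h => huv (Subtype.ext h)) hadj)
    refine ⟨K, hK, isMinor_iff.2 ?_⟩
    have h := isMinor_iff.1 hm
    have heq : ((G.addEdge u v).delete D).graph = ((G.delete D).addEdge ⟨u, hu⟩ ⟨v, hv⟩).graph :=
      induce_sup_edge G.graph (S := Dᶜ) ⟨u, hu⟩ ⟨v, hv⟩
    exact heq ▸ h

/-- One more dominating vertex would give `γ_H + 1` vertices with at least `|H|` common neighbours,
forcing `H` as a minor. -/
theorem eq_dominatingVertices {F : Set FinGraph} {n : ℕ} {G H : FinGraph} (hG : G ∈ SPEX n F)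
    (hH : H ∈ F) (ho : H.order = H.gamma + H.alpha + 1) (hn : H.gamma + 1 + H.order ≤ n)
    {L : Finset G.V} (hL : L.card = H.gamma) (hU : ∀ l ∈ L, G.graph.IsUniversal l) :
    G.dominatingVertices = L := by
  classical
  let _ := Fintype.ofFinite G.V
  refine Subset.antisymm (fun v hv => ?_) hU
  by_contra hvL
  have hvL : v ∉ L := hvL
  have hX : (insert v L).card = H.gamma + 1 := by rw [Finset.card_insert_of_notMem hvL, hL]
  have h1 := card_common_neighbors_lt ho (fun h => hG.2.1 H hH (isMinor_iff.2 h)) hX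
  have h2 : (insert v L)ᶜ ⊆ Finset.univ.filter fun w => ∀ y ∈ insert v L, G.graph.Adj y w := by
    intro w hw
    refine Finset.mem_filter.2 ⟨Finset.mem_univ w, fun y hy => ?_⟩
    have hyw : y ≠ w := fun h => Finset.mem_compl.1 hw (h ▸ hy)
    rcases Finset.mem_insert.1 hy with rfl | hy
    · exact hv hyw
    · exact hU y hy hyw
  have h3 := Finset.card_le_card h2
  have hcard : Fintype.card G.V = n := by rw [← Nat.card_eq_fintype_card]; exact hG.1
  rw [Finset.card_compl, hX, hcard] at h3
  have h4 : H.order ≤ n - (H.gamma + 1) := by omega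
  refine absurd h1 (not_lt.2 (h4.trans (h3.trans (le_of_eq ?_))))
  congr!

theorem familyGamma_singleton (H : FinGraph) : familyGamma {H} = H.gamma := by
  rw [familyGamma, image_singleton, csInf_singleton]

end FinGraph

end

theorem theorem1p2 (F : Set FinGraph) (hF : F.Nonempty)
    (hdeg : ∀ H ∈ F, H.MinDegreePos) (hstar : ∀ H ∈ F, ¬ H.IsStar) :
    ∃ N : ℕ, ∀ n : ℕ, N ≤ n → ∀ G ∈ FinGraph.SPEX n F,
      G.dominatingVertices.ncard = FinGraph.familyGamma F ∧
      G.delete G.dominatingVertices ∈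
        FinGraph.SAT (n - FinGraph.familyGamma F) (FinGraph.Gam F) ∧
      ∀ H : FinGraph, F = {H} →
        G.delete G.dominatingVertices ∈
          FinGraph.SAT (n - H.gamma) (FinGraph.irreducibleInduced (H.alpha + 1) H) := by
  have ho : ∀ H ∈ F, H.order = H.gamma + H.alpha + 1 := fun H hH =>
    FinGraph.order_eq_gamma_add (hdeg H hH) (hstar H hH)
  obtain ⟨H₀, hH₀, hγ⟩ := FinGraph.exists_gamma_eq_familyGamma hF
  have hk : 1 ≤ FinGraph.familyGamma F := hγ ▸ FinGraph.one_le_gamma (hdeg H₀ hH₀) (hstar H₀ hH₀)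
  have hkF : ∀ H ∈ F, FinGraph.familyGamma F ≤ H.order := fun H hH =>
    (FinGraph.familyGamma_le hH).trans (by rw [ho H hH]; omega)
  obtain ⟨N, hN⟩ := FinGraph.exists_card_eq_familyGamma_dominating hF hdeg hstar
  refine ⟨N + (H₀.gamma + 1 + H₀.order), fun n hn G hG => ?_⟩
  obtain ⟨L, hL, hU⟩ := hN n (by omega) G hG
  have hD : G.dominatingVertices = L :=
    FinGraph.eq_dominatingVertices hG hH₀ (ho H₀ hH₀) (by omega) (hL.trans hγ.symm) hU
  have hcard : G.dominatingVertices.ncard = FinGraph.familyGamma F := by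
    rw [hD, Set.ncard_coe_finset, hL]
  have hsat := FinGraph.delete_mem_SAT_of_mem_SPEX hkF hk hG hcard fun v hv => hv
  refine ⟨hcard, hsat, ?_⟩
  rintro H rfl
  have hGam : FinGraph.Gam {H} = FinGraph.irreducibleInduced (H.alpha + 1) H := by
    rw [FinGraph.Gam, Set.biUnion_singleton, FinGraph.familyGamma_singleton, ho H rfl]
    congr 1
    omega
  rwa [hGam, FinGraph.familyGamma_singleton] at hsat
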